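/- Let $m\in\{2,3,4,6\}$, $\omega=e^{2\pi i/m}$, and let $\Lambda\subset\mathbb C$ be a lattice with $\omega\Lambda=\Lambda$. Let $\sigma,\zeta,\wp$ be the Weierstrass functions of $\Lambda$, and let $\eta:\mathbb C\to\mathbb C$ be the $\mathbb R$-linear map with $\eta(\gamma)=\zeta(z+\gamma)-\zeta(z)$ for $\gamma\in\Lambda$. Let $s$ act on $\mathcal E=\mathbb C/\Lambda$ by multiplication by $\omega$, and put $\Omega_l=1-\omega^l$, with the index $l\in\mathbb Z/m$. A set of couplings $c$ consists of numbers $c_l(x)\in\mathbb C$ for $l\in\mathbb Z/m\setminus\{0\}$ and $x\in\mathcal E$ such that $c_l(x)=0$ unless $s^lx=x$, and $c_l(sx)=c_l(x)$. Put $$\varphi(x,z)=\frac{\sigma(x-z)}{\sigma(x)\sigma(-z)},\qquad v_{l,c}(x,z)=\sum_{x_i}c_l(x_i)\,e^{-\eta(\Omega_lx_i)z}\,\varphi(x-x_i,\Omega_{-l}z),$$ the sum being over the points $x_i$ of $\mathcal E$ fixed by $s^l$, and define the dual couplings by $$c_l^\vee(x_i)=\frac1{\Omega_l}\sum_{x_j}c_{-l}(x_j)\,e^{\eta(\Omega_lx_i)x_j-\eta(\Omega_{-l}x_j)x_i}\quad\text{if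 } s^lx_i=x_i,$$ and $c_l^\vee(x_i)=0$ otherwise. (The summands do not depend on the representatives of $x_i$, $x_j$ in $\mathbb C$.) The classical elliptic Dunkl operator is $y^c=p-\sum_{l\neq0}v_{l,c}(q,\alpha)s^l$, where $sp=\omega^{-1}ps$, $sq=\omega qs$. The Lax matrix $L=L(p,q;\alpha)$ is the matrix of left multiplication by $y^c$ on the crossed product of the functions of $(p,q)$ with $\mathbb Z/m$, in the basis $1,s,\dots,s^{m-1}$ of this crossed product as a right module over the functions: for $i,j\in\mathbb Z/m$, $$L_{ii}=\omega^ip,\qquad L_{ij}=-v_{i-j,c}(\omega^{-i}q,\alpha)\quad(i\ne j).$$ Let $L^\vee$ be the Lax matrix of $c^\vee$. Put $\mu_j(x)=\sum_{l\ne0}\omega^{-jl}c_l(x)$, and, with sums over the nonzero fixed points of $s,\dots,s^{m-1}$, $M_j=\sum_{x_i\neq0}\mu_j(x_i)$ and $f_j(q)=\sum_{x_i\ne0}\mu_j(x_i)\bigl(\zeta(q-x_i)-\zeta(q)+\zeta(x_i)\bigr)$. The hamiltonian of $c$ is $$h_c(p,q)=\prod_{j=0}^{m-1}(p-f_j(q))+\sum_{i=2}^m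 a_i\,\wp^{(i-2)}(q)\prod_{j=0}^{m-i-1}(p-f_j(q)),$$ where the constants $a_2,\dots,a_m$ are determined by $$\prod_{j=0}^{m-1}\Bigl(p-\frac{\mu_j(0)}q\Bigr)=\prod_{j=0}^{m-1}\Bigl(p+\frac{M_j}q\Bigr)+\sum_{i=2}^m(-1)^i(i-1)!\,\frac{a_i}{q^i}\prod_{j=0}^{m-i-1}\Bigl(p+\frac{M_j}q\Bigr).$$ The hamiltonian is regarded as defined up to an additive constant depending on the couplings. Then the following holds. 1. For every set of couplings $c$: $c^\vee$ is again a set of couplings; the constants $a_2,\dots,a_m$ exist and are unique; for every $l\ne0$, and all $x,z\in\mathbb C$ with $\Omega_lx,\Omega_lz\notin\Lambda$, $$v_{l,c}(x,z)=-v_{-l,c^\vee}(z,x);$$ and for all $p,k\in\mathbb C$ and all $q,\alpha\in\mathbb C$ that are not fixed points of any of $s,\dots,s^{m-1}$ modulo $\Lambda$, $$\det\bigl(L(p,q;\alpha)-k\,\mathrm{Id}\bigr)=-\det\bigl(L^\vee(k,\alpha;q)-p\,\mathrm{Id}\bigr).$$ 2. The additive constants of the hamiltonians can be chosen simultaneously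 for all couplings so that the spectral equation below holds: there is a function $c\mapsto\kappa(c)\in\mathbb C$ such that, with $h=h_c+\kappa(c)$ and $h^\vee=h_{c^\vee}+\kappa(c^\vee)$, for every set of couplings $c$ and all $p,q,k,\alpha$ as in 1, $$(-1)^m\det\bigl(L(p,q;\alpha)-k\,\mathrm{Id}\bigr)=h^\vee(k,\alpha)-h(p,q).$$ -/

import Mathlib

namespace EllipticDunkl

noncomputable section

/- Throughout, `L.ω₁`, `L.ω₂` are the full periods (often written `2ω₁`, `2ω₂`), so that
`L.lattice = ℤ L.ω₁ + ℤ L.ω₂`, and `PeriodPair.weierstrassP L` is the Weierstrass `℘`-function. -/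

/-- The Weierstrass `ζ`-function,
`ζ(z) = 1/z + ∑_{γ ≠ 0} (1/(z-γ) + 1/γ + z/γ²)`. -/
def wZeta (L : PeriodPair) (z : ℂ) : ℂ :=
  1 / z + ∑' γ : {γ : L.lattice // γ ≠ 0},
    (1 / (z - (γ.1 : ℂ)) + 1 / (γ.1 : ℂ) + z / (γ.1 : ℂ) ^ 2)

/-- The Weierstrass `σ`-function,
`σ(z) = z ∏_{γ ≠ 0} (1 - z/γ) exp(z/γ + z²/(2γ²))`. -/
def wSigma (L : PeriodPair) (z : ℂ) : ℂ :=
  z * ∏' γ : {γ : L.lattice // γ ≠ 0},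
    ((1 - z / (γ.1 : ℂ)) * Complex.exp (z / (γ.1 : ℂ) + z ^ 2 / (2 * (γ.1 : ℂ) ^ 2)))

/-- The `ℝ`-linear quasi-period map: `η(a ω₁ + b ω₂) = 2 a ζ(ω₁/2) + 2 b ζ(ω₂/2)`
for real `a`, `b` (and full periods `ω₁`, `ω₂`). -/
def eta (L : PeriodPair) (z : ℂ) : ℂ :=
  2 * (L.basis.repr z 0 : ℂ) * wZeta L (L.ω₁ / 2)
    + 2 * (L.basis.repr z 1 : ℂ) * wZeta L (L.ω₂ / 2)

/-- `φ(x, z) = σ(x - z) / (σ(x) σ(-z))`. -/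
def phi (L : PeriodPair) (x z : ℂ) : ℂ :=
  wSigma L (x - z) / (wSigma L x * wSigma L (-z))

/-- The elliptic curve `ℂ / Λ`. -/
abbrev Curve (L : PeriodPair) : Type := ℂ ⧸ L.lattice

/-- A representative in `ℂ` of a point of `ℂ / Λ`. -/
def rep (L : PeriodPair) (x : Curve L) : ℂ :=
  Function.surjInv L.lattice.mkQ_surjective x

/-- `ω ^ l`, where `ω = exp(2πi/m)` and `l ∈ ℤ/m`. -/
def om (m : ℕ) [NeZero m] (l : ZMod m) : ℂ := ZMod.stdAddChar l

/-- `Ω_l = 1 - ω ^ l`. The point `z` mod `Λ` is fixed by `s ^ l` iff `Ω_l z ∈ Λ`. -/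
def Om (m : ℕ) [NeZero m] (l : ZMod m) : ℂ := 1 - om m l

/-- Families `c_l(x)`, with `l ∈ ℤ/m` and `x ∈ ℂ / Λ`. -/
abbrev Family (L : PeriodPair) (m : ℕ) : Type := ZMod m → Curve L → ℂ

/-- `c` is a set of couplings: the parameters are `c_l(x)` for `l ≠ 0` and `x` fixed by `s ^ l`
(all other values are set to zero), and `c_l` is constant on the orbits of `ℤ/m`. -/
structure IsCoupling (L : PeriodPair) (m : ℕ) [NeZero m] (c : Family L m) : Prop where
  index_zero : ∀ x : Curve L, c 0 x = 0
  not_fixed : ∀ (l : ZMod m) (z : ℂ), Om m l * z ∉ L.lattice → c l (L.lattice.mkQ z) = 0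
  invariant : ∀ (l r : ZMod m) (z : ℂ), c l (L.lattice.mkQ (om m r * z)) = c l (L.lattice.mkQ z)

/-- The point `z` mod `Λ` is not fixed by any of `s, s ^ 2, …, s ^ (m-1)`. -/
def IsNotFixed (L : PeriodPair) (m : ℕ) [NeZero m] (z : ℂ) : Prop :=
  ∀ l : ZMod m, l ≠ 0 → Om m l * z ∉ L.lattice

/-- `v_{l,c}(x, z) = ∑_i c_l(x_i) exp(-η(Ω_l x_i) z) φ(x - x_i, Ω_{-l} z)`. For a set of couplings
only finitely many points of `ℂ / Λ`, namely the fixed points of `s ^ l`, contribute. -/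
def vKer (L : PeriodPair) (m : ℕ) [NeZero m] (c : Family L m) (l : ZMod m) (x z : ℂ) : ℂ :=
  ∑ᶠ y : Curve L, c l y * Complex.exp (-eta L (Om m l * rep L y) * z)
    * phi L (x - rep L y) (Om m (-l) * z)

open Classical in
/-- The dual couplings: for `l ≠ 0` and `x_i` fixed by `s ^ l`,
`c^∨_l(x_i) = Ω_l⁻¹ ∑_j c_{-l}(x_j) exp(η(Ω_l x_i) x_j - η(Ω_{-l} x_j) x_i)`. -/
def dual (L : PeriodPair) (m : ℕ) [NeZero m] (c : Family L m) : Family L m := fun l x =>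
  if l ≠ 0 ∧ Om m l * rep L x ∈ L.lattice then
    (Om m l)⁻¹ * ∑ᶠ y : Curve L, c (-l) y *
      Complex.exp (eta L (Om m l * rep L x) * rep L y - eta L (Om m (-l) * rep L y) * rep L x)
  else 0

/-- An element `∑_l a_l s^l` of the crossed product of the functions of `(p, q)` with `ℤ/m`,
where `s p = ω⁻¹ p s` and `s q = ω q s`, is recorded by its coefficients `l ↦ a_l(p, q)`. -/
abbrev Crossed (m : ℕ) : Type := ZMod m → ℂ → ℂ → ℂ

/-- The classical elliptic Dunkl operator `p - ∑_{l ≠ 0} v_l(q, α) s^l`. -/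
def dunkl (L : PeriodPair) (m : ℕ) [NeZero m] (c : Family L m) (α : ℂ) : Crossed m :=
  fun l p q => if l = 0 then p else -vKer L m c l q α

/-- The matrix of left multiplication by `a = ∑_l a_l s^l` on the crossed product, viewed as a free
right module over the functions of `(p, q)` with basis `1, s, …, s^(m-1)`:
since `a_l(p, q) s^i = s^i a_l(ω^i p, ω^(-i) q)`, one has
`a s^j = ∑_i s^i a_{i-j}(ω^i p, ω^(-i) q)`. -/
def leftMulMatrix (m : ℕ) [NeZero m] (a : Crossed m) (p q : ℂ) : Matrix (ZMod m) (ZMod m) ℂ :=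
  Matrix.of fun i j => a (i - j) (om m i * p) (om m (-i) * q)

/-- The Lax matrix `L(p, q; α)`, i.e. the matrix of the Dunkl operator. Its diagonal entries are
`ω^i p`, and its off-diagonal ones are `-v_{i-j}(ω^(-i) q, α)`. -/
def lax (L : PeriodPair) (m : ℕ) [NeZero m] (c : Family L m) (p q α : ℂ) :
    Matrix (ZMod m) (ZMod m) ℂ :=
  leftMulMatrix m (dunkl L m c α) p q

/-- `μ_j(x) = ∑_{l ≠ 0} ω^(-jl) c_l(x)` (recall that `c_0 = 0` for a set of couplings). -/
def mu (L : PeriodPair) (m : ℕ) [NeZero m] (c : Family L m) (j : ℕ) (x : Curve L) : ℂ :=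
  ∑ l : ZMod m, om m (-(j : ZMod m) * l) * c l x

/-- The sum of `μ_j(x)` over the nonzero fixed points `x`. -/
def muSum (L : PeriodPair) (m : ℕ) [NeZero m] (c : Family L m) (j : ℕ) : ℂ :=
  ∑ᶠ x ∈ ({0}ᶜ : Set (Curve L)), mu L m c j x

/-- `f_j(q) = ∑_{x ≠ 0} μ_j(x) (ζ(q - x) - ζ(q) + ζ(x))`, the sum being over the nonzero fixed
points. -/
def fSum (L : PeriodPair) (m : ℕ) [NeZero m] (c : Family L m) (j : ℕ) (q : ℂ) : ℂ :=
  ∑ᶠ x ∈ ({0}ᶜ : Set (Curve L)),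
    mu L m c j x * (wZeta L (q - rep L x) - wZeta L q + wZeta L (rep L x))

/-- The constants `a_2, …, a_m` entering the hamiltonian, as determined by the couplings:
`∏_{j<m} (p - μ_j(0)/q) = ∏_{j<m} (p + M_j/q)
  + ∑_{i=2}^m (-1)^i (i-1)! a_i q^{-i} ∏_{j<m-i} (p + M_j/q)`, with `M_j = muSum L m c j`
(the entries of `a` outside `2, …, m` are irrelevant and set to zero). -/
structure IsHamCoeff (L : PeriodPair) (m : ℕ) [NeZero m] (c : Family L m) (a : ℕ → ℂ) :
    Prop where
  eq_zero : ∀ i, i ∉ Finset.Icc 2 m → a i = 0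
  relation : ∀ p q : ℂ, q ≠ 0 →
    ∏ j ∈ Finset.range m, (p - mu L m c j 0 / q)
      = ∏ j ∈ Finset.range m, (p + muSum L m c j / q)
        + ∑ i ∈ Finset.Icc 2 m, (-1) ^ i * ((i - 1).factorial : ℂ) * a i / q ^ i
            * ∏ j ∈ Finset.range (m - i), (p + muSum L m c j / q)

/-- The classical hamiltonian
`h(p, q) = ∏_{j<m} (p - f_j(q)) + ∑_{i=2}^m a_i ℘^{(i-2)}(q) ∏_{j<m-i} (p - f_j(q))`. -/
def ham (L : PeriodPair) (m : ℕ) [NeZero m] (c : Family L m) (a : ℕ → ℂ) (p q : ℂ) : ℂ :=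
  ∏ j ∈ Finset.range m, (p - fSum L m c j q)
    + ∑ i ∈ Finset.Icc 2 m, a i * iteratedDeriv (i - 2) L.weierstrassP q
        * ∏ j ∈ Finset.range (m - i), (p - fSum L m c j q)

end

end EllipticDunkl

open EllipticDunkl

namespace EllipticDunkl

noncomputable section

open Filter Topology

/-! Kernel duality. As functions of z, one term of v_l(x, z) and a Fourier-type combination of the
terms of v_{-l}(z, x) have the same multipliers under Λ, the same simple poles and the same
residues. Their difference extends to an entire function with multipliers exp(-η(γ)a), a = Ω_l x ∉
Λ, and such a function is zero (`eq_zero_of_quasiperiodic`): an exponential factor makes the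
multipliers unimodular, Liouville makes the product constant, and a nonzero constant would produce
an elliptic function with a single simple pole. Summing over fixed points gives `vKer_duality`, and
comparing residues gives `dual_dual`. Together with homogeneity under ω, this shows that L - k and
L^∨ - p agree entrywise up to negating the indices and the row factors -ω^i, whose product is -1
(`det_lax_duality`).

Spectral equation. At a point x with stabilizer of order n and local coordinate t, consider the
algebra of polynomials in p generated over the analytic germs by tp and t⁻ⁿ ∏_{i<n} (tp - μ_i(x))
(`spherical`). The determinant lies in it: after a gauge and a finite Fourier transform the polar
part of the Lax matrix is a cyclic shift weighted by the tp - μ_r, and in each term of the Leibniz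
expansion the factors t⁻ⁿ are controlled by counting level crossings of a permutation (`flux_le`,
`det_mem_of_spherical`, `det_laxPoly_mem`). The hamiltonian lies in it as well: on the lattice by
the relation defining the a_i, elsewhere because the derivatives of ℘ vanish to the right order
(`hamPoly_mem`).

An element of degree at most d in p has p^d-coefficient g t^(d mod n) with g analytic
(`coeff_of_mem_spherical`). The sum (-1)^m det + h has degree below m and elliptic coefficients, so
its top coefficient is regular everywhere, hence constant, and for d ≠ 0 it vanishes at q = 0, where
n = m. Descending in the degree, the sum is independent of p and q (`exists_const_of_spherical`,
`exists_det_lax_eq`).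

Using this on both sides of the determinant duality gives the spectral equation up to a constant
K(c). Since duality is an involution, K(c^∨) = -K(c), and κ = -K/2 absorbs it. -/

/-- The nonzero lattice points. -/
abbrev Nonzero (L : PeriodPair) : Type := {γ : L.lattice // γ ≠ 0}

lemma Nonzero.coe_ne_zero {L : PeriodPair} (γ : Nonzero L) : ((γ.1 : L.lattice) : ℂ) ≠ 0 := by
  simpa using γ.2

/-! ### The Weierstrass functions: convergence, homogeneity, quasi-periods. -/

/-- The primary factor of genus two. -/
def primaryFactor (u : ℂ) : ℂ := (1 - u) * Complex.exp (u + u ^ 2 / 2)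

/-- The exponent is chosen so that the derivative vanishes to second order at 0. Integrating it
gives a cubic estimate, the decay that is summable over a lattice of rank two. -/
lemma hasDerivAt_primaryFactor (u : ℂ) :
    HasDerivAt primaryFactor (-(u ^ 2 * Complex.exp (u + u ^ 2 / 2))) u := by
  have h := ((hasDerivAt_id u).const_sub 1).mul
    (((hasDerivAt_id u).add (((hasDerivAt_id u).pow 2).div_const 2)).cexp)
  refine h.congr_deriv ?_
  simp only [id, Pi.add_apply, Pi.pow_apply]
  push_cast
  ring

lemma norm_primaryFactor_sub_one_le {u : ℂ} (hu : ‖u‖ ≤ 1) :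
    ‖primaryFactor u - 1‖ ≤ Real.exp 2 * ‖u‖ ^ 3 := by
  have key := (convex_closedBall (0 : ℂ) ‖u‖).norm_image_sub_le_of_norm_hasDerivWithin_le
    (f := primaryFactor) (C := Real.exp 2 * ‖u‖ ^ 2) (x := 0) (y := u)
    (fun x _ => (hasDerivAt_primaryFactor x).hasDerivWithinAt) ?_ (by simp) (by simp)
  · have h0 : primaryFactor 0 = 1 := by simp [primaryFactor]
    rw [h0, sub_zero] at key
    linarith [key, show Real.exp 2 * ‖u‖ ^ 2 * ‖u‖ = Real.exp 2 * ‖u‖ ^ 3 by ring]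
  · intro x hx
    have hx' : ‖x‖ ≤ ‖u‖ := by simpa using hx
    rw [norm_neg, norm_mul, norm_pow, mul_comm]
    gcongr
    refine (Complex.norm_exp_le_exp_norm _).trans (Real.exp_le_exp.mpr ?_)
    refine (norm_add_le _ _).trans ?_
    rw [norm_div, norm_pow]
    have : ‖x‖ ≤ 1 := hx'.trans hu
    have : ‖x‖ ^ 2 ≤ 1 := pow_le_one₀ (norm_nonneg _) this
    norm_num
    linarith

variable (L : PeriodPair)

lemma summable_nonzero_norm_pow_inv : Summable fun γ : Nonzero L => (‖(γ.1 : ℂ)‖ ^ 3)⁻¹ := by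
  have h := ZLattice.summable_norm_pow_inv L.lattice 3 (by simp)
  simpa [Function.comp_def] using
    h.comp_injective (i := fun γ : Nonzero L => γ.1) Subtype.val_injective

lemma eventually_cofinite_lt_norm (r : ℝ) : ∀ᶠ γ : Nonzero L in cofinite, r < ‖(γ.1 : ℂ)‖ := by
  have h : {l : L.lattice | ¬ r < ‖(l : ℂ)‖}.Finite := by
    refine (isCompact_iff_finite.mp (isCompact_closedBall (0 : L.lattice) r)).subset ?_
    intro l hl
    simpa using hl
  exact h.preimage (f := fun γ : Nonzero L => γ.1) Subtype.val_injective.injOn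

lemma primaryFactor_div (z γ : ℂ) :
    primaryFactor (z / γ) = (1 - z / γ) * Complex.exp (z / γ + z ^ 2 / (2 * γ ^ 2)) := by
  unfold primaryFactor
  congr 3
  rw [div_pow, div_div, mul_comm]

/-- The function `σ(z) / z`, extended to `z = 0`. -/
def sigmaProd (z : ℂ) : ℂ := ∏' γ : Nonzero L, primaryFactor (z / (γ.1 : ℂ))

lemma wSigma_eq (z : ℂ) : wSigma L z = z * sigmaProd L z := by
  simp only [wSigma, sigmaProd, primaryFactor_div]

lemma eventually_norm_primaryFactor_le (r : ℝ) (hr : 0 < r) :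
    ∀ᶠ γ : Nonzero L in cofinite, ∀ z ∈ Metric.ball (0 : ℂ) r,
      ‖primaryFactor (z / (γ.1 : ℂ)) - 1‖ ≤ Real.exp 2 * r ^ 3 * (‖(γ.1 : ℂ)‖ ^ 3)⁻¹ := by
  filter_upwards [eventually_cofinite_lt_norm L r] with γ hγ z hz
  have hz' : ‖z‖ < r := by simpa using hz
  have hγ0 : 0 < ‖(γ.1 : ℂ)‖ := hr.trans hγ
  have h1 : ‖z / (γ.1 : ℂ)‖ ≤ 1 := by
    rw [norm_div, div_le_one hγ0]; linarith
  refine (norm_primaryFactor_sub_one_le h1).trans ?_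
  rw [norm_div, div_pow, mul_assoc, div_eq_mul_inv]
  gcongr

lemma differentiable_primaryFactor : Differentiable ℂ primaryFactor :=
  fun u => (hasDerivAt_primaryFactor u).differentiableAt

lemma differentiable_primaryFactor_div (γ : ℂ) :
    Differentiable ℂ fun z => primaryFactor (z / γ) :=
  differentiable_primaryFactor.comp (by fun_prop)

lemma multipliableLocallyUniformlyOn_primaryFactor (r : ℝ) (hr : 0 < r) :
    MultipliableLocallyUniformlyOn
      (fun (γ : Nonzero L) z => primaryFactor (z / (γ.1 : ℂ))) (Metric.ball (0 : ℂ) r) := by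
  have h := Summable.multipliableLocallyUniformlyOn_one_add
    (f := fun (γ : Nonzero L) z => primaryFactor (z / (γ.1 : ℂ)) - 1)
    (K := Metric.ball (0 : ℂ) r) Metric.isOpen_ball
    ((summable_nonzero_norm_pow_inv L).mul_left (Real.exp 2 * r ^ 3))
    (eventually_norm_primaryFactor_le L r hr)
    (fun γ => ((differentiable_primaryFactor_div _).continuous.sub continuous_const).continuousOn)
  simpa using h

lemma differentiable_sigmaProd : Differentiable ℂ (sigmaProd L) := by
  intro z
  have hr : 0 < ‖z‖ + 1 := by positivity
  have h := (multipliableLocallyUniformlyOn_primaryFactor L _ hr).hasProdLocallyUniformlyOn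
  have := h.differentiableOn
    (.of_forall fun s => by
      refine DifferentiableOn.fun_finsetProd fun γ _ => ?_
      exact (differentiable_primaryFactor_div _).differentiableOn) Metric.isOpen_ball
  exact (this z (by simp)).differentiableAt (Metric.isOpen_ball.mem_nhds (by simp))

lemma primaryFactor_div_ne_zero {z γ : ℂ} (hγ : γ ≠ 0) (h : z ≠ γ) : primaryFactor (z / γ) ≠ 0 := by
  refine mul_ne_zero ?_ (Complex.exp_ne_zero _)
  rw [sub_ne_zero]
  intro e
  rw [eq_div_iff hγ] at e
  exact h (by simpa using e.symm)

lemma summable_norm_primaryFactor (z : ℂ) :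
    Summable fun γ : Nonzero L => ‖primaryFactor (z / (γ.1 : ℂ)) - 1‖ := by
  refine Summable.of_norm_bounded_eventually
    ((summable_nonzero_norm_pow_inv L).mul_left (Real.exp 2 * (‖z‖ + 1) ^ 3)) ?_
  filter_upwards [eventually_norm_primaryFactor_le L (‖z‖ + 1) (by positivity)] with γ h
  simpa using h z (by simp)

lemma sigmaProd_ne_zero {z : ℂ} (hz : ∀ γ : Nonzero L, z ≠ (γ.1 : ℂ)) : sigmaProd L z ≠ 0 := by
  have := tprod_one_add_ne_zero_of_summable
    (f := fun γ : Nonzero L => primaryFactor (z / (γ.1 : ℂ)) - 1)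
    (fun γ => by simpa using primaryFactor_div_ne_zero γ.coe_ne_zero (hz γ))
    (summable_norm_primaryFactor L z)
  simpa [sigmaProd] using this

lemma sigmaProd_zero : sigmaProd L 0 = 1 := by
  simp [sigmaProd, primaryFactor]

lemma wSigma_ne_zero {z : ℂ} (hz : z ∉ L.lattice) : wSigma L z ≠ 0 := by
  rw [wSigma_eq]
  refine mul_ne_zero (by rintro rfl; exact hz (zero_mem _)) (sigmaProd_ne_zero L ?_)
  rintro γ rfl
  exact hz γ.1.2

lemma differentiable_wSigma : Differentiable ℂ (wSigma L) := by
  have : wSigma L = fun z => z * sigmaProd L z := funext (wSigma_eq L)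
  rw [this]
  exact differentiable_id.mul (differentiable_sigmaProd L)

/-- The function `ζ(z) - 1/z`, extended to `z = 0`. -/
def zetaSum (z : ℂ) : ℂ := ∑' γ : Nonzero L,
    (1 / (z - (γ.1 : ℂ)) + 1 / (γ.1 : ℂ) + z / (γ.1 : ℂ) ^ 2)

lemma wZeta_eq (z : ℂ) : wZeta L z = 1 / z + zetaSum L z := rfl

lemma logDeriv_primaryFactor_div {z γ : ℂ} (hγ : γ ≠ 0) (h : z ≠ γ) :
    logDeriv (fun z => primaryFactor (z / γ)) z = 1 / (z - γ) + 1 / γ + z / γ ^ 2 := by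
  have hd : HasDerivAt (fun z => primaryFactor (z / γ))
      (-((z / γ) ^ 2 * Complex.exp (z / γ + (z / γ) ^ 2 / 2)) * (1 / γ)) z :=
    (hasDerivAt_primaryFactor (z / γ)).comp (h := fun w => w / γ) z
      ((hasDerivAt_id z).div_const γ)
  rw [logDeriv_apply, hd.deriv, div_eq_iff (primaryFactor_div_ne_zero hγ h), primaryFactor]
  have : z - γ ≠ 0 := sub_ne_zero.mpr h
  field_simp
  ring

lemma zeta_term_bound {r : ℝ} (hr : 0 < r) {z γ : ℂ} (hz : ‖z‖ < r) (h : 2 * r ≤ ‖γ‖) :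
    ‖1 / (z - γ) + 1 / γ + z / γ ^ 2‖ ≤ 2 * r ^ 2 * (‖γ‖ ^ 3)⁻¹ := by
  have hγ : 0 < ‖γ‖ := by linarith
  have hγ0 : γ ≠ 0 := norm_pos_iff.mp hγ
  have h1 : ‖γ‖ / 2 ≤ ‖z - γ‖ := by
    rw [norm_sub_rev]
    exact .trans (by linarith) (norm_sub_norm_le γ z)
  have h2 : z - γ ≠ 0 := norm_pos_iff.mp (by linarith)
  have e : 1 / (z - γ) + 1 / γ + z / γ ^ 2 = z ^ 2 / ((z - γ) * γ ^ 2) := by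
    field_simp
    ring
  rw [e, norm_div, norm_mul, norm_pow, norm_pow]
  calc ‖z‖ ^ 2 / (‖z - γ‖ * ‖γ‖ ^ 2) ≤ r ^ 2 / (‖γ‖ / 2 * ‖γ‖ ^ 2) := by gcongr
    _ = _ := by field_simp

/-- The open set of points which are not nonzero lattice points. -/
def punctured : Set ℂ := ((L.lattice : Set ℂ) \ {0})ᶜ

lemma isOpen_punctured : IsOpen (punctured L) := L.isOpen_compl_lattice_sdiff

lemma ne_of_mem_punctured {z : ℂ} (hz : z ∈ punctured L) (γ : Nonzero L) : z ≠ (γ.1 : ℂ) := by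
  rintro rfl
  exact hz ⟨γ.1.2, by simpa using γ.2⟩

lemma zero_mem_punctured : (0 : ℂ) ∈ punctured L := by simp [punctured]

lemma mem_punctured_of_notMem {z : ℂ} (hz : z ∉ L.lattice) : z ∈ punctured L := fun h => hz h.1

lemma eventually_zeta_term_bound (r : ℝ) (hr : 0 < r) :
    ∀ᶠ γ : Nonzero L in cofinite, ∀ z : ℂ, ‖z‖ < r →
      ‖1 / (z - (γ.1 : ℂ)) + 1 / (γ.1 : ℂ) + z / (γ.1 : ℂ) ^ 2‖
        ≤ 2 * r ^ 2 * (‖(γ.1 : ℂ)‖ ^ 3)⁻¹ := by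
  filter_upwards [eventually_cofinite_lt_norm L (2 * r)] with γ hγ z hz
  exact zeta_term_bound hr hz hγ.le

lemma summable_zeta_term (z : ℂ) : Summable fun γ : Nonzero L =>
    (1 / (z - (γ.1 : ℂ)) + 1 / (γ.1 : ℂ) + z / (γ.1 : ℂ) ^ 2) := by
  refine Summable.of_norm_bounded_eventually
    ((summable_nonzero_norm_pow_inv L).mul_left (2 * (‖z‖ + 1) ^ 2)) ?_
  filter_upwards [eventually_zeta_term_bound L (‖z‖ + 1) (by positivity)] with γ h
  exact h z (by simp)

lemma logDeriv_sigmaProd {z : ℂ} (hz : z ∈ punctured L) :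
    logDeriv (sigmaProd L) z = zetaSum L z := by
  have hr : 0 < ‖z‖ + 1 := by positivity
  have h := logDeriv_tprod_eq_tsum (s := Metric.ball (0 : ℂ) (‖z‖ + 1)) Metric.isOpen_ball
    (x := z) (by simp) (f := fun (γ : Nonzero L) z => primaryFactor (z / (γ.1 : ℂ)))
    (fun γ => primaryFactor_div_ne_zero γ.coe_ne_zero (ne_of_mem_punctured L hz γ))
    (fun γ => (differentiable_primaryFactor_div _).differentiableOn)
    ((summable_zeta_term L z).congr fun γ =>
      (logDeriv_primaryFactor_div γ.coe_ne_zero (ne_of_mem_punctured L hz γ)).symm)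
    (multipliableLocallyUniformlyOn_primaryFactor L _ hr)
    (sigmaProd_ne_zero L (ne_of_mem_punctured L hz))
  refine h.trans (tsum_congr fun γ => ?_)
  exact logDeriv_primaryFactor_div γ.coe_ne_zero (ne_of_mem_punctured L hz γ)

lemma hasSumLocallyUniformlyOn_zetaSum : HasSumLocallyUniformlyOn
    (fun (γ : Nonzero L) z => (1 / (z - (γ.1 : ℂ)) + 1 / (γ.1 : ℂ) + z / (γ.1 : ℂ) ^ 2))
    (zetaSum L) Set.univ := by
  rw [hasSumLocallyUniformlyOn_iff_tendstoLocallyUniformlyOn, tendstoLocallyUniformlyOn_univ,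
    tendstoLocallyUniformly_iff_filter]
  intro x
  have hr : 0 < ‖x‖ + 1 := by positivity
  have hr' : 𝓝 x ≤ 𝓟 (Metric.ball 0 (‖x‖ + 1)) :=
    Filter.le_principal_iff.mpr (Metric.isOpen_ball.mem_nhds (by simp))
  refine .mono_right ?_ hr'
  rw [← tendstoUniformlyOn_iff_tendstoUniformlyOnFilter]
  refine tendstoUniformlyOn_tsum_of_cofinite_eventually
    ((summable_nonzero_norm_pow_inv L).mul_left (2 * (‖x‖ + 1) ^ 2)) ?_
  filter_upwards [eventually_zeta_term_bound L (‖x‖ + 1) hr] with γ h z hz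
  exact h z (by simpa using hz)

lemma hasDerivAt_zeta_term {z γ : ℂ} (h : z ≠ γ) :
    HasDerivAt (fun z => 1 / (z - γ) + 1 / γ + z / γ ^ 2) (-(1 / (z - γ) ^ 2 - 1 / γ ^ 2)) z := by
  have h2 : z - γ ≠ 0 := sub_ne_zero.mpr h
  have h1 := ((((hasDerivAt_id z).sub_const γ).inv h2).add_const (1 / γ)).add
    ((hasDerivAt_id z).div_const (γ ^ 2))
  refine (h1.congr_deriv ?_).congr_of_eventuallyEq (.of_forall fun w => ?_)
  · simp only [id]; ring
  · simp [one_div]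

lemma differentiableOn_zetaSum : DifferentiableOn ℂ (zetaSum L) (punctured L) :=
  ((hasSumLocallyUniformlyOn_zetaSum L).mono (Set.subset_univ _)).differentiableOn
    (.of_forall fun _ => .fun_sum fun γ _ _ hz =>
      (hasDerivAt_zeta_term (ne_of_mem_punctured L hz γ)).differentiableAt.differentiableWithinAt)
    (isOpen_punctured L)

lemma weierstrassP_eq (z : ℂ) : L.weierstrassP z = 1 / z ^ 2 + L.weierstrassPExcept 0 z := by
  have := L.weierstrassPExcept_add 0 z
  simp only [ZeroMemClass.coe_zero, sub_zero] at this
  rw [← this]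
  simp [add_comm]

lemma hasSum_weierstrassPExcept_zero (z : ℂ) : HasSum (fun γ : Nonzero L =>
    (1 / (z - (γ.1 : ℂ)) ^ 2 - 1 / (γ.1 : ℂ) ^ 2)) (L.weierstrassPExcept 0 z) := by
  have h := L.hasSum_weierstrassPExcept 0 z
  have hinj : Function.Injective (fun γ : Nonzero L => γ.1) := Subtype.val_injective
  rw [← hinj.hasSum_iff] at h
  · refine h.congr_fun fun γ => ?_
    simp [show (γ.1 : L.lattice) ≠ 0 from γ.2]
  · intro x hx
    have : x = 0 := by
      by_contra hne
      exact hx ⟨⟨x, hne⟩, rfl⟩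
    simp [this]

lemma deriv_zetaSum {z : ℂ} (hz : z ∈ punctured L) :
    deriv (zetaSum L) z = -L.weierstrassPExcept 0 z := by
  have h := (hasSumLocallyUniformlyOn_iff_tendstoLocallyUniformlyOn.mp
    ((hasSumLocallyUniformlyOn_zetaSum L).mono (Set.subset_univ (punctured L)))).deriv
    (.of_forall fun _ => .fun_sum fun γ _ _ hz =>
      (hasDerivAt_zeta_term (ne_of_mem_punctured L hz γ)).differentiableAt.differentiableWithinAt)
    (isOpen_punctured L)
  refine tendsto_nhds_unique (h.tendsto_at hz)
    (((hasSum_weierstrassPExcept_zero L z).neg).congr fun s => ?_)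
  simp only [Function.comp_apply]
  rw [deriv_fun_sum fun γ _ =>
    (hasDerivAt_zeta_term (ne_of_mem_punctured L hz γ)).differentiableAt]
  refine Finset.sum_congr rfl fun γ _ => ?_
  rw [(hasDerivAt_zeta_term (ne_of_mem_punctured L hz γ)).deriv]

lemma hasDerivAt_wZeta {z : ℂ} (hz : z ∉ L.lattice) :
    HasDerivAt (wZeta L) (-L.weierstrassP z) z := by
  have hz' := mem_punctured_of_notMem L hz
  have h0 : z ≠ 0 := by rintro rfl; exact hz (zero_mem _)
  have h1 : HasDerivAt (zetaSum L) (-L.weierstrassPExcept 0 z) z :=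
    deriv_zetaSum L hz' ▸ ((differentiableOn_zetaSum L).differentiableAt
      ((isOpen_punctured L).mem_nhds hz')).hasDerivAt
  have h2 := (hasDerivAt_inv h0).add h1
  rw [weierstrassP_eq]
  refine (h2.congr_deriv (by rw [one_div]; ring)).congr_of_eventuallyEq (.of_forall fun w => ?_)
  simp [wZeta_eq]

lemma analyticAt_zetaSum {z : ℂ} (hz : z ∈ punctured L) : AnalyticAt ℂ (zetaSum L) z :=
  (differentiableOn_zetaSum L).analyticOnNhd (isOpen_punctured L) z hz

lemma isOpen_compl_lattice : IsOpen ((L.lattice : Set ℂ)ᶜ) := L.isClosed_lattice.isOpen_compl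

lemma countable_lattice : (L.lattice : Set ℂ).Countable := by
  have : Countable L.lattice := L.latticeEquivProd.toEquiv.countable_iff.mpr inferInstance
  exact Set.to_countable _

/-- A real plane minus a countable set is path connected. This is what turns a zero derivative off
the lattice into a constant, and it later feeds the identity theorem. -/
lemma isPreconnected_compl_lattice : IsPreconnected ((L.lattice : Set ℂ)ᶜ) :=
  ((countable_lattice L).isPathConnected_compl_of_one_lt_rank
    (by simp [Complex.rank_real_complex])).isConnected.isPreconnected

lemma dense_compl_lattice : Dense ((L.lattice : Set ℂ)ᶜ) :=
  (countable_lattice L).dense_compl ℂ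

lemma add_mem_lattice_iff {z γ : ℂ} (hγ : γ ∈ L.lattice) : z + γ ∈ L.lattice ↔ z ∈ L.lattice :=
  L.lattice.add_mem_iff_left hγ

lemma exists_const_of_hasDerivAt_zero {f : ℂ → ℂ}
    (hf : ∀ z ∉ L.lattice, HasDerivAt f 0 z) : ∃ C, ∀ z ∉ L.lattice, f z = C :=
  (isOpen_compl_lattice L).exists_is_const_of_deriv_eq_zero (isPreconnected_compl_lattice L)
    (fun z hz => (hf z hz).differentiableAt.differentiableWithinAt) (fun z hz => (hf z hz).deriv)

lemma exists_wZeta_add_const {γ : ℂ} (hγ : γ ∈ L.lattice) :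
    ∃ C, ∀ z ∉ L.lattice, wZeta L (z + γ) = wZeta L z + C := by
  obtain ⟨C, hC⟩ := exists_const_of_hasDerivAt_zero L (f := fun z => wZeta L (z + γ) - wZeta L z)
    fun z hz => by
      have h1 := (hasDerivAt_wZeta L (mt (add_mem_lattice_iff L hγ).mp hz)).comp_add_const z γ
      have h2 := h1.sub (hasDerivAt_wZeta L hz)
      rw [L.weierstrassP_add_coe z ⟨γ, hγ⟩, sub_self] at h2
      exact h2
  exact ⟨C, fun z hz => by rw [← hC z hz]; ring⟩

variable {L} in
/-- Multiplication by a unit of the lattice, as a permutation of the nonzero lattice points. -/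
def nonzeroMul {u : ℂ} (hu : u ≠ 0) (h : ∀ z, u * z ∈ L.lattice ↔ z ∈ L.lattice) :
    Nonzero L ≃ Nonzero L where
  toFun γ := ⟨⟨u * (γ.1 : ℂ), (h _).mpr γ.1.2⟩, fun e =>
    mul_ne_zero hu γ.coe_ne_zero (congrArg Subtype.val e)⟩
  invFun γ := ⟨⟨u⁻¹ * (γ.1 : ℂ), (h _).mp (by rw [mul_inv_cancel_left₀ hu]; exact γ.1.2)⟩,
    fun e => mul_ne_zero (inv_ne_zero hu) γ.coe_ne_zero (congrArg Subtype.val e)⟩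
  left_inv γ := Subtype.ext (Subtype.ext (inv_mul_cancel_left₀ hu _))
  right_inv γ := Subtype.ext (Subtype.ext (mul_inv_cancel_left₀ hu _))

lemma tsum_nonzero_mul {u : ℂ} (hu : u ≠ 0) (h : ∀ z, u * z ∈ L.lattice ↔ z ∈ L.lattice)
    (f : ℂ → ℂ) :
    ∑' γ : Nonzero L, f (u * (γ.1 : ℂ)) = ∑' γ : Nonzero L, f (γ.1 : ℂ) :=
  (nonzeroMul hu h).tsum_eq (fun γ : Nonzero L => f (γ.1 : ℂ))

lemma tprod_nonzero_mul {u : ℂ} (hu : u ≠ 0) (h : ∀ z, u * z ∈ L.lattice ↔ z ∈ L.lattice)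
    (f : ℂ → ℂ) :
    ∏' γ : Nonzero L, f (u * (γ.1 : ℂ)) = ∏' γ : Nonzero L, f (γ.1 : ℂ) :=
  (nonzeroMul hu h).tprod_eq (fun γ : Nonzero L => f (γ.1 : ℂ))

/-- Multiplication by u permutes the nonzero lattice points, so the sum can be reindexed. The same
argument serves σ and ℘; u = -1 gives parity, u = ω^l the cyclic symmetry. -/
lemma zetaSum_mul {u : ℂ} (hu : u ≠ 0) (h : ∀ z, u * z ∈ L.lattice ↔ z ∈ L.lattice) (z : ℂ) :
    zetaSum L (u * z) = u⁻¹ * zetaSum L z := by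
  unfold zetaSum
  rw [← tsum_nonzero_mul L hu h (fun γ => 1 / (u * z - γ) + 1 / γ + u * z / γ ^ 2), ← tsum_mul_left]
  refine tsum_congr fun γ => ?_
  have := γ.coe_ne_zero
  rw [← mul_sub, one_div, mul_inv]
  field_simp

lemma wZeta_mul {u : ℂ} (hu : u ≠ 0) (h : ∀ z, u * z ∈ L.lattice ↔ z ∈ L.lattice) (z : ℂ) :
    wZeta L (u * z) = u⁻¹ * wZeta L z := by
  rw [wZeta_eq, wZeta_eq, zetaSum_mul L hu h, one_div, mul_inv]
  ring

lemma wSigma_mul {u : ℂ} (hu : u ≠ 0) (h : ∀ z, u * z ∈ L.lattice ↔ z ∈ L.lattice) (z : ℂ) :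
    wSigma L (u * z) = u * wSigma L z := by
  rw [wSigma_eq, wSigma_eq, mul_assoc]
  congr 2
  unfold sigmaProd
  rw [← tprod_nonzero_mul L hu h (fun γ => primaryFactor (u * z / γ))]
  refine tprod_congr fun γ => ?_
  rw [mul_div_mul_left _ _ hu]

lemma weierstrassP_mul {u : ℂ} (hu : u ≠ 0) (h : ∀ z, u * z ∈ L.lattice ↔ z ∈ L.lattice) (z : ℂ) :
    L.weierstrassP (u * z) = u⁻¹ ^ 2 * L.weierstrassP z := by
  rw [weierstrassP_eq, weierstrassP_eq, ← (hasSum_weierstrassPExcept_zero L _).tsum_eq,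
    ← (hasSum_weierstrassPExcept_zero L _).tsum_eq,
    ← tsum_nonzero_mul L hu h (fun γ => 1 / (u * z - γ) ^ 2 - 1 / γ ^ 2), mul_add, ← tsum_mul_left]
  congr 1
  · rw [one_div, mul_pow, mul_inv]; simp
  · refine tsum_congr fun γ => ?_
    rw [← mul_sub, mul_pow, mul_pow]
    simp only [one_div, mul_inv, inv_pow]
    ring

lemma neg_one_mul_mem_iff (z : ℂ) : (-1) * z ∈ L.lattice ↔ z ∈ L.lattice := by simp

lemma wZeta_neg (z : ℂ) : wZeta L (-z) = -wZeta L z := by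
  have := wZeta_mul L (u := -1) (by simp) (neg_one_mul_mem_iff L) z
  simpa [inv_neg] using this

lemma wSigma_neg (z : ℂ) : wSigma L (-z) = -wSigma L z := by
  have := wSigma_mul L (u := -1) (by simp) (neg_one_mul_mem_iff L) z
  simpa using this

/-- The quasi-period map as an `ℝ`-linear map. -/
def etaLin : ℂ →ₗ[ℝ] ℂ :=
  L.basis.constr ℝ ![2 * wZeta L (L.ω₁ / 2), 2 * wZeta L (L.ω₂ / 2)]

lemma etaLin_apply (z : ℂ) : etaLin L z = eta L z := by
  simp [etaLin, Module.Basis.constr_apply_fintype, eta]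
  ring

lemma eta_add (x y : ℂ) : eta L (x + y) = eta L x + eta L y := by
  simp only [← etaLin_apply, map_add]

lemma eta_sub (x y : ℂ) : eta L (x - y) = eta L x - eta L y := by
  simp only [← etaLin_apply, map_sub]

lemma eta_neg (x : ℂ) : eta L (-x) = -eta L x := by
  simp only [← etaLin_apply, map_neg]

lemma eta_zero : eta L 0 = 0 := by
  simp only [← etaLin_apply, map_zero]

lemma eta_ω₁ : eta L L.ω₁ = 2 * wZeta L (L.ω₁ / 2) := by
  rw [← etaLin_apply, ← L.basis_zero, etaLin, Module.Basis.constr_basis]; simp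

lemma eta_ω₂ : eta L L.ω₂ = 2 * wZeta L (L.ω₂ / 2) := by
  rw [← etaLin_apply, ← L.basis_one, etaLin, Module.Basis.constr_basis]; simp

/-- The additive constant is read off at z = -γ/2, where ζ is odd; hence γ/2 must avoid the lattice.
-/
lemma wZeta_add_of_half {γ : ℂ} (hγ : γ ∈ L.lattice) (h2 : γ / 2 ∉ L.lattice) {z : ℂ}
    (hz : z ∉ L.lattice) : wZeta L (z + γ) = wZeta L z + 2 * wZeta L (γ / 2) := by
  obtain ⟨C, hC⟩ := exists_wZeta_add_const L hγ
  have h := hC (-(γ / 2)) (by simpa using h2)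
  rw [wZeta_neg, show -(γ / 2) + γ = γ / 2 by ring] at h
  rw [hC z hz]
  linear_combination -h

/-- The half-period evaluation covers the two generators, and the property is stable under sums and
integer multiples of γ. This identifies `eta`, defined by half-period values, with the true
quasi-periods. -/
lemma wZeta_add {γ : ℂ} (hγ : γ ∈ L.lattice) {z : ℂ} (hz : z ∉ L.lattice) :
    wZeta L (z + γ) = wZeta L z + eta L γ := by
  revert z
  refine Submodule.span_induction (p := fun γ _ => ∀ {z : ℂ}, z ∉ L.lattice →
    wZeta L (z + γ) = wZeta L z + eta L γ) ?_ ?_ ?_ ?_ hγ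
  · intro x hx z hz
    rcases hx with rfl | rfl
    · rw [wZeta_add_of_half L L.ω₁_mem_lattice L.ω₁_div_two_notMem_lattice hz, eta_ω₁]
    · rw [wZeta_add_of_half L L.ω₂_mem_lattice L.ω₂_div_two_notMem_lattice hz, eta_ω₂]
  · intro z _
    simp [eta_zero]
  · intro x y hx hy ihx ihy z hz
    rw [← add_assoc, ihy (mt (add_mem_lattice_iff L hx).mp hz), ihx hz, eta_add, add_assoc]
  · intro a x hx ih z hz
    have hnat : ∀ n : ℕ, ∀ {z : ℂ}, z ∉ L.lattice →
        wZeta L (z + n • x) = wZeta L z + eta L (n • x) := by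
      intro n
      induction n with
      | zero => intro z _; simp [eta_zero]
      | succ n ihn =>
        intro z hz
        rw [succ_nsmul, ← add_assoc, ih, ihn hz, eta_add, add_assoc]
        exact mt (add_mem_lattice_iff L (nsmul_mem hx n)).mp hz
    obtain ⟨n, rfl | rfl⟩ := a.eq_nat_or_neg
    · simpa using hnat n hz
    · have := hnat n (z := z - n • x) (by
        rwa [sub_eq_add_neg, add_mem_lattice_iff L (neg_mem (nsmul_mem hx n))])
      rw [sub_add_cancel] at this
      rw [neg_smul, natCast_zsmul, ← sub_eq_add_neg, eta_neg, this]
      ring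

lemma hasDerivAt_wSigma {z : ℂ} (hz : z ∉ L.lattice) :
    HasDerivAt (wSigma L) (wZeta L z * wSigma L z) z := by
  have hz' := mem_punctured_of_notMem L hz
  have h0 : z ≠ 0 := by rintro rfl; exact hz (zero_mem _)
  have hp := sigmaProd_ne_zero L (ne_of_mem_punctured L hz')
  have h1 := logDeriv_sigmaProd L hz'
  rw [logDeriv_apply, div_eq_iff hp] at h1
  have h2 := (hasDerivAt_id z).mul (differentiable_sigmaProd L z).hasDerivAt
  refine (h2.congr_deriv ?_).congr_of_eventuallyEq (.of_forall fun w => ?_)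
  · rw [h1, wSigma_eq, wZeta_eq]
    simp only [id]
    field_simp
  · simp [wSigma_eq]

/-- Quasi-periodicity of the `σ`-function; the constant is not made explicit. -/
lemma exists_wSigma_add {γ : ℂ} (hγ : γ ∈ L.lattice) :
    ∃ C, C ≠ 0 ∧ ∀ z, wSigma L (z + γ) = C * Complex.exp (eta L γ * z) * wSigma L z := by
  have hz1 : ∀ {z}, z ∉ L.lattice → z + γ ∉ L.lattice := fun h => mt (add_mem_lattice_iff L hγ).mp h
  obtain ⟨C, hC⟩ := exists_const_of_hasDerivAt_zero L
    (f := fun z => wSigma L (z + γ) / (Complex.exp (eta L γ * z) * wSigma L z)) fun z hz => by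
      have h1 := (hasDerivAt_wSigma L (hz1 hz)).comp_add_const z γ
      have hs := wSigma_ne_zero L hz
      have h2 := (((hasDerivAt_id z).const_mul (eta L γ)).cexp).mul (hasDerivAt_wSigma L hz)
      have h3 := h1.div h2 (mul_ne_zero (Complex.exp_ne_zero _) hs)
      refine h3.congr_deriv ?_
      simp only [id, Pi.mul_apply]
      rw [wZeta_add L hγ hz]
      ring
  have hfun : ∀ z ∉ L.lattice, wSigma L (z + γ) = C * Complex.exp (eta L γ * z) * wSigma L z := by
    intro z hz
    rw [mul_assoc, ← div_eq_iff (mul_ne_zero (Complex.exp_ne_zero _) (wSigma_ne_zero L hz))]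
    exact hC z hz
  refine ⟨C, ?_, fun z => ?_⟩
  · rintro rfl
    have h := hfun _ L.ω₁_div_two_notMem_lattice
    rw [zero_mul, zero_mul] at h
    exact wSigma_ne_zero L (hz1 L.ω₁_div_two_notMem_lattice) h
  · have hc := (differentiable_wSigma L).continuous
    exact congrFun (Continuous.ext_on (dense_compl_lattice L)
      (f := fun z => wSigma L (z + γ)) (g := fun z => C * Complex.exp (eta L γ * z) * wSigma L z)
      (by fun_prop) (by fun_prop) hfun) z

/-- Legendre's relation modulo `2πi`. -/
lemma exp_eta_mul_comm {γ δ : ℂ} (hγ : γ ∈ L.lattice) (hδ : δ ∈ L.lattice) :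
    Complex.exp (eta L γ * δ) = Complex.exp (eta L δ * γ) := by
  obtain ⟨C, hC0, hC⟩ := exists_wSigma_add L hγ
  obtain ⟨D, hD0, hD⟩ := exists_wSigma_add L hδ
  have hz := wSigma_ne_zero L L.ω₁_div_two_notMem_lattice
  set z := L.ω₁ / 2
  -- σ(z + γ + δ) is expanded in both orders. The constants C and D occur on both sides and cancel,
  -- so they need not be known.
  have h1 : wSigma L (z + δ + γ) = wSigma L (z + γ + δ) := by rw [add_right_comm]
  rw [hC, hD, hD, hC, mul_add, mul_add, Complex.exp_add, Complex.exp_add] at h1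
  have e1 := Complex.exp_ne_zero (eta L γ * z)
  have e2 := Complex.exp_ne_zero (eta L δ * z)
  have : C * D * Complex.exp (eta L γ * z) * Complex.exp (eta L δ * z) * wSigma L z ≠ 0 := by
    simp [*]
  refine mul_left_cancel₀ this ?_
  linear_combination h1

/-! ### Simple poles, removable singularities, gluing. -/

section Poles

/-- `f` has at most a simple pole at `z₀`, with residue `r`. -/
def HasResidue (f : ℂ → ℂ) (z₀ r : ℂ) : Prop :=
  ∃ h : ℂ → ℂ, AnalyticAt ℂ h z₀ ∧ h z₀ = r ∧ ∀ᶠ z in 𝓝[≠] z₀, f z = (z - z₀)⁻¹ * h z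

/-- `f` agrees with an analytic function on a punctured neighbourhood of `z₀`. -/
def IsRegular (f : ℂ → ℂ) (z₀ : ℂ) : Prop :=
  ∃ h : ℂ → ℂ, AnalyticAt ℂ h z₀ ∧ f =ᶠ[𝓝[≠] z₀] h

lemma HasResidue.congr {f g : ℂ → ℂ} {z₀ r : ℂ} (hf : HasResidue f z₀ r)
    (h : f =ᶠ[𝓝[≠] z₀] g) : HasResidue g z₀ r := by
  obtain ⟨k, hk, hr, he⟩ := hf
  exact ⟨k, hk, hr, by filter_upwards [he, h] with z h1 h2; rw [← h2, h1]⟩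

lemma HasResidue.add {f g : ℂ → ℂ} {z₀ r s : ℂ} (hf : HasResidue f z₀ r) (hg : HasResidue g z₀ s) :
    HasResidue (fun z => f z + g z) z₀ (r + s) := by
  obtain ⟨k, hk, rfl, he⟩ := hf
  obtain ⟨l, hl, rfl, he'⟩ := hg
  exact ⟨fun z => k z + l z, hk.add hl, rfl, by
    filter_upwards [he, he'] with z h1 h2; rw [h1, h2]; ring⟩

lemma AnalyticAt.mul_hasResidue {f g : ℂ → ℂ} {z₀ r : ℂ} (hg : AnalyticAt ℂ g z₀)
    (hf : HasResidue f z₀ r) : HasResidue (fun z => g z * f z) z₀ (g z₀ * r) := by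
  obtain ⟨k, hk, rfl, he⟩ := hf
  exact ⟨fun z => g z * k z, hg.mul hk, rfl, by
    filter_upwards [he] with z h1; rw [h1]; ring⟩

lemma HasResidue.const_mul {f : ℂ → ℂ} {z₀ r : ℂ} (hf : HasResidue f z₀ r) (c : ℂ) :
    HasResidue (fun z => c * f z) z₀ (c * r) :=
  AnalyticAt.mul_hasResidue (analyticAt_const (v := c)) hf

lemma AnalyticAt.hasResidue {f : ℂ → ℂ} {z₀ : ℂ} (hf : AnalyticAt ℂ f z₀) :
    HasResidue f z₀ 0 := by
  refine ⟨fun z => (z - z₀) * f z, by fun_prop, by simp, ?_⟩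
  filter_upwards [self_mem_nhdsWithin] with z hz
  rw [inv_mul_cancel_left₀ (sub_ne_zero.mpr hz)]

lemma HasResidue.sum {ι : Type*} (s : Finset ι) {f : ι → ℂ → ℂ} {z₀ : ℂ} {r : ι → ℂ}
    (h : ∀ i ∈ s, HasResidue (f i) z₀ (r i)) :
    HasResidue (fun z => ∑ i ∈ s, f i z) z₀ (∑ i ∈ s, r i) := by
  classical
  induction s using Finset.induction_on with
  | empty => simpa using AnalyticAt.hasResidue (analyticAt_const (v := (0 : ℂ)))
  | insert i s hi ih =>
    simp only [Finset.sum_insert hi]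
    exact (h i (by simp)).add (ih fun j hj => h j (by simp [hj]))

lemma tendsto_affine_punctured {a b z₀ : ℂ} (ha : a ≠ 0) :
    Tendsto (fun z => a * z + b) (𝓝[≠] z₀) (𝓝[≠] (a * z₀ + b)) := by
  refine tendsto_nhdsWithin_of_tendsto_nhds_of_eventually_within _ ?_ ?_
  · exact ((by fun_prop : Continuous fun z => a * z + b).tendsto z₀).mono_left nhdsWithin_le_nhds
  · filter_upwards [self_mem_nhdsWithin] with z hz
    simpa [ha] using hz

lemma HasResidue.comp_affine {f : ℂ → ℂ} {a b z₀ r : ℂ} (ha : a ≠ 0)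
    (hf : HasResidue f (a * z₀ + b) r) : HasResidue (fun z => f (a * z + b)) z₀ (a⁻¹ * r) := by
  obtain ⟨k, hk, rfl, he⟩ := hf
  refine ⟨fun z => a⁻¹ * k (a * z + b), analyticAt_const.mul
    (hk.fun_comp (f := fun z => a * z + b) (by fun_prop)), rfl, ?_⟩
  filter_upwards [(tendsto_affine_punctured ha).eventually he, self_mem_nhdsWithin] with z h1 hz
  rw [h1, show a * z + b - (a * z₀ + b) = a * (z - z₀) by ring, mul_inv]
  ring

/-- With residue zero the analytic numerator vanishes at z₀, and its divided slope is again
analytic. -/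
lemma HasResidue.isRegular {f : ℂ → ℂ} {z₀ : ℂ} (hf : HasResidue f z₀ 0) : IsRegular f z₀ := by
  obtain ⟨k, hk, h0, he⟩ := hf
  obtain ⟨p, hp⟩ := hk
  refine ⟨dslope k z₀, ⟨_, hp.has_fpower_series_dslope_fslope⟩, ?_⟩
  filter_upwards [he, self_mem_nhdsWithin] with z h1 hz
  rw [h1, dslope_of_ne _ hz, slope_def_field, h0, sub_zero, div_eq_inv_mul]

lemma HasResidue.tendsto {f : ℂ → ℂ} {z₀ r : ℂ} (hf : HasResidue f z₀ r) :
    Tendsto (fun z => (z - z₀) * f z) (𝓝[≠] z₀) (𝓝 r) := by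
  obtain ⟨k, hk, rfl, he⟩ := hf
  refine (hk.continuousAt.tendsto.mono_left nhdsWithin_le_nhds).congr' ?_
  filter_upwards [he, self_mem_nhdsWithin] with z h1 hz
  rw [h1, mul_inv_cancel_left₀ (sub_ne_zero.mpr hz)]

lemma HasResidue.unique {f : ℂ → ℂ} {z₀ r s : ℂ} (hf : HasResidue f z₀ r)
    (hf' : HasResidue f z₀ s) : r = s := tendsto_nhds_unique hf.tendsto hf'.tendsto

lemma AnalyticAt.isRegular {f : ℂ → ℂ} {z₀ : ℂ} (hf : AnalyticAt ℂ f z₀) : IsRegular f z₀ :=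
  ⟨f, hf, .rfl⟩

/-- A function which is regular at all points extends to an entire function. -/
lemma exists_entire_extension {f : ℂ → ℂ} (hf : ∀ z, IsRegular f z) :
    ∃ F : ℂ → ℂ, Differentiable ℂ F ∧ (∀ z, f =ᶠ[𝓝[≠] z] F) := by
  choose g hg he using hf
  -- The local extensions glue: for w near z, both g w and g z take at w the limit of f along the
  -- punctured neighbourhood of w. The diagonal w ↦ g w w is therefore locally one of them.
  have key : ∀ z, ∀ᶠ w in 𝓝 z, g w w = g z w := by
    intro z
    have h1 : ∀ᶠ w in 𝓝[≠] z, f =ᶠ[𝓝 w] g z := by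
      have := eventually_eventually_nhdsWithin.mpr (he z)
      filter_upwards [this, self_mem_nhdsWithin] with w hw hwz
      rwa [nhdsWithin_eq_nhds.mpr (isOpen_compl_singleton.mem_nhds hwz)] at hw
    have h2 : ∀ᶠ w in 𝓝[≠] z, g w w = g z w := by
      have hga : ∀ᶠ w in 𝓝[≠] z, AnalyticAt ℂ (g z) w :=
        (hg z).eventually_analyticAt.filter_mono nhdsWithin_le_nhds
      filter_upwards [h1, hga] with w hw hgw
      have h3 : g w =ᶠ[𝓝[≠] w] g z := (he w).symm.trans (hw.filter_mono nhdsWithin_le_nhds)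
      exact tendsto_nhds_unique_of_eventuallyEq
        ((hg w).continuousAt.tendsto.mono_left nhdsWithin_le_nhds)
        (hgw.continuousAt.tendsto.mono_left nhdsWithin_le_nhds) h3
    rw [← nhdsNE_sup_pure, eventually_sup]
    exact ⟨h2, by simp⟩
  refine ⟨fun w => g w w, fun z => ?_, fun z => ?_⟩
  · exact ((hg z).congr (EventuallyEq.symm (key z))).differentiableAt
  · exact (he z).trans (EventuallyEq.symm ((key z).filter_mono nhdsWithin_le_nhds))

lemma eq_of_eventuallyEq_punctured {f g : ℂ → ℂ} {z : ℂ} (h : f =ᶠ[𝓝[≠] z] g)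
    (hf : ContinuousAt f z) (hg : ContinuousAt g z) : f z = g z :=
  tendsto_nhds_unique_of_eventuallyEq (hf.tendsto.mono_left nhdsWithin_le_nhds)
    (hg.tendsto.mono_left nhdsWithin_le_nhds) h

end Poles

/-! ### Liouville's theorem on the torus. -/

section Liouville

variable (L : PeriodPair)

/-- Only the modulus has to be periodic, so that unimodular multipliers are allowed. -/
lemma eq_const_of_periodic {F : ℂ → ℂ} (hF : Differentiable ℂ F)
    (hper : ∀ γ ∈ L.lattice, ∀ z, ‖F (z + γ)‖ = ‖F z‖) (z w : ℂ) : F z = F w := by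
  have hc := (IsZLattice.isCompact_range_of_periodic L.lattice (fun z => ‖F z‖)
    hF.continuous.norm fun z w hw => hper w hw z).isBounded
  refine hF.apply_eq_apply_of_bounded ?_ z w
  obtain ⟨C, hC⟩ := hc.exists_norm_le
  refine isBounded_iff_forall_norm_le.mpr ⟨C, ?_⟩
  rintro _ ⟨x, rfl⟩
  simpa using hC _ ⟨x, rfl⟩

lemma tendsto_add_punctured (z₀ γ : ℂ) : Tendsto (fun z => z + γ) (𝓝[≠] z₀) (𝓝[≠] (z₀ + γ)) := by
  simpa using tendsto_affine_punctured (a := 1) (b := γ) (z₀ := z₀) one_ne_zero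

/-- Liouville's theorem for elliptic functions without poles. -/
lemma eq_const_of_regular {f : ℂ → ℂ} (hf : ∀ z, IsRegular f z)
    (hper : ∀ γ ∈ L.lattice, ∀ z, ∀ᶠ w in 𝓝[≠] z, f (w + γ) = f w) :
    ∃ C, ∀ z, ∀ᶠ w in 𝓝[≠] z, f w = C := by
  obtain ⟨F, hF, he⟩ := exists_entire_extension hf
  have h : ∀ z, F z = F 0 := fun z => eq_const_of_periodic L hF (fun γ hγ z => by
    congr 1
    refine eq_of_eventuallyEq_punctured (f := fun z => F (z + γ)) ?_
      (hF.continuous.comp (by fun_prop)).continuousAt hF.continuous.continuousAt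
    filter_upwards [(tendsto_add_punctured z γ).eventually (he (z + γ)), he z, hper γ hγ z]
      with w h1 h2 h3
    rw [← h1, ← h2, h3]) z 0
  exact ⟨F 0, fun z => by filter_upwards [he z] with w hw; rw [hw, h]⟩

end Liouville

/-! ### The function φ and vanishing of quasi-periodic entire functions. -/

section Phi

variable (L : PeriodPair)

/-- `x φ(x, z)`, extended to `x = 0`. -/
def phiReg (x z : ℂ) : ℂ := wSigma L (x - z) / (sigmaProd L x * wSigma L (-z))

lemma phi_eq (x z : ℂ) : phi L x z = x⁻¹ * phiReg L x z := by
  rw [phi, phiReg, wSigma_eq L x, mul_assoc, div_mul_eq_div_div_swap,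
    div_eq_mul_inv _ x, mul_comm]

lemma phi_swap (x z : ℂ) : phi L z x = -phi L x z := by
  unfold phi
  rw [wSigma_neg, wSigma_neg, ← neg_sub, wSigma_neg, mul_neg, mul_neg, neg_div_neg_eq, div_neg,
    neg_neg, mul_comm]

/-- The unknown constant in the multiplier of σ appears in numerator and denominator and cancels. At
zeros of the denominator both sides are 0 by the convention for division. -/
lemma phi_add_left {γ : ℂ} (hγ : γ ∈ L.lattice) (x z : ℂ) :
    phi L (x + γ) z = Complex.exp (-eta L γ * z) * phi L x z := by
  obtain ⟨C, hC0, hC⟩ := exists_wSigma_add L hγ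
  unfold phi
  rw [add_sub_right_comm, hC, hC, mul_sub, Complex.exp_sub, neg_mul, Complex.exp_neg]
  have := Complex.exp_ne_zero (eta L γ * x)
  have := Complex.exp_ne_zero (eta L γ * z)
  by_cases hx : wSigma L x = 0
  · simp [hx]
  by_cases hz : wSigma L (-z) = 0
  · simp [hz]
  field_simp

lemma phi_add_right {γ : ℂ} (hγ : γ ∈ L.lattice) (x z : ℂ) :
    phi L x (z + γ) = Complex.exp (-eta L γ * x) * phi L x z := by
  rw [phi_swap, phi_add_left L hγ, phi_swap L x z]
  ring

lemma phi_mul {u : ℂ} (hu : u ≠ 0) (h : ∀ z, u * z ∈ L.lattice ↔ z ∈ L.lattice) (x z : ℂ) :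
    phi L (u * x) (u * z) = u⁻¹ * phi L x z := by
  unfold phi
  rw [← mul_sub, ← mul_neg, wSigma_mul L hu h, wSigma_mul L hu h, wSigma_mul L hu h]
  field_simp

lemma analyticAt_wSigma (z : ℂ) : AnalyticAt ℂ (wSigma L) z :=
  (differentiable_wSigma L).analyticAt z

lemma analyticAt_phi {x : ℂ} (hx : x ∉ L.lattice) (z : ℂ) :
    AnalyticAt ℂ (fun x => phi L x z) x := by
  unfold phi
  by_cases hz : wSigma L (-z) = 0
  · simp only [hz, mul_zero, div_zero]
    exact analyticAt_const
  refine AnalyticAt.div ?_ ((analyticAt_wSigma L x).mul analyticAt_const)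
    (mul_ne_zero (wSigma_ne_zero L hx) hz)
  exact (analyticAt_wSigma L (x - z)).fun_comp (f := fun x => x - z) (by fun_prop)

lemma hasResidue_phi_zero {z : ℂ} (hz : z ∉ L.lattice) :
    HasResidue (fun x => phi L x z) 0 1 := by
  have hz' : wSigma L (-z) ≠ 0 := wSigma_ne_zero L (by simpa using hz)
  refine ⟨fun x => phiReg L x z, ?_, ?_, .of_forall fun x => by
    simp only [phi_eq, sub_zero]⟩
  · unfold phiReg
    refine AnalyticAt.div ((analyticAt_wSigma L (0 - z)).fun_comp
      (f := fun x => x - z) (by fun_prop))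
      (((differentiable_sigmaProd L).analyticAt 0).mul analyticAt_const) ?_
    rw [sigmaProd_zero, one_mul]
    exact hz'
  · simp [phiReg, sigmaProd_zero, hz']

lemma hasResidue_phi {γ z : ℂ} (hγ : γ ∈ L.lattice) (hz : z ∉ L.lattice) :
    HasResidue (fun x => phi L x z) γ (Complex.exp (-eta L γ * z)) := by
  have h := (HasResidue.comp_affine (f := fun x => phi L x z) (a := 1) (b := -γ) (z₀ := γ)
    one_ne_zero (by simpa using hasResidue_phi_zero L hz)).const_mul (Complex.exp (-eta L γ * z))
  simp only [one_mul, inv_one, mul_one] at h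
  refine h.congr (.of_forall fun x => ?_)
  have := phi_add_left L hγ (x + -γ) z
  rw [neg_add_cancel_right] at this
  exact this.symm

/-- Every real-linear functional on `ℂ` is `z ↦ Re (b z)`. -/
lemma exists_re_mul_eq (f : ℂ →ₗ[ℝ] ℝ) : ∃ b : ℂ, ∀ z, (b * z).re = f z := by
  refine ⟨⟨f 1, -f Complex.I⟩, fun z => ?_⟩
  have : z = z.re • (1 : ℂ) + z.im • Complex.I := by simp
  conv_rhs => rw [this, map_add, map_smul, map_smul]
  simp
  ring

lemma half_add_half_notMem : L.ω₂ / 2 + L.ω₁ / 2 ∉ L.lattice := by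
  have := (L.mul_ω₁_add_mul_ω₂_mem_lattice (α := 1 / 2) (β := 1 / 2)).not.mpr (by norm_num)
  intro h
  apply this
  push_cast
  convert h using 1
  ring

lemma mem_lattice_sub_iff {z γ : ℂ} (hγ : γ ∈ L.lattice) : z - γ ∈ L.lattice ↔ z ∈ L.lattice := by
  rw [sub_eq_add_neg, add_mem_lattice_iff L (neg_mem hγ)]

/-- An elliptic function cannot have a single simple pole. -/
lemma residue_eq_zero_of_elliptic {f : ℂ → ℂ} {r : ℂ} (hper : ∀ γ ∈ L.lattice, ∀ z, f (z + γ) = f z)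
    (hf : ∀ z ∉ L.lattice, AnalyticAt ℂ f z) (hr : HasResidue f 0 r) : r = 0 := by
  by_contra hr0
  -- No contour integral is needed. The function h(z) = f(z) - f(-z) is elliptic and odd with
  -- residue 2r on the lattice; oddness and periodicity force it to vanish at half periods.
  set h : ℂ → ℂ := fun z => f z + -1 * f (-1 * z + 0) with hh
  have hodd : ∀ z, h (-z) = -h z := fun z => by simp [hh]
  have hperh : ∀ γ ∈ L.lattice, ∀ z, h (z + γ) = h z := fun γ hγ z => by
    have h1 := hper (-γ) (neg_mem hγ) (-z)
    simp only [hh, hper γ hγ z, neg_one_mul, add_zero, neg_add, h1]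
  have hres0 : HasResidue h 0 (r + r) := by
    have := hr.add ((HasResidue.comp_affine (a := -1) (b := 0) (z₀ := 0) (by simp)
      (by simpa using hr)).const_mul (-1))
    simpa [hh, inv_neg] using this
  have hres : ∀ γ ∈ L.lattice, HasResidue h γ (r + r) := fun γ hγ => by
    have := HasResidue.comp_affine (f := h) (a := 1) (b := -γ) (z₀ := γ) one_ne_zero
      (by simpa using hres0)
    simp only [one_mul, inv_one] at this
    exact this.congr (.of_forall fun z => hperh _ (neg_mem hγ) z)
  have han : ∀ z ∉ L.lattice, AnalyticAt ℂ h z := fun z hz => by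
    refine (hf z hz).add (analyticAt_const.mul ?_)
    exact (hf (-1 * z + 0) (by simpa using hz)).fun_comp (f := fun z => -1 * z + 0) (by fun_prop)
  have hhalf : ∀ γ ∈ L.lattice, h (γ / 2) = 0 := fun γ hγ => by
    have h1 := hperh γ hγ (-(γ / 2))
    rw [hodd, show -(γ / 2) + γ = γ / 2 by ring] at h1
    have h2 : 2 * h (γ / 2) = 0 := by linear_combination h1
    simpa using h2
  -- Each pole of one factor sits at a zero of the other, so k is regular and hence constant; its
  -- value at ω₂/2 is zero. As h has no zeros near its pole at 0, it must vanish near ω₁/2, and the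
  -- identity theorem gives the contradiction.
  set k : ℂ → ℂ := fun z => h (z + L.ω₁ / 2) * h z with hk
  have hw1 := L.ω₁_mem_lattice
  have hn1 := L.ω₁_div_two_notMem_lattice
  have hn1' : ∀ {γ}, γ ∈ L.lattice → γ + L.ω₁ / 2 ∉ L.lattice := fun hγ h =>
    hn1 ((add_mem_lattice_iff L hγ).mp (by rwa [add_comm] at h))
  have hn1'' : ∀ {z}, z + L.ω₁ / 2 ∈ L.lattice → z ∉ L.lattice := fun hz h => hn1' h hz
  have hshift : ∀ z, z + L.ω₁ / 2 ∉ L.lattice → AnalyticAt ℂ (fun z => h (z + L.ω₁ / 2)) z :=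
    fun z hz => (han _ hz).fun_comp (f := fun z => z + L.ω₁ / 2) (by fun_prop)
  have hreg : ∀ z, IsRegular k z := by
    intro z
    by_cases hz : z ∈ L.lattice
    · have := AnalyticAt.mul_hasResidue (hshift z (hn1' hz)) (hres z hz)
      rw [add_comm z, hperh z hz, hhalf _ hw1, zero_mul] at this
      exact this.isRegular
    by_cases hz1 : z + L.ω₁ / 2 ∈ L.lattice
    · have h0 : h z = 0 := by
        have := hperh _ (neg_mem hz1) z
        rw [show z + -(z + L.ω₁ / 2) = -(L.ω₁ / 2) by ring, hodd, hhalf _ hw1] at this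
        simpa using this.symm
      have h1 := HasResidue.comp_affine (f := h) (a := 1) (b := L.ω₁ / 2) (z₀ := z) one_ne_zero
        (by simpa using hres _ hz1)
      have := AnalyticAt.mul_hasResidue (han z hz) h1
      rw [h0, zero_mul] at this
      exact (this.congr (.of_forall fun w => by simp [hk, mul_comm])).isRegular
    · exact AnalyticAt.isRegular ((hshift z hz1).mul (han z hz))
  obtain ⟨C, hC⟩ := eq_const_of_regular L hreg fun γ hγ z => .of_forall fun w => by
    simp only [hk, hperh γ hγ w, add_right_comm w γ, hperh γ hγ (w + L.ω₁ / 2)]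
  have hC0 : C = 0 := by
    have h1 := eq_of_eventuallyEq_punctured (g := fun _ => C) (hC (L.ω₂ / 2))
      ((hshift _ (half_add_half_notMem L)).mul (han _ L.ω₂_div_two_notMem_lattice)).continuousAt
      continuousAt_const
    rw [← h1]
    simp [hk, hhalf _ L.ω₂_mem_lattice]
  have hnz : ∀ᶠ z in 𝓝[≠] (0 : ℂ), h z ≠ 0 := by
    have := hres0.tendsto.eventually_ne (b₂ := 0) (by simpa using hr0)
    filter_upwards [this] with z hz h0
    simp [h0] at hz
  have hz0 : ∀ᶠ z in 𝓝[≠] (0 : ℂ), h (z + L.ω₁ / 2) = 0 := by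
    filter_upwards [hC 0, hnz] with z h1 h2
    rw [hC0] at h1
    exact (mul_eq_zero.mp h1).resolve_right h2
  have hz1 : ∃ᶠ z in 𝓝[≠] (L.ω₁ / 2), h z = 0 := by
    have h1 := (tendsto_add_punctured (L.ω₁ / 2) (-(L.ω₁ / 2)))
    rw [add_neg_cancel] at h1
    refine Eventually.frequently ?_
    filter_upwards [h1.eventually hz0] with z hz
    simpa using hz
  have hall := AnalyticOnNhd.eqOn_zero_of_preconnected_of_frequently_eq_zero
    (f := h) (U := (L.lattice : Set ℂ)ᶜ) (fun z hz => han z hz) (isPreconnected_compl_lattice L)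
    hn1 hz1
  have hev : ∀ᶠ z in 𝓝[≠] (0 : ℂ), z ∉ L.lattice := by
    have := (isOpen_punctured L).mem_nhds (zero_mem_punctured L)
    filter_upwards [nhdsWithin_le_nhds this, self_mem_nhdsWithin] with z h1 h2 h3
    exact h1 ⟨h3, h2⟩
  obtain ⟨z, hz1, hz2⟩ := (hnz.and hev).exists
  exact hz1 (hall hz2)

/-- An entire function with the multipliers of `φ(z, a)`, `a ∉ Λ`, vanishes. -/
lemma eq_zero_of_quasiperiodic {g : ℂ → ℂ} (hg : Differentiable ℂ g) {a : ℂ} (ha : a ∉ L.lattice)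
    (hq : ∀ γ ∈ L.lattice, ∀ z, g (z + γ) = Complex.exp (-eta L γ * a) * g z) (z : ℂ) :
    g z = 0 := by
  -- With Re(bz) = Re(η(z)a) the factor exp(bz) turns the multipliers exp(-η(γ)a) into numbers of
  -- modulus one, so Liouville applies to G.
  obtain ⟨b, hb⟩ := exists_re_mul_eq
    (Complex.reLm ∘ₗ (LinearMap.mulRight ℝ a) ∘ₗ etaLin L)
  have hb' : ∀ z, (b * z).re = (eta L z * a).re := fun z => by
    rw [hb]; simp [etaLin_apply]
  set G : ℂ → ℂ := fun z => Complex.exp (b * z) * g z with hG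
  have hGper : ∀ γ ∈ L.lattice, ∀ z, G (z + γ) = Complex.exp (b * γ - eta L γ * a) * G z := by
    intro γ hγ z
    simp only [hG, hq γ hγ z, mul_add, Complex.exp_add, sub_eq_add_neg, neg_mul]
    ring
  have hGd : Differentiable ℂ G := by fun_prop
  have hconst := eq_const_of_periodic L hGd fun γ hγ z => by
    rw [hGper γ hγ, norm_mul, Complex.norm_exp, Complex.sub_re, hb', sub_self, Real.exp_zero,
      one_mul]
  have hG0 : G 0 = 0 := by
    by_contra hne
    -- A nonzero constant G forces every multiplier to be 1. Then exp(bz)φ(z, a) is elliptic with a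
    -- single simple pole of residue 1, which is impossible.
    have h1 : ∀ γ ∈ L.lattice, Complex.exp (b * γ - eta L γ * a) = 1 := fun γ hγ => by
      have h2 := hGper γ hγ 0
      rw [hconst (0 + γ) 0] at h2
      exact (mul_right_cancel₀ hne (by rw [one_mul]; exact h2)).symm
    have h3 := residue_eq_zero_of_elliptic L (f := fun z => Complex.exp (b * z) * phi L z a)
      (r := Complex.exp (b * 0) * 1)
      (fun γ hγ z => by
        rw [phi_add_left L hγ, mul_add, Complex.exp_add, ← mul_assoc]
        have := h1 γ hγ
        rw [sub_eq_add_neg, Complex.exp_add, ← neg_mul] at this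
        linear_combination Complex.exp (b * z) * phi L z a * this)
      (fun z hz => AnalyticAt.mul (by fun_prop) (analyticAt_phi L hz a))
      (AnalyticAt.mul_hasResidue (g := fun z => Complex.exp (b * z)) (by fun_prop)
        (hasResidue_phi_zero L ha))
    simp at h3
  have := hconst z 0
  rw [hG0] at this
  exact (mul_eq_zero.mp this).resolve_left (Complex.exp_ne_zero _)

end Phi

/-! ### Roots of unity indexed by ℤ/m. -/

section RootsOfUnity

variable {m : ℕ} [NeZero m]

lemma om_zero : om m 0 = 1 := AddChar.map_zero_eq_one _

lemma om_add (a b : ZMod m) : om m (a + b) = om m a * om m b := AddChar.map_add_eq_mul _ _ _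

lemma om_neg (a : ZMod m) : om m (-a) = (om m a)⁻¹ := AddChar.map_neg_eq_inv _ _

lemma om_ne_zero (a : ZMod m) : om m a ≠ 0 := by
  intro h
  have := om_add a (-a)
  rw [add_neg_cancel, om_zero, h, zero_mul] at this
  exact one_ne_zero this

lemma om_nsmul (n : ℕ) (a : ZMod m) : om m (n • a) = om m a ^ n := AddChar.map_nsmul_eq_pow _ _ _

lemma om_injective : Function.Injective (om m) := ZMod.injective_stdAddChar

lemma om_eq_one_iff {a : ZMod m} : om m a = 1 ↔ a = 0 := by
  rw [← om_zero (m := m), om_injective.eq_iff]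

lemma Om_ne_zero {l : ZMod m} (hl : l ≠ 0) : Om m l ≠ 0 :=
  sub_ne_zero.mpr fun h => hl (om_eq_one_iff.mp h.symm)

lemma Om_neg (l : ZMod m) : Om m (-l) = -(om m (-l) * Om m l) := by
  have := om_ne_zero l
  simp only [Om, om_neg]
  field_simp
  ring

lemma om_mul_neg (a : ZMod m) : om m a * om m (-a) = 1 := by
  rw [← om_add, add_neg_cancel, om_zero]

end RootsOfUnity

/-! ### The cyclic symmetry of the lattice and of η. -/

section Symmetry

variable {L : PeriodPair} {m : ℕ} [NeZero m]

lemma om_mul_mem (hL : ∀ γ ∈ L.lattice, om m 1 * γ ∈ L.lattice) (l : ZMod m) {γ : ℂ}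
    (hγ : γ ∈ L.lattice) : om m l * γ ∈ L.lattice := by
  have h : ∀ n : ℕ, om m 1 ^ n * γ ∈ L.lattice := by
    intro n
    induction n with
    | zero => simpa using hγ
    | succ n ih => rw [pow_succ', mul_assoc]; exact hL _ ih
  have := h l.val
  rwa [← om_nsmul, nsmul_eq_mul, mul_one, ZMod.natCast_zmod_val] at this

lemma om_mul_mem_iff (hL : ∀ γ ∈ L.lattice, om m 1 * γ ∈ L.lattice) (l : ZMod m) (z : ℂ) :
    om m l * z ∈ L.lattice ↔ z ∈ L.lattice := by
  refine ⟨fun h => ?_, om_mul_mem hL l⟩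
  have := om_mul_mem hL (-l) h
  rwa [← mul_assoc, mul_comm (om m (-l)), om_mul_neg, one_mul] at this

lemma Om_mul_mem (hL : ∀ γ ∈ L.lattice, om m 1 * γ ∈ L.lattice) (l : ZMod m) {γ : ℂ}
    (hγ : γ ∈ L.lattice) : Om m l * γ ∈ L.lattice := by
  rw [Om, sub_mul, one_mul]
  exact sub_mem hγ (om_mul_mem hL l hγ)

lemma Om_neg_mul_mem_iff (hL : ∀ γ ∈ L.lattice, om m 1 * γ ∈ L.lattice) (l : ZMod m) (z : ℂ) :
    Om m (-l) * z ∈ L.lattice ↔ Om m l * z ∈ L.lattice := by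
  rw [Om_neg, neg_mul, neg_mem_iff, mul_assoc, om_mul_mem_iff hL]

/-- On lattice vectors this compares the quasi-periods of the two sides of ζ(ω^l z) = ω^(-l) ζ(z).
Both sides are ℝ-linear and the periods form a real basis. -/
lemma eta_om_mul (hL : ∀ γ ∈ L.lattice, om m 1 * γ ∈ L.lattice) (l : ZMod m) (z : ℂ) :
    eta L (om m l * z) = om m (-l) * eta L z := by
  have hlat : ∀ γ ∈ L.lattice, eta L (om m l * γ) = om m (-l) * eta L γ := by
    intro γ hγ
    have hz := L.ω₁_div_two_notMem_lattice
    have hu := om_ne_zero l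
    have h1 := wZeta_mul L hu (om_mul_mem_iff hL l) (L.ω₁ / 2 + γ)
    rw [mul_add, wZeta_add L (om_mul_mem hL l hγ) (mt (om_mul_mem_iff hL l _).mp hz),
      wZeta_add L hγ hz, wZeta_mul L hu (om_mul_mem_iff hL l), ← om_neg] at h1
    linear_combination h1
  have h2 : etaLin L ∘ₗ LinearMap.mulLeft ℝ (om m l)
      = LinearMap.mulLeft ℝ (om m (-l)) ∘ₗ etaLin L := by
    refine L.basis.ext fun i => ?_
    fin_cases i
    · simpa [etaLin_apply] using hlat _ L.ω₁_mem_lattice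
    · simpa [etaLin_apply] using hlat _ L.ω₂_mem_lattice
  simpa [etaLin_apply] using LinearMap.congr_fun h2 z

lemma eta_Om_mul (hL : ∀ γ ∈ L.lattice, om m 1 * γ ∈ L.lattice) (l : ZMod m) (z : ℂ) :
    eta L (Om m l * z) = Om m (-l) * eta L z := by
  rw [Om, sub_mul, one_mul, eta_sub, eta_om_mul hL, Om, sub_mul, one_mul]

end Symmetry

/-! ### Fixed points on the curve and the action of ℤ/m. -/

section Curve

variable {L : PeriodPair}

lemma mkQ_rep (y : Curve L) : L.lattice.mkQ (rep L y) = y :=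
  Function.surjInv_eq L.lattice.mkQ_surjective y

lemma mkQ_eq_iff {a b : ℂ} : L.lattice.mkQ a = L.lattice.mkQ b ↔ a - b ∈ L.lattice :=
  Submodule.Quotient.eq _

lemma exists_rep_mkQ (z : ℂ) : ∃ γ ∈ L.lattice, rep L (L.lattice.mkQ z) = z + γ :=
  ⟨rep L (L.lattice.mkQ z) - z, mkQ_eq_iff.mp (mkQ_rep _), by ring⟩

lemma eventually_mul_notMem {a : ℂ} (ha : a ≠ 0) (z₀ : ℂ) : ∀ᶠ z in 𝓝[≠] z₀, a * z ∉ L.lattice := by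
  have h : ∀ᶠ w in 𝓝[≠] (a * z₀ + 0), w ∉ L.lattice := by
    filter_upwards [nhdsWithin_le_nhds (L.compl_lattice_sdiff_singleton_mem_nhds _),
      self_mem_nhdsWithin] with w h1 h2 h3
    exact h1 ⟨h3, h2⟩
  simpa using (tendsto_affine_punctured (b := 0) ha).eventually h

variable (L) in
/-- The points of the curve fixed by `s ^ l`. -/
def fixedPoints (m : ℕ) [NeZero m] (l : ZMod m) : Set (Curve L) := {y | Om m l * rep L y ∈ L.lattice}

variable {m : ℕ} [NeZero m]

lemma mem_fixedPoints {l : ZMod m} {y : Curve L} :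
    y ∈ fixedPoints L m l ↔ Om m l * rep L y ∈ L.lattice := Iff.rfl

lemma Om_mul_rep_mkQ (hL : ∀ γ ∈ L.lattice, om m 1 * γ ∈ L.lattice) (l : ZMod m) (z : ℂ) :
    Om m l * rep L (L.lattice.mkQ z) ∈ L.lattice ↔ Om m l * z ∈ L.lattice := by
  obtain ⟨γ, hγ, h⟩ := exists_rep_mkQ (L := L) z
  rw [h, mul_add, add_mem_lattice_iff L (Om_mul_mem hL l hγ)]

/-- Take the representative z in the bounded fundamental domain. Then Ω_l z is a lattice point of
bounded norm, and z is recovered from it because Ω_l ≠ 0. -/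
lemma finite_fixedPoints (hL : ∀ γ ∈ L.lattice, om m 1 * γ ∈ L.lattice) {l : ZMod m} (hl : l ≠ 0) :
    (fixedPoints L m l).Finite := by
  obtain ⟨R, hR⟩ := (ZSpan.fundamentalDomain_isBounded L.basis).exists_norm_le
  have hfin : (Subtype.val '' Metric.closedBall (0 : L.lattice) (‖Om m l‖ * R)).Finite :=
    (isCompact_iff_finite.mp (isCompact_closedBall (0 : L.lattice) _)).image _
  refine (hfin.image fun w => L.lattice.mkQ (w / Om m l)).subset fun y hy => ?_
  set z := ZSpan.fract L.basis (rep L y) with hz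
  have hzR : ‖z‖ ≤ R := hR _ (ZSpan.fract_mem_fundamentalDomain _ _)
  have hyz : y = L.lattice.mkQ z := by
    conv_lhs => rw [← mkQ_rep y]
    rw [mkQ_eq_iff, hz, ZSpan.fract, sub_sub_cancel, L.lattice_eq_span_range_basis]
    exact (ZSpan.floor L.basis (rep L y)).2
  have hmem : Om m l * z ∈ L.lattice := by
    rw [mem_fixedPoints, hyz, Om_mul_rep_mkQ hL] at hy
    exact hy
  refine ⟨Om m l * z, ⟨⟨_, hmem⟩, ?_, rfl⟩, ?_⟩
  · simpa using mul_le_mul_of_nonneg_left hzR (norm_nonneg _)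
  · simp only [mul_div_cancel_left₀ z (Om_ne_zero hl)]
    exact hyz.symm

lemma IsCoupling.mem_of_ne_zero {c : Family L m} (hc : IsCoupling L m c) {l : ZMod m} {y : Curve L}
    (h : c l y ≠ 0) : y ∈ fixedPoints L m l := by
  by_contra hn
  refine h ?_
  rw [← mkQ_rep y]
  exact hc.not_fixed l _ hn

/-- Multiplication by `om m r` as a permutation of the curve. -/
def curveMul (hL : ∀ γ ∈ L.lattice, om m 1 * γ ∈ L.lattice) (r : ZMod m) :
    Curve L ≃ Curve L where
  toFun y := L.lattice.mkQ (om m r * rep L y)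
  invFun y := L.lattice.mkQ (om m (-r) * rep L y)
  left_inv y := by
    obtain ⟨γ, hγ, h⟩ := exists_rep_mkQ (L := L) (om m r * rep L y)
    beta_reduce
    rw [h, mul_add, ← mul_assoc, mul_comm (om m (-r)), om_mul_neg, one_mul]
    conv_rhs => rw [← mkQ_rep y]
    rw [mkQ_eq_iff, add_sub_cancel_left]
    exact om_mul_mem hL _ hγ
  right_inv y := by
    obtain ⟨γ, hγ, h⟩ := exists_rep_mkQ (L := L) (om m (-r) * rep L y)
    beta_reduce
    rw [h, mul_add, ← mul_assoc, om_mul_neg, one_mul]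
    conv_rhs => rw [← mkQ_rep y]
    rw [mkQ_eq_iff, add_sub_cancel_left]
    exact om_mul_mem hL _ hγ

lemma curveMul_apply (hL : ∀ γ ∈ L.lattice, om m 1 * γ ∈ L.lattice) (r : ZMod m) (y : Curve L) :
    curveMul hL r y = L.lattice.mkQ (om m r * rep L y) := rfl

lemma IsCoupling.curveMul {c : Family L m} (hc : IsCoupling L m c)
    (hL : ∀ γ ∈ L.lattice, om m 1 * γ ∈ L.lattice) (l r : ZMod m) (y : Curve L) :
    c l (curveMul hL r y) = c l y := by
  rw [curveMul_apply, hc.invariant, mkQ_rep]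

end Curve

/-! ### Multipliers, residues and duality of the individual kernel terms. -/

section Kernel

variable {L : PeriodPair} {m : ℕ} [NeZero m]

variable (L) in
/-- The contribution of the fixed point `w` to `v_l(x, z)`. -/
def vTerm (m : ℕ) [NeZero m] (l : ZMod m) (w x z : ℂ) : ℂ :=
  Complex.exp (-eta L (Om m l * w) * z) * phi L (x - w) (Om m (-l) * z)

lemma vKer_eq (c : Family L m) (l : ZMod m) (x z : ℂ) :
    vKer L m c l x z = ∑ᶠ y : Curve L, c l y * vTerm L m l (rep L y) x z := by
  simp only [vKer, vTerm, mul_assoc]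

lemma vKer_eq_sum (hL : ∀ γ ∈ L.lattice, om m 1 * γ ∈ L.lattice) {c : Family L m}
    (hc : IsCoupling L m c) {l : ZMod m} (hl : l ≠ 0) (x z : ℂ) :
    vKer L m c l x z = ∑ y ∈ (finite_fixedPoints hL hl).toFinset,
      c l y * vTerm L m l (rep L y) x z := by
  rw [vKer_eq]
  refine finsum_eq_sum_of_support_subset _ fun y hy => ?_
  simpa using hc.mem_of_ne_zero (left_ne_zero_of_mul hy)

/-- The exponential prefactor compensates the multiplier of φ, because η(Ω_l γ) = Ω_{-l} η(γ). Hence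
only the class of w on the curve matters. -/
lemma vTerm_add (hL : ∀ γ ∈ L.lattice, om m 1 * γ ∈ L.lattice) (l : ZMod m) {γ : ℂ}
    (hγ : γ ∈ L.lattice) (w x z : ℂ) : vTerm L m l (w + γ) x z = vTerm L m l w x z := by
  unfold vTerm
  have h := phi_add_left L hγ (x - (w + γ)) (Om m (-l) * z)
  rw [show x - (w + γ) + γ = x - w by ring] at h
  rw [h, mul_add, eta_add, eta_Om_mul hL l γ, ← mul_assoc, ← Complex.exp_add]
  congr 2
  ring

lemma vTerm_mul (hL : ∀ γ ∈ L.lattice, om m 1 * γ ∈ L.lattice) (l r : ZMod m) (w x z : ℂ) :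
    vTerm L m l (om m r * w) (om m r * x) (om m r * z) = om m (-r) * vTerm L m l w x z := by
  unfold vTerm
  rw [mul_left_comm (Om m l), eta_om_mul hL, ← mul_sub, mul_left_comm (Om m (-l)),
    phi_mul L (om_ne_zero r) (om_mul_mem_iff hL r), ← om_neg]
  have : -(om m (-r) * eta L (Om m l * w)) * (om m r * z) = -eta L (Om m l * w) * z := by
    linear_combination (-eta L (Om m l * w) * z) * om_mul_neg r
  rw [this]
  ring

lemma vKer_mul (hL : ∀ γ ∈ L.lattice, om m 1 * γ ∈ L.lattice) {c : Family L m}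
    (hc : IsCoupling L m c) (l r : ZMod m) (x z : ℂ) :
    vKer L m c l (om m r * x) (om m r * z) = om m (-r) * vKer L m c l x z := by
  rw [vKer_eq, vKer_eq, ← finsum_comp_equiv (curveMul hL r), mul_finsum]
  refine finsum_congr fun y => ?_
  rw [hc.curveMul, curveMul_apply]
  obtain ⟨γ, hγ, h⟩ := exists_rep_mkQ (L := L) (om m r * rep L y)
  rw [h, vTerm_add hL l hγ, vTerm_mul hL]
  ring

lemma vTerm_add_left (l : ZMod m) {γ : ℂ}
    (hγ : γ ∈ L.lattice) (w x z : ℂ) :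
    vTerm L m l w (x + γ) z = Complex.exp (-eta L γ * (Om m (-l) * z)) * vTerm L m l w x z := by
  unfold vTerm
  rw [add_sub_right_comm, phi_add_left L hγ]
  ring

lemma vKer_add_left (c : Family L m) (l : ZMod m)
    {γ : ℂ} (hγ : γ ∈ L.lattice) (x z : ℂ) :
    vKer L m c l (x + γ) z = Complex.exp (-eta L γ * (Om m (-l) * z)) * vKer L m c l x z := by
  rw [vKer_eq, vKer_eq, mul_finsum]
  refine finsum_congr fun y => ?_
  rw [vTerm_add_left l hγ]
  ring

/-- Here w must be a fixed point: the leftover factor is trivial by Legendre's relation for the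
lattice vectors Ω_l w and γ. -/
lemma vTerm_add_right (hL : ∀ γ ∈ L.lattice, om m 1 * γ ∈ L.lattice) (l : ZMod m) {γ : ℂ}
    (hγ : γ ∈ L.lattice) {w : ℂ} (hw : Om m l * w ∈ L.lattice) (x z : ℂ) :
    vTerm L m l w x (z + γ) = Complex.exp (-eta L γ * (Om m l * x)) * vTerm L m l w x z := by
  unfold vTerm
  rw [mul_add, mul_add, phi_add_right L (Om_mul_mem hL _ hγ), Complex.exp_add, eta_Om_mul hL (-l) γ,
    neg_neg, mul_sub, sub_eq_add_neg, Complex.exp_add]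
  have h1 : Complex.exp (-eta L (Om m l * w) * γ)
      * Complex.exp (-(-(Om m l * eta L γ) * w)) = 1 := by
    have := exp_eta_mul_comm L hw hγ
    rw [neg_mul, Complex.exp_neg, this, neg_mul, neg_neg, mul_assoc, mul_left_comm,
      inv_mul_cancel₀ (Complex.exp_ne_zero _)]
  have h2 : -(Om m l * eta L γ) * x = -eta L γ * (Om m l * x) := by ring
  rw [h2]
  linear_combination (Complex.exp (-eta L (Om m l * w) * z) *
    Complex.exp (-eta L γ * (Om m l * x)) * phi L (x - w) (Om m (-l) * z)) * h1

lemma analyticAt_vTerm_left (l : ZMod m) {w x : ℂ} (h : x - w ∉ L.lattice) (z : ℂ) :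
    AnalyticAt ℂ (fun x => vTerm L m l w x z) x :=
  analyticAt_const.mul ((analyticAt_phi L h _).fun_comp (f := fun x => x - w) (by fun_prop))

lemma hasResidue_vTerm_left (hL : ∀ γ ∈ L.lattice, om m 1 * γ ∈ L.lattice) (l : ZMod m) {w x z : ℂ}
    (h : x - w ∈ L.lattice) (hz : Om m (-l) * z ∉ L.lattice) :
    HasResidue (fun x => vTerm L m l w x z) x (Complex.exp (-eta L (Om m l * x) * z)) := by
  have h1 := (HasResidue.comp_affine (a := 1) (b := -w) (z₀ := x) one_ne_zero
    (by rw [one_mul, ← sub_eq_add_neg]; exact hasResidue_phi L h hz)).const_mul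
      (Complex.exp (-eta L (Om m l * w) * z))
  have e : Complex.exp (-eta L (Om m l * w) * z)
      * Complex.exp (-eta L (x - w) * (Om m (-l) * z)) = Complex.exp (-eta L (Om m l * x) * z) := by
    rw [← Complex.exp_add, eta_sub, eta_Om_mul hL, eta_Om_mul hL]
    congr 1
    ring
  rw [inv_one, one_mul, e] at h1
  refine h1.congr (.of_forall fun x => ?_)
  simp only [vTerm, one_mul, ← sub_eq_add_neg]

lemma analyticAt_vTerm_right (l : ZMod m) (w x : ℂ) {z : ℂ} (h : Om m (-l) * z ∉ L.lattice) :
    AnalyticAt ℂ (fun z => vTerm L m l w x z) z := by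
  refine AnalyticAt.mul (by fun_prop) ?_
  simp only [phi_swap L _ (x - w)]
  exact ((analyticAt_phi L h _).fun_comp (f := fun z => Om m (-l) * z) (by fun_prop)).neg

lemma hasResidue_vTerm_right {l : ZMod m}
    (hl : l ≠ 0) {w x z : ℂ} (h : Om m (-l) * z ∈ L.lattice) (hx : x - w ∉ L.lattice) :
    HasResidue (fun z => vTerm L m l w x z) z (-(Om m (-l))⁻¹ *
      (Complex.exp (eta L (Om m (-l) * z) * w - eta L (Om m l * w) * z)
        * Complex.exp (-eta L (Om m (-l) * z) * x))) := by
  have h1 := HasResidue.comp_affine (a := Om m (-l)) (b := 0) (z₀ := z)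
    (Om_ne_zero (neg_ne_zero.mpr hl)) (by rw [add_zero]; exact hasResidue_phi L h hx)
  have h2 := AnalyticAt.mul_hasResidue
    (g := fun z => -Complex.exp (-eta L (Om m l * w) * z)) (by fun_prop) h1
  have e : -Complex.exp (-eta L (Om m l * w) * z)
      * ((Om m (-l))⁻¹ * Complex.exp (-eta L (Om m (-l) * z) * (x - w)))
      = -(Om m (-l))⁻¹ *
      (Complex.exp (eta L (Om m (-l) * z) * w - eta L (Om m l * w) * z)
        * Complex.exp (-eta L (Om m (-l) * z) * x)) := by
    rw [← Complex.exp_add, mul_left_comm, neg_mul, ← Complex.exp_add]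
    have : -eta L (Om m l * w) * z + -eta L (Om m (-l) * z) * (x - w) =
      eta L (Om m (-l) * z) * w - eta L (Om m l * w) * z + -eta L (Om m (-l) * z) * x := by ring
    rw [this]
    ring
  rw [e] at h2
  refine h2.congr (.of_forall fun z => ?_)
  simp only [vTerm, phi_swap L (x - w), add_zero]
  ring

/-- The pairing of fixed points entering the dual couplings. -/
lemma dual_exp_add_left (hL : ∀ γ ∈ L.lattice, om m 1 * γ ∈ L.lattice) (l : ZMod m) {x w γ : ℂ}
    (hγ : γ ∈ L.lattice) (hw : Om m (-l) * w ∈ L.lattice) :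
    Complex.exp (eta L (Om m l * (x + γ)) * w - eta L (Om m (-l) * w) * (x + γ))
      = Complex.exp (eta L (Om m l * x) * w - eta L (Om m (-l) * w) * x) := by
  have h := exp_eta_mul_comm L hw hγ
  have e : eta L (Om m l * (x + γ)) * w - eta L (Om m (-l) * w) * (x + γ)
      = (eta L (Om m l * x) * w - eta L (Om m (-l) * w) * x)
        + (eta L γ * (Om m (-l) * w) - eta L (Om m (-l) * w) * γ) := by
    rw [mul_add, eta_add, eta_Om_mul hL l γ]
    ring
  rw [e, Complex.exp_add, Complex.exp_sub _ (eta L (Om m (-l) * w) * γ), h,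
    div_self (Complex.exp_ne_zero _), mul_one]

lemma dual_exp_add_right (hL : ∀ γ ∈ L.lattice, om m 1 * γ ∈ L.lattice) (l : ZMod m) {x w γ : ℂ}
    (hγ : γ ∈ L.lattice) (hx : Om m l * x ∈ L.lattice) :
    Complex.exp (eta L (Om m l * x) * (w + γ) - eta L (Om m (-l) * (w + γ)) * x)
      = Complex.exp (eta L (Om m l * x) * w - eta L (Om m (-l) * w) * x) := by
  have h := dual_exp_add_left (x := w) (w := x) hL (-l) hγ (by rwa [neg_neg])
  rw [neg_neg] at h
  rw [← neg_sub, Complex.exp_neg, h, ← Complex.exp_neg, neg_sub]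

lemma dual_exp_mul (hL : ∀ γ ∈ L.lattice, om m 1 * γ ∈ L.lattice) (l r : ZMod m) (x w : ℂ) :
    eta L (Om m l * (om m r * x)) * (om m r * w) - eta L (Om m (-l) * (om m r * w)) * (om m r * x)
      = eta L (Om m l * x) * w - eta L (Om m (-l) * w) * x := by
  rw [mul_left_comm (Om m l), eta_om_mul hL, mul_left_comm (Om m (-l)), eta_om_mul hL]
  linear_combination (eta L (Om m l * x) * w - eta L (Om m (-l) * w) * x) * om_mul_neg r

/-- The elliptic Fourier-type identity behind the duality of the kernels. -/
lemma vTerm_duality (hL : ∀ γ ∈ L.lattice, om m 1 * γ ∈ L.lattice) {l : ZMod m} (hl : l ≠ 0)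
    {w x z : ℂ} (hw : Om m l * w ∈ L.lattice) (hx : Om m l * x ∉ L.lattice)
    (hz : Om m l * z ∉ L.lattice) :
    vTerm L m l w x z = -(Om m (-l))⁻¹ *
      ∑ y ∈ (finite_fixedPoints hL (neg_ne_zero.mpr hl)).toFinset,
        Complex.exp (eta L (Om m (-l) * rep L y) * w - eta L (Om m l * w) * rep L y)
          * vTerm L m (-l) (rep L y) z x := by
  classical
  set s := (finite_fixedPoints hL (neg_ne_zero.mpr hl)).toFinset
  set E : ℂ → ℂ := fun z => vTerm L m l w x z + (Om m (-l))⁻¹ * ∑ y ∈ s,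
        Complex.exp (eta L (Om m (-l) * rep L y) * w - eta L (Om m l * w) * rep L y)
          * vTerm L m (-l) (rep L y) z x with hE
  have hxw : x - w ∉ L.lattice := fun h => hx (by
    have := Om_mul_mem hL l h
    rwa [mul_sub, mem_lattice_sub_iff L hw] at this)
  have hs : ∀ y ∈ s, Om m (-l) * rep L y ∈ L.lattice := fun y hy => by simpa [s, mem_fixedPoints] using hy
  have hx' : Om m (- -l) * x ∉ L.lattice := by rwa [neg_neg]
  have hEan : ∀ z, Om m (-l) * z ∉ L.lattice → AnalyticAt ℂ E z := by
    intro z hz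
    refine (analyticAt_vTerm_right l w x hz).add (analyticAt_const.mul ?_)
    refine Finset.analyticAt_fun_sum _ fun y hy => analyticAt_const.mul ?_
    refine analyticAt_vTerm_left _ (fun h => hz ?_) _
    have := Om_mul_mem hL (-l) h
    rwa [mul_sub, mem_lattice_sub_iff L (hs y hy)] at this
  have hreg : ∀ z, IsRegular E z := by
    intro z
    by_cases hz : Om m (-l) * z ∈ L.lattice
    swap
    · exact AnalyticAt.isRegular (hEan z hz)
    set y₀ := L.lattice.mkQ z with hy₀
    have hy₀s : y₀ ∈ s := by
      simp only [s, Set.Finite.mem_toFinset, mem_fixedPoints]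
      rwa [hy₀, Om_mul_rep_mkQ hL]
    -- At a pole z exactly one summand is singular, the one indexed by the class of z. Its residue
    -- is rewritten in terms of z itself so as to cancel the residue of the left-hand term.
    have h1 : ∀ y ∈ s, HasResidue (fun z =>
        Complex.exp (eta L (Om m (-l) * rep L y) * w - eta L (Om m l * w) * rep L y)
          * vTerm L m (-l) (rep L y) z x) z (if y = y₀ then
          (Complex.exp (eta L (Om m (-l) * z) * w - eta L (Om m l * w) * z)
        * Complex.exp (-eta L (Om m (-l) * z) * x)) else 0) := by
      intro y hy
      split_ifs with hyy
      · obtain ⟨γ, hγ, h⟩ := exists_rep_mkQ (L := L) z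
        rw [hyy, hy₀, h]
        have e := dual_exp_add_left (x := z) (w := w) hL (-l) hγ (by rwa [neg_neg])
        rw [neg_neg] at e
        rw [e]
        refine HasResidue.const_mul (hasResidue_vTerm_left hL (-l) ?_ hx') _
        simpa using hγ
      · refine AnalyticAt.hasResidue (analyticAt_const.mul (analyticAt_vTerm_left _ (fun h => ?_) _))
        exact hyy (by rw [hy₀, ← mkQ_rep y, mkQ_eq_iff, ← neg_mem_iff, neg_sub]; exact h)
    have h2 := (hasResidue_vTerm_right hl hz hxw).add
      ((HasResidue.sum s h1).const_mul (Om m (-l))⁻¹)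
    rw [Finset.sum_ite_eq' s y₀, if_pos hy₀s, neg_mul, neg_add_cancel] at h2
    exact h2.isRegular
  have hper : ∀ γ ∈ L.lattice, ∀ z, E (z + γ) = Complex.exp (-eta L γ * (Om m l * x)) * E z := by
    intro γ hγ z
    simp only [hE, vTerm_add_right hL l hγ hw, vTerm_add_left (-l) hγ, neg_neg]
    rw [mul_add, Finset.mul_sum, Finset.mul_sum, Finset.mul_sum]
    congr 1
    refine Finset.sum_congr rfl fun y _ => ?_
    ring
  obtain ⟨F, hF, he⟩ := exists_entire_extension hreg
  -- The common multipliers are those of φ(z, a) with a = Ω_l x, which is off the lattice by `hx`.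
  have hF0 := eq_zero_of_quasiperiodic L hF hx fun γ hγ z => by
    refine eq_of_eventuallyEq_punctured (f := fun z => F (z + γ))
      (g := fun z => Complex.exp (-eta L γ * (Om m l * x)) * F z) ?_
      (hF.continuous.comp (by fun_prop)).continuousAt
      (continuous_const.mul hF.continuous).continuousAt
    filter_upwards [(tendsto_add_punctured z γ).eventually (he (z + γ)), he z] with w h1 h2
    rw [← h1, ← h2, hper γ hγ]
  have hz' : Om m (-l) * z ∉ L.lattice := mt (Om_neg_mul_mem_iff hL l z).mp hz
  have hEz := eq_of_eventuallyEq_punctured (he z) (hEan z hz').continuousAt hF.continuous.continuousAt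
  rw [hF0] at hEz
  simp only [hE] at hEz
  rw [neg_mul]
  exact eq_neg_of_add_eq_zero_left hEz

end Kernel

/-! ### Dual couplings, involutivity, duality of the determinants. -/

section Dual

variable {L : PeriodPair} {m : ℕ} [NeZero m]

lemma dual_mkQ (hL : ∀ γ ∈ L.lattice, om m 1 * γ ∈ L.lattice) {c : Family L m}
    (hc : IsCoupling L m c) {l : ZMod m} (hl : l ≠ 0) {z : ℂ} (hz : Om m l * z ∈ L.lattice) :
    dual L m c l (L.lattice.mkQ z) = (Om m l)⁻¹ * ∑ᶠ y : Curve L, c (-l) y *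
      Complex.exp (eta L (Om m l * z) * rep L y - eta L (Om m (-l) * rep L y) * z) := by
  rw [dual, if_pos ⟨hl, (Om_mul_rep_mkQ hL l z).mpr hz⟩]
  congr 1
  refine finsum_congr fun y => ?_
  by_cases hy : c (-l) y = 0
  · simp [hy]
  obtain ⟨γ, hγ, h⟩ := exists_rep_mkQ (L := L) z
  rw [h, dual_exp_add_left hL l hγ (hc.mem_of_ne_zero hy)]

lemma isCoupling_dual (hL : ∀ γ ∈ L.lattice, om m 1 * γ ∈ L.lattice) {c : Family L m}
    (hc : IsCoupling L m c) : IsCoupling L m (dual L m c) where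
  index_zero x := by simp [dual]
  not_fixed l z hz := by
    rw [dual, if_neg]
    rintro ⟨-, h⟩
    exact hz ((Om_mul_rep_mkQ hL l z).mp h)
  invariant l r z := by
    by_cases hl : l = 0
    · simp [dual, hl]
    by_cases hz : Om m l * z ∈ L.lattice
    · have hrz : Om m l * (om m r * z) ∈ L.lattice := by
        rw [mul_left_comm]; exact om_mul_mem hL r hz
      rw [dual_mkQ hL hc hl hz, dual_mkQ hL hc hl hrz, ← finsum_comp_equiv (curveMul hL r)]
      congr 1
      refine finsum_congr fun y => ?_
      rw [hc.curveMul, curveMul_apply]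
      obtain ⟨γ, hγ, h⟩ := exists_rep_mkQ (L := L) (om m r * rep L y)
      rw [h, dual_exp_add_right hL l hγ hrz, dual_exp_mul hL]
    · have hrz : Om m l * (om m r * z) ∉ L.lattice := by
        rwa [mul_left_comm, om_mul_mem_iff hL]
      rw [dual, if_neg, dual, if_neg]
      · rw [Om_mul_rep_mkQ hL]; exact fun h => hz h.2
      · rw [Om_mul_rep_mkQ hL]; exact fun h => hrz h.2

/-- Apply the termwise identity and exchange the two finite sums; the inner sum is then the dual
coupling by definition. -/
lemma vKer_duality (hL : ∀ γ ∈ L.lattice, om m 1 * γ ∈ L.lattice) {c : Family L m}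
    (hc : IsCoupling L m c) {l : ZMod m} (hl : l ≠ 0) {x z : ℂ} (hx : Om m l * x ∉ L.lattice)
    (hz : Om m l * z ∉ L.lattice) :
    vKer L m c l x z = -vKer L m (dual L m c) (-l) z x := by
  have hl' : -l ≠ 0 := neg_ne_zero.mpr hl
  rw [vKer_eq_sum hL hc hl, vKer_eq_sum hL (isCoupling_dual hL hc) hl']
  have h1 : ∀ y ∈ (finite_fixedPoints hL hl).toFinset, c l y * vTerm L m l (rep L y) x z =
      ∑ w ∈ (finite_fixedPoints hL hl').toFinset, -((Om m (-l))⁻¹ * (c l y *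
        Complex.exp (eta L (Om m (-l) * rep L w) * rep L y - eta L (Om m l * rep L y) * rep L w))
          * vTerm L m (-l) (rep L w) z x) := by
    intro y hy
    rw [vTerm_duality hL hl (by simpa [mem_fixedPoints] using hy) hx hz, Finset.mul_sum, Finset.mul_sum]
    refine Finset.sum_congr rfl fun w _ => ?_
    ring
  rw [Finset.sum_congr rfl h1, Finset.sum_comm, ← Finset.sum_neg_distrib]
  refine Finset.sum_congr rfl fun w hw => ?_
  have hw' : Om m (-l) * rep L w ∈ L.lattice := by simpa [mem_fixedPoints] using hw
  rw [Finset.sum_neg_distrib, ← Finset.sum_mul, ← Finset.mul_sum]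
  congr 2
  conv_rhs => rw [← mkQ_rep w]
  rw [dual_mkQ hL hc hl' hw', neg_neg]
  congr 1
  refine (finsum_eq_sum_of_support_subset _ fun y hy => ?_).symm
  simpa using hc.mem_of_ne_zero (left_ne_zero_of_mul hy)

/-- Couplings are recovered from residues of the kernel; if x is not fixed by s^l, the coupling and
the residue are both zero. -/
lemma hasResidue_vKer (hL : ∀ γ ∈ L.lattice, om m 1 * γ ∈ L.lattice) {c : Family L m}
    (hc : IsCoupling L m c) {l : ZMod m} (hl : l ≠ 0) (x : ℂ) {z : ℂ}
    (hz : Om m (-l) * z ∉ L.lattice) :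
    HasResidue (fun x => vKer L m c l x z) x
      (c l (L.lattice.mkQ x) * Complex.exp (-eta L (Om m l * x) * z)) := by
  classical
  set s := (finite_fixedPoints hL hl).toFinset
  have h1 : ∀ y ∈ s, HasResidue (fun x => c l y * vTerm L m l (rep L y) x z) x
      (if y = L.lattice.mkQ x then
        c l (L.lattice.mkQ x) * Complex.exp (-eta L (Om m l * x) * z) else 0) := by
    intro y _
    have hiff : y = L.lattice.mkQ x ↔ x - rep L y ∈ L.lattice := by
      conv_lhs => rw [← mkQ_rep y]
      rw [mkQ_eq_iff, ← neg_mem_iff, neg_sub]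
    split_ifs with h
    · rw [← h]
      exact (hasResidue_vTerm_left hL l (hiff.mp h) hz).const_mul _
    · exact AnalyticAt.hasResidue
        (analyticAt_const.mul (analyticAt_vTerm_left _ (mt hiff.mpr h) _))
  have h2 := HasResidue.sum s h1
  rw [Finset.sum_ite_eq' s] at h2
  replace h2 := h2.congr (.of_forall fun x => (vKer_eq_sum hL hc hl x z).symm)
  convert h2 using 1
  split_ifs with h
  · rfl
  · rw [hc.not_fixed, zero_mul]
    intro h'
    exact h (by rwa [Set.Finite.mem_toFinset, mem_fixedPoints, Om_mul_rep_mkQ hL])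

/-- No inversion of the finite Fourier sum is needed: applying kernel duality twice shows that c and
its double dual have the same kernels, hence the same residues. -/
lemma dual_dual (hL : ∀ γ ∈ L.lattice, om m 1 * γ ∈ L.lattice) {c : Family L m}
    (hc : IsCoupling L m c) : dual L m (dual L m c) = c := by
  have hc' := isCoupling_dual hL hc
  have hc'' := isCoupling_dual hL hc'
  funext l y
  by_cases hl : l = 0
  · rw [hl, hc.index_zero, hc''.index_zero]
  have hl' : -l ≠ 0 := neg_ne_zero.mpr hl
  obtain ⟨z, hz⟩ : ∃ z, Om m (-l) * z ∉ L.lattice :=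
    ⟨(Om m (-l))⁻¹ * (L.ω₁ / 2), by
      rw [mul_inv_cancel_left₀ (Om_ne_zero hl')]; exact L.ω₁_div_two_notMem_lattice⟩
  have hz' : Om m l * z ∉ L.lattice := mt (Om_neg_mul_mem_iff hL l z).mpr hz
  have h1 := hasResidue_vKer hL hc hl (rep L y) hz
  have h2 := hasResidue_vKer hL hc'' hl (rep L y) hz
  have h3 := h1.congr (g := fun x => vKer L m (dual L m (dual L m c)) l x z) (by
    filter_upwards [eventually_mul_notMem (L := L) (Om_ne_zero hl) (rep L y)] with x hx
    rw [vKer_duality hL hc hl hx hz', vKer_duality hL hc' hl' hz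
      (mt (Om_neg_mul_mem_iff hL l x).mp hx), neg_neg, neg_neg])
  have h4 := h3.unique h2
  rw [mkQ_rep] at h4
  exact (mul_right_cancel₀ (Complex.exp_ne_zero _) h4).symm

lemma isPrimitiveRoot_om (m : ℕ) [NeZero m] : IsPrimitiveRoot (om m 1) m := by
  refine ⟨?_, fun n hn => ?_⟩
  · rw [← om_nsmul, nsmul_eq_mul, mul_one, ZMod.natCast_self, om_zero]
  · rwa [← om_nsmul, om_eq_one_iff, nsmul_eq_mul, mul_one, ZMod.natCast_eq_zero_iff] at hn

/-- Compare constant terms in X^m - 1 = ∏ (X - ω^i). -/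
lemma prod_om (m : ℕ) [NeZero m] : ∏ i : ZMod m, om m i = (-1) ^ (m + 1) := by
  classical
  have h := Polynomial.X_pow_sub_one_eq_prod (NeZero.pos m) (isPrimitiveRoot_om m)
  have himg : Polynomial.nthRootsFinset m (1 : ℂ) = Finset.univ.image (om m) := by
    refine (Finset.eq_of_subset_of_card_le (fun x hx => ?_) ?_).symm
    · obtain ⟨i, -, rfl⟩ := Finset.mem_image.mp hx
      rw [Polynomial.mem_nthRootsFinset (NeZero.pos m), ← om_nsmul, nsmul_eq_mul,
        ZMod.natCast_self, zero_mul, om_zero]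
    · rw [(isPrimitiveRoot_om m).card_nthRootsFinset, Finset.card_image_of_injective _ om_injective,
        Finset.card_univ, ZMod.card]
  rw [himg, Finset.prod_image (om_injective.injOn)] at h
  have h0 := congrArg (Polynomial.eval 0) h
  simp only [Polynomial.eval_sub, Polynomial.eval_pow, Polynomial.eval_X, Polynomial.eval_one,
    Polynomial.eval_prod, Polynomial.eval_C, zero_sub, Finset.prod_neg, Finset.card_univ,
    ZMod.card, zero_pow (NeZero.ne m)] at h0
  have h1 : (-1 : ℂ) ^ m * (-1) ^ m = 1 := by rw [← mul_pow]; simp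
  linear_combination (-(-1) ^ m) * h0 - (∏ i : ZMod m, om m i) * h1

lemma det_lax_duality (hL : ∀ γ ∈ L.lattice, om m 1 * γ ∈ L.lattice) {c : Family L m}
    (hc : IsCoupling L m c) (p q k α : ℂ) (hq : IsNotFixed L m q) (hα : IsNotFixed L m α) :
    (lax L m c p q α - k • (1 : Matrix (ZMod m) (ZMod m) ℂ)).det
      = -(lax L m (dual L m c) k α q - p • (1 : Matrix (ZMod m) (ZMod m) ℂ)).det := by
  set A := lax L m c p q α - k • (1 : Matrix (ZMod m) (ZMod m) ℂ)
  set B := lax L m (dual L m c) k α q - p • (1 : Matrix (ZMod m) (ZMod m) ℂ)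
  -- On the diagonal, ω^i p - k = -ω^i (ω^(-i) k - p). Off the diagonal, kernel duality exchanges
  -- the arguments and negates i - j, and homogeneity moves ω^(-i) from q to α. The row factors
  -- multiply to (-1)^m (-1)^(m+1) = -1.
  have hAB : A = Matrix.of fun i j => -om m i * (B.submatrix (Equiv.neg _) (Equiv.neg _)) i j := by
    ext i j
    simp only [A, B, lax, leftMulMatrix, dunkl, Matrix.sub_apply, Matrix.of_apply, Matrix.smul_apply,
      Matrix.submatrix_apply, Equiv.neg_apply, smul_eq_mul, neg_neg, neg_sub_neg]
    by_cases hij : i = j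
    · subst hij
      simp
      linear_combination k * om_mul_neg i
    · have hl : i - j ≠ 0 := sub_ne_zero.mpr hij
      have hl' : j - i ≠ 0 := sub_ne_zero.mpr (Ne.symm hij)
      rw [if_neg hl, if_neg hl', Matrix.one_apply_ne hij, Matrix.one_apply_ne (by simpa using hij)]
      have h1 := vKer_mul hL hc (i - j) i (om m (-i) * q) α
      rw [← mul_assoc, om_mul_neg, one_mul, vKer_duality hL hc hl (hq _ hl)
        (by rw [mul_left_comm, om_mul_mem_iff hL]; exact hα _ hl), neg_sub] at h1
      linear_combination om m i * h1 + vKer L m c (i - j) (om m (-i) * q) α * om_mul_neg i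
  rw [hAB, Matrix.det_mul_column, Matrix.det_submatrix_equiv_self, Finset.prod_neg, prod_om]
  simp only [Finset.card_univ, ZMod.card]
  rw [← pow_add, show m + (m + 1) = 2 * m + 1 by ring, pow_succ, pow_mul]
  simp

end Dual

/-! ### A combinatorial criterion for determinants. -/

section DetSpherical

variable {R : Type*} [CommRing R] {ι : Type*} [Fintype ι] [DecidableEq ι]

/-- A permutation crosses the level between i and i + 1 equally often upwards and downwards. Every
wrap-around n - 1 → 0 in S crosses it downwards; upward crossings are steps i → i + 1 in S or
ascents outside S. For i = n - 1 the bound is immediate. -/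
lemma flux_le {n : ℕ} (ρ : ι → ℕ) (hρ : ∀ r, ρ r < n) (π : Equiv.Perm ι) (S : Finset ι)
    (hS : ∀ r ∈ S, ρ (π r) = (ρ r + 1) % n) {i : ℕ} (hi : i < n) :
    (S.filter fun r => ρ r + 1 = n).card ≤ (S.filter fun r => ρ r = i).card
      + (Sᶜ.filter fun r => ρ r < ρ (π r)).card := by
  rcases eq_or_ne (i + 1) n with hin | hin
  · refine le_trans (le_of_eq ?_) (Nat.le_add_right _ _)
    congr 1
    ext r
    simp only [Finset.mem_filter, and_congr_right_iff]
    intro _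
    omega
  have h0 : ∑ r, (((if i < ρ (π r) then 1 else 0) : ℤ) - if i < ρ r then 1 else 0) = 0 := by
    rw [Finset.sum_sub_distrib, Equiv.sum_comp π (fun r => if i < ρ r then (1 : ℤ) else 0), sub_self]
  rw [← Finset.sum_add_sum_compl S] at h0
  have h1 : ∑ r ∈ S, (((if i < ρ (π r) then 1 else 0) : ℤ) - if i < ρ r then 1 else 0)
      = ∑ r ∈ S, ((if ρ r = i then 1 else 0) - if ρ r + 1 = n then 1 else 0) := by
    refine Finset.sum_congr rfl fun r hr => ?_
    have h2 := hS r hr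
    have h3 := hρ r
    rcases eq_or_ne (ρ r + 1) n with h | h
    · rw [h, Nat.mod_self] at h2
      rw [h2]
      split_ifs <;> omega
    · rw [Nat.mod_eq_of_lt (by omega)] at h2
      rw [h2]
      split_ifs <;> omega
  have h2 : ∑ r ∈ Sᶜ, (((if i < ρ (π r) then 1 else 0) : ℤ) - if i < ρ r then 1 else 0)
      ≤ ∑ r ∈ Sᶜ, if ρ r < ρ (π r) then 1 else 0 := by
    refine Finset.sum_le_sum fun r _ => ?_
    split_ifs <;> omega
  rw [h1, Finset.sum_sub_distrib] at h0
  simp only [Finset.sum_boole] at h0 h2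
  have h3 : ((S.filter fun r => ρ r + 1 = n).card : ℤ) ≤ (S.filter fun r => ρ r = i).card
      + (Sᶜ.filter fun r => ρ r < ρ (π r)).card := by linarith
  exact_mod_cast h3

/-- Determinants of matrices with entries of spherical shape lie in the subring generated by the
`xᵢ`, `T` and `T⁻¹ ∏ xᵢ`. -/
lemma det_mem_of_spherical (A : Subring R) {n : ℕ} (x : ℕ → R) (T T' : R) (hx : ∀ i, x i ∈ A)
    (hT : T ∈ A) (hTT' : T * T' = 1) (hH : T' * ∏ i ∈ Finset.range n, x i ∈ A) (ρ : ι → ℕ)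
    (hρ : ∀ r, ρ r < n) (M : Matrix ι ι R)
    (hM : ∀ s r, ∃ a ∈ A, ∃ b ∈ A, M s r = a * (if ρ r < ρ s then T else 1)
      + if ρ s = (ρ r + 1) % n then b * x (ρ r) * (if ρ r + 1 = n then T' else 1) else 0) :
    M.det ∈ A := by
  choose a ha b hb hM using hM
  rw [Matrix.det_apply]
  refine sum_mem fun π _ => zsmul_mem ?_ _
  simp only [hM]
  -- For each permutation the set S collects the rows r where the cyclic-shift summand is chosen;
  -- off S the other summand is taken, with a factor T at each ascent.
  rw [Finset.prod_add]
  refine sum_mem fun S' _ => ?_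
  obtain ⟨S, rfl⟩ : ∃ S : Finset ι, S' = Sᶜ := ⟨S'ᶜ, by simp⟩
  rw [← Finset.compl_eq_univ_sdiff, compl_compl]
  by_cases hS : ∀ r ∈ S, ρ (π r) = (ρ r + 1) % n
  swap
  · push Not at hS
    obtain ⟨r, hr, hne⟩ := hS
    rw [Finset.prod_eq_zero hr (if_neg hne), mul_zero]
    exact zero_mem _
  rw [Finset.prod_congr rfl fun r hr => if_pos (hS r hr)]
  simp only [Finset.prod_mul_distrib, Finset.prod_ite, Finset.prod_const]
  set e := (S.filter fun r => ρ r + 1 = n).card with he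
  set up := (Sᶜ.filter fun r => ρ r < ρ (π r)).card with hup
  set u : ℕ → ℕ := fun i => (S.filter fun r => ρ r = i).card with hu
  have hflux : ∀ i < n, e ≤ u i + up := fun i hi => flux_le ρ hρ π S hS hi
  have hxu : ∏ r ∈ S, x (ρ r) = ∏ i ∈ Finset.range n, x i ^ u i := by
    rw [← Finset.prod_fiberwise_of_maps_to (t := Finset.range n) (g := ρ)
      (fun r _ => Finset.mem_range.mpr (hρ r))]
    refine Finset.prod_congr rfl fun i _ => ?_
    rw [Finset.prod_congr rfl fun r hr => by rw [(Finset.mem_filter.mp hr).2], Finset.prod_const]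
  -- Ascents contribute `up` factors T, wrap-arounds `e` factors T'. If e ≤ up they are absorbed;
  -- otherwise the flux bound provides e - up complete products ∏ xᵢ, one for each surplus T'.
  have key : T ^ up * (T' ^ e * ∏ i ∈ Finset.range n, x i ^ u i) ∈ A := by
    rcases le_total e up with h | h
    · obtain ⟨k, hk⟩ := Nat.exists_eq_add_of_le h
      have : T ^ up * (T' ^ e * ∏ i ∈ Finset.range n, x i ^ u i)
          = T ^ k * ∏ i ∈ Finset.range n, x i ^ u i := by
        rw [hk, pow_add, ← mul_assoc, mul_right_comm (T ^ e), ← mul_pow, hTT', one_pow, one_mul]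
      rw [this]
      exact mul_mem (pow_mem hT _) (prod_mem fun i _ => pow_mem (hx i) _)
    · obtain ⟨k, hk⟩ := Nat.exists_eq_add_of_le h
      have h1 : ∏ i ∈ Finset.range n, x i ^ u i
          = (∏ i ∈ Finset.range n, x i) ^ k * ∏ i ∈ Finset.range n, x i ^ (u i - k) := by
        rw [← Finset.prod_pow, ← Finset.prod_mul_distrib]
        refine Finset.prod_congr rfl fun i hi => ?_
        have := hflux i (Finset.mem_range.mp hi)
        rw [← pow_add, Nat.add_sub_cancel' (by omega)]
      have : T ^ up * (T' ^ e * ∏ i ∈ Finset.range n, x i ^ u i)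
          = (T' * ∏ i ∈ Finset.range n, x i) ^ k * ∏ i ∈ Finset.range n, x i ^ (u i - k) := by
        have h2 : T ^ up * T' ^ up = 1 := by rw [← mul_pow, hTT', one_pow]
        rw [h1, hk, pow_add, mul_pow]
        linear_combination (T' ^ k * (∏ i ∈ Finset.range n, x i) ^ k *
          ∏ i ∈ Finset.range n, x i ^ (u i - k)) * h2
      rw [this]
      exact mul_mem (pow_mem hH _) (prod_mem fun i _ => pow_mem (hx i) _)
  rw [hxu]
  have h1 : ∏ r ∈ Sᶜ, a (π r) r ∈ A := prod_mem fun r _ => ha _ _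
  have h2 : ∏ r ∈ S, b (π r) r ∈ A := prod_mem fun r _ => hb _ _
  convert mul_mem (mul_mem h1 h2) key using 1
  ring

end DetSpherical

/-! ### The local spherical algebra: module basis and leading coefficients. -/

section Spherical

open Polynomial

variable {K : Type*} [CommRing K] (O : Subring K) (t : Kˣ) (n : ℕ) (μ : ℕ → O)

/-- The rescaled momentum `t p`. -/
def sphP : K[X] := C (t : K) * X

/-- The local hamiltonian `t⁻ⁿ ∏ (t p - μᵢ)`. -/
def sphH : K[X] := C ((t⁻¹ : Kˣ) : K) ^ n * ∏ i ∈ Finset.range n, (sphP t - C (μ i : K))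

/-- The local spherical subalgebra: polynomials in `t p` and the local hamiltonian, with
coefficients in `O`. -/
def spherical : Subalgebra O K[X] := Algebra.adjoin O {sphP t, sphH O t n μ}

/-- The basis of the spherical subalgebra as an `O`-module. -/
def sphBasis (j : ℕ) : K[X] := sphH O t n μ ^ (j / n) * sphP t ^ (j % n)

variable {O}

lemma sphP_mem : sphP t ∈ spherical O t n μ := Algebra.subset_adjoin (by simp)

lemma sphH_mem : sphH O t n μ ∈ spherical O t n μ := Algebra.subset_adjoin (by simp)

lemma C_mem_spherical {a : K} (ha : a ∈ O) : C a ∈ spherical O t n μ :=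
  (spherical O t n μ).algebraMap_mem ⟨a, ha⟩

lemma sphH_eq : sphH O t n μ = ∏ i ∈ Finset.range n, (X - C (((t⁻¹ : Kˣ) : K) * μ i)) := by
  rw [sphH, ← Finset.card_range n, ← Finset.prod_const, Finset.card_range,
    ← Finset.prod_mul_distrib]
  refine Finset.prod_congr rfl fun i _ => ?_
  rw [sphP, mul_sub, ← mul_assoc, ← C_mul, ← C_mul]
  simp

lemma monic_sphH : (sphH O t n μ).Monic := by
  rw [sphH_eq]; exact monic_prod_of_monic _ _ fun i _ => monic_X_sub_C _

lemma natDegree_sphH [Nontrivial K] : (sphH O t n μ).natDegree = n := by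
  rw [sphH_eq, natDegree_prod_of_monic _ _ fun i _ => monic_X_sub_C _]
  simp only [natDegree_X_sub_C, Finset.sum_const, Finset.card_range, smul_eq_mul, mul_one]

lemma natDegree_sphBasis_le [Nontrivial K] (j : ℕ) : (sphBasis O t n μ j).natDegree ≤ j := by
  calc (sphBasis O t n μ j).natDegree ≤ (j / n) * n + (j % n) * 1 := by
        refine natDegree_mul_le.trans (add_le_add ?_ ?_)
        · exact natDegree_pow_le.trans (by rw [natDegree_sphH])
        · exact natDegree_pow_le.trans (Nat.mul_le_mul_left _
            ((natDegree_C_mul_le _ _).trans natDegree_X_le))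
    _ = j := by rw [mul_one, mul_comm, Nat.div_add_mod]

lemma coeff_sphBasis_self [Nontrivial K] (j : ℕ) :
    (sphBasis O t n μ j).coeff j = (t : K) ^ (j % n) := by
  have h1 : (sphH O t n μ ^ (j / n)).natDegree = n * (j / n) := by
    rw [(monic_sphH t n μ).natDegree_pow, natDegree_sphH, mul_comm]
  have h2 : (sphH O t n μ ^ (j / n)).coeff (n * (j / n)) = 1 := by
    rw [← h1]; exact ((monic_sphH t n μ).pow _).coeff_natDegree
  have h3 : (sphH O t n μ ^ (j / n) * X ^ (j % n)).coeff (n * (j / n) + j % n) = 1 := by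
    rw [coeff_mul_X_pow, h2]
  rw [Nat.div_add_mod] at h3
  rw [sphBasis, sphP, mul_pow, ← C_pow, mul_left_comm, coeff_C_mul, h3, mul_one]

/-- The span contains 1 and is stable under both generators. With P = tp and H the local
hamiltonian, the one nontrivial product is P · P^(n-1): since tⁿH = ∏ (P - μᵢ), the power Pⁿ equals
tⁿH plus lower powers of P. -/
lemma span_sphBasis_le (hn : 0 < n) (ht : (t : K) ∈ O) {F : K[X]} (hF : F ∈ spherical O t n μ) :
    F ∈ Submodule.span O (Set.range (sphBasis O t n μ)) := by
  set S := Submodule.span O (Set.range (sphBasis O t n μ)) with hS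
  have hB : ∀ j, sphBasis O t n μ j ∈ S := fun j => Submodule.subset_span ⟨j, rfl⟩
  have hone : (1 : K[X]) ∈ S := by simpa [sphBasis] using hB 0
  have hlin : ∀ x : K[X], (∀ j, x * sphBasis O t n μ j ∈ S) → ∀ y ∈ S, x * y ∈ S := by
    intro x hx y hy
    induction hy using Submodule.span_induction with
    | mem y hy => obtain ⟨j, rfl⟩ := hy; exact hx j
    | zero => rw [mul_zero]; exact zero_mem _
    | add y z _ _ hy hz => rw [mul_add]; exact add_mem hy hz
    | smul a y _ hy => rw [mul_smul_comm]; exact S.smul_mem a hy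
  have hHS : ∀ j, sphH O t n μ * sphBasis O t n μ j = sphBasis O t n μ (j + n) := by
    intro j
    rw [sphBasis, sphBasis, Nat.add_div_right _ hn, Nat.add_mod_right, pow_succ']
    ring
  have hPow : sphP t ^ n = C (t : K) ^ n * sphH O t n μ
      - ∑ i ∈ Finset.range n, ((∏ r ∈ Finset.range n, (X - C (μ r)) : O[X]).coeff i) • sphP t ^ i := by
    set q : O[X] := ∏ r ∈ Finset.range n, (X - C (μ r)) with hq
    rcases subsingleton_or_nontrivial O with hsub | hnt
    · have : Subsingleton K := subsingleton_of_zero_eq_one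
        (congrArg Subtype.val (Subsingleton.elim (0 : O) 1))
      exact Subsingleton.elim _ _
    have hqm : q.Monic := monic_prod_of_monic _ _ fun i _ => monic_X_sub_C _
    have hqd : q.natDegree = n := by
      rw [hq, natDegree_prod_of_monic _ _ fun i _ => monic_X_sub_C _]
      simp
    have h1 : C (t : K) ^ n * sphH O t n μ = aeval (sphP t) q := by
      rw [sphH, ← mul_assoc, ← mul_pow, ← C_mul, Units.mul_inv, C_1, one_pow, one_mul, hq, map_prod]
      refine Finset.prod_congr rfl fun i _ => ?_
      rw [map_sub, aeval_X, aeval_C]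
      rfl
    have h2 : aeval (sphP t) q = aeval (sphP t) (X ^ n + ∑ i ∈ Finset.range n, C (q.coeff i) * X ^ i) := by
      conv_lhs => rw [hqm.as_sum, hqd]
    rw [h1, h2]
    simp only [map_add, map_pow, aeval_X, map_sum, map_mul, aeval_C, Algebra.smul_def,
      add_sub_cancel_right]
  have hPS : ∀ j, sphP t * sphBasis O t n μ j ∈ S := by
    intro j
    have hlt := Nat.mod_lt j hn
    rcases eq_or_ne (j % n + 1) n with h | h
    · have e : sphP t * sphBasis O t n μ j = sphH O t n μ ^ (j / n) * sphP t ^ n := by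
        rw [sphBasis, mul_left_comm, ← pow_succ', h]
      rw [e, hPow, mul_sub, Finset.mul_sum]
      refine sub_mem ?_ (sum_mem fun i hi => ?_)
      · have e2 : sphH O t n μ ^ (j / n) * (C (t : K) ^ n * sphH O t n μ)
            = (⟨t, ht⟩ ^ n : O) • sphBasis O t n μ (n * (j / n + 1)) := by
          rw [sphBasis, Nat.mul_div_cancel_left _ hn, Nat.mul_mod_right, Algebra.smul_def]
          have : algebraMap O K[X] (⟨t, ht⟩ ^ n) = C (t : K) ^ n := by
            rw [map_pow]; rfl
          rw [this]
          ring
        rw [e2]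
        exact S.smul_mem _ (hB _)
      · have hi' := Finset.mem_range.mp hi
        have e3 : sphH O t n μ ^ (j / n) * sphP t ^ i = sphBasis O t n μ (n * (j / n) + i) := by
          rw [sphBasis, Nat.mul_add_div hn, Nat.div_eq_of_lt hi', Nat.mul_add_mod,
            Nat.mod_eq_of_lt hi', add_zero]
        rw [mul_smul_comm, e3]
        exact S.smul_mem _ (hB _)
    · have e : sphP t * sphBasis O t n μ j = sphBasis O t n μ (j + 1) := by
        have hm : (j + 1) % n = j % n + 1 := by
          rw [Nat.add_mod, Nat.mod_eq_of_lt (a := 1) (by omega), Nat.mod_eq_of_lt (by omega)]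
        have hd : (j + 1) / n = j / n := by
          rw [Nat.succ_div, if_neg, add_zero]
          rw [Nat.dvd_iff_mod_eq_zero, hm]; omega
        rw [sphBasis, sphBasis, hm, hd, pow_succ]
        ring
      rw [e]
      exact hB _
  have hmul : ∀ x ∈ spherical O t n μ, ∀ y ∈ S, x * y ∈ S := by
    intro x hx
    induction hx using Algebra.adjoin_induction with
    | mem x hx =>
      rcases hx with rfl | rfl
      · exact hlin _ hPS
      · exact hlin _ fun j => by rw [hHS]; exact hB _
    | algebraMap r => intro y hy; rw [← Algebra.smul_def]; exact S.smul_mem r hy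
    | add x y _ _ hx hy => intro z hz; rw [add_mul]; exact add_mem (hx z hz) (hy z hz)
    | mul x y _ _ hx hy => intro z hz; rw [mul_assoc]; exact hx _ (hy z hz)
  simpa using hmul F hF 1 hone

/-- The top coefficient of an element of the spherical subalgebra. -/
lemma coeff_of_mem_spherical [Nontrivial K] (hn : 0 < n) (ht : (t : K) ∈ O) {F : K[X]}
    (hF : F ∈ spherical O t n μ) {d : ℕ} (hd : F.natDegree ≤ d) :
    ∃ g ∈ O, F.coeff d = g * (t : K) ^ (d % n) := by
  obtain ⟨c, rfl⟩ := (Finsupp.mem_span_range_iff_exists_finsupp).mp (span_sphBasis_le t n μ hn ht hF)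
  have hco : ∀ d, (c.sum fun j a => a • sphBasis O t n μ j).coeff d
      = ∑ j ∈ c.support, (c j : K) * (sphBasis O t n μ j).coeff d := by
    intro d
    rw [Finsupp.sum, finsetSum_coeff]
    rfl
  have hzero : ∀ J, (∀ j ∈ c.support, j ≤ J) →
      (c.sum fun j a => a • sphBasis O t n μ j).coeff J = (c J : K) * (t : K) ^ (J % n) := by
    intro J hJ
    rw [hco, ← coeff_sphBasis_self t n μ J]
    refine Finset.sum_eq_single J (fun j hj hne => ?_) fun h => ?_
    · rw [coeff_eq_zero_of_natDegree_lt, mul_zero]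
      exact (natDegree_sphBasis_le t n μ j).trans_lt (lt_of_le_of_ne (hJ j hj) hne)
    · rw [Finsupp.notMem_support_iff.mp h]; simp
  -- The j-th basis element has degree at most j, with j-th coefficient t^(j mod n), a unit of K.
  -- Leading terms of distinct indices cannot cancel, so a degree bound on the sum bounds the
  -- support.
  have hsupp : ∀ j ∈ c.support, j ≤ d := by
    by_contra hcon
    push Not at hcon
    obtain ⟨j, hj, hdj⟩ := hcon
    have hne : c.support.Nonempty := ⟨j, hj⟩
    set J := c.support.max' hne
    have hJ : d < J := hdj.trans_le (c.support.le_max' j hj)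
    have h1 := hzero J fun j hj => c.support.le_max' j hj
    rw [coeff_eq_zero_of_natDegree_lt (hd.trans_lt hJ)] at h1
    have h2 : (c J : K) = 0 := by
      have hu : IsUnit ((t : K) ^ (J % n)) := t.isUnit.pow _
      exact (hu.mul_left_eq_zero).mp h1.symm
    exact Finsupp.mem_support_iff.mp (c.support.max'_mem hne) (Subtype.ext h2)
  exact ⟨c d, (c d).2, hzero d hsupp⟩

end Spherical

/-! ### Punctured germs and equivariant divisibility. -/

section Germs

/-- Germs of functions on punctured neighbourhoods of `0`. -/
abbrev PGerm : Type := Germ (𝓝[≠] (0 : ℂ)) ℂ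

/-- The germ at `0` of a function. -/
def toGerm : (ℂ → ℂ) →+* PGerm := Germ.coeRingHom _

lemma toGerm_eq_iff {f g : ℂ → ℂ} : toGerm f = toGerm g ↔ f =ᶠ[𝓝[≠] 0] g := Germ.coe_eq

/-- The germ of a function at `x`. -/
def germAt (x : ℂ) : (ℂ → ℂ) →+* PGerm where
  toFun f := toGerm fun t => f (x + t)
  map_one' := rfl
  map_mul' _ _ := rfl
  map_zero' := rfl
  map_add' _ _ := rfl

lemma germAt_apply (x : ℂ) (f : ℂ → ℂ) : germAt x f = toGerm fun t => f (x + t) := rfl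

/-- Germs of functions which are analytic at `0`. -/
def analyticGerms : Subring PGerm where
  carrier := {a | ∃ f : ℂ → ℂ, AnalyticAt ℂ f 0 ∧ toGerm f = a}
  mul_mem' := by
    rintro _ _ ⟨f, hf, rfl⟩ ⟨g, hg, rfl⟩
    exact ⟨f * g, hf.mul hg, map_mul _ _ _⟩
  one_mem' := ⟨1, analyticAt_const, map_one _⟩
  add_mem' := by
    rintro _ _ ⟨f, hf, rfl⟩ ⟨g, hg, rfl⟩
    exact ⟨f + g, hf.add hg, map_add _ _ _⟩
  zero_mem' := ⟨0, analyticAt_const, map_zero _⟩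
  neg_mem' := by
    rintro _ ⟨f, hf, rfl⟩
    exact ⟨-f, hf.neg, map_neg _ _⟩

lemma toGerm_mem {f : ℂ → ℂ} (hf : AnalyticAt ℂ f 0) : toGerm f ∈ analyticGerms := ⟨f, hf, rfl⟩

lemma isRegular_of_germAt_mem {f : ℂ → ℂ} {x : ℂ} (h : germAt x f ∈ analyticGerms) :
    IsRegular f x := by
  obtain ⟨g, hg, he⟩ := h
  rw [germAt_apply, toGerm_eq_iff] at he
  refine ⟨fun z => g (z + -x), ?_, ?_⟩
  · refine AnalyticAt.fun_comp (f := fun z => z + -x) ?_ (by fun_prop)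
    simpa using hg
  · have h1 := tendsto_add_punctured x (-x)
    rw [add_neg_cancel] at h1
    filter_upwards [h1.eventually he] with z hz
    rw [hz]
    simp

/-- The germ of the coordinate. -/
def coordGerm : PGermˣ where
  val := toGerm fun t => t
  inv := toGerm fun t => t⁻¹
  val_inv := by
    rw [← map_mul, ← map_one toGerm, toGerm_eq_iff]
    filter_upwards [self_mem_nhdsWithin] with t ht
    exact mul_inv_cancel₀ ht
  inv_val := by
    rw [← map_mul, ← map_one toGerm, toGerm_eq_iff]
    filter_upwards [self_mem_nhdsWithin] with t ht
    exact inv_mul_cancel₀ ht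

lemma coordGerm_mem : (coordGerm : PGerm) ∈ analyticGerms := toGerm_mem analyticAt_id

/-- A sequence of constants, as germs. -/
def constGerms (μ : ℕ → ℂ) (j : ℕ) : analyticGerms :=
  ⟨toGerm fun _ => μ j, toGerm_mem analyticAt_const⟩

/-- Divisibility by powers of the coordinate for functions equivariant under a root of unity. -/
lemma exists_eq_pow_mul_of_equivariant {f : ℂ → ℂ} (hf : AnalyticAt ℂ f 0) {n s e : ℕ} {u : ℂ}
    (hu : IsPrimitiveRoot u n) (hn : 0 < n)
    (hequiv : ∀ᶠ t in 𝓝[≠] (0 : ℂ), f (u * t) = u ^ s * f t)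
    (he : ∀ k, k ≡ s [MOD n] → (f 0 = 0 → k ≠ 0) → e ≤ k) :
    ∃ g : ℂ → ℂ, AnalyticAt ℂ g 0 ∧ ∀ᶠ t in 𝓝[≠] (0 : ℂ), f t = t ^ e * g t := by
  by_cases htop : analyticOrderAt f 0 = ⊤
  · refine ⟨0, analyticAt_const, ?_⟩
    filter_upwards [nhdsWithin_le_nhds (analyticOrderAt_eq_top.mp htop)] with t ht
    simp [ht]
  obtain ⟨g, hg, hg0, hfg⟩ := hf.analyticOrderAt_ne_top.mp htop
  set k := analyticOrderNatAt f 0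
  simp only [sub_zero, smul_eq_mul] at hfg
  have hu0 : u ≠ 0 := hu.ne_zero hn.ne'
  -- Write f = t^k g with g(0) ≠ 0. Comparing leading coefficients in the equivariance gives u^k =
  -- u^s, so k ≡ s mod n, and `he` bounds k from below.
  have h1 : u ^ k * g 0 = u ^ s * g 0 := by
    have hm : Tendsto (fun t => u * t) (𝓝[≠] (0 : ℂ)) (𝓝[≠] (0 : ℂ)) := by
      simpa using tendsto_affine_punctured (b := 0) (z₀ := 0) hu0
    have hev : (fun t => u ^ k * g (u * t)) =ᶠ[𝓝[≠] (0 : ℂ)] fun t => u ^ s * g t := by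
      filter_upwards [hequiv, hm.eventually (nhdsWithin_le_nhds hfg), nhdsWithin_le_nhds hfg,
        self_mem_nhdsWithin] with t h1 h2 h3 h4
      rw [h2, h3, mul_pow] at h1
      have h5 : t ^ k ≠ 0 := pow_ne_zero _ h4
      refine mul_left_cancel₀ h5 ?_
      linear_combination h1
    have hgc := hg.continuousAt
    have h2 := eq_of_eventuallyEq_punctured hev
      (continuousAt_const.mul (ContinuousAt.comp (f := fun t => u * t) (by simpa using hgc)
        (by fun_prop))) (continuousAt_const.mul hgc)
    simpa using h2
  have h2 : k ≡ s [MOD n] := by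
    have h3 := mul_right_cancel₀ hg0 h1
    have h4 : IsPrimitiveRoot (Units.mk0 u hu0) n := by
      rw [← IsPrimitiveRoot.coe_units_iff]; exact hu
    rw [h4.eq_orderOf]
    refine pow_eq_pow_iff_modEq.mp (Units.ext ?_)
    simpa using h3
  have hk : e ≤ k := he k h2 fun hf0 hk0 => by
    have := hfg.self_of_nhds
    simp only [hf0, hk0, pow_zero, one_mul] at this
    exact hg0 this.symm
  refine ⟨fun t => t ^ (k - e) * g t, by fun_prop, ?_⟩
  filter_upwards [nhdsWithin_le_nhds hfg] with t ht
  rw [ht, ← mul_assoc, ← pow_add, Nat.add_sub_cancel' hk]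

end Germs

/-! ### Stabilizers in ℤ/m. -/

section Stabilizer

variable {L : PeriodPair} {m : ℕ} [NeZero m]

/-- The stabilizer of the point `x` of the curve. -/
def stab (hL : ∀ γ ∈ L.lattice, om m 1 * γ ∈ L.lattice) (x : ℂ) : AddSubgroup (ZMod m) where
  carrier := {l | Om m l * x ∈ L.lattice}
  zero_mem' := by simp [Om, om_zero]
  add_mem' {a b} ha hb := by
    have e : Om m (a + b) * x = Om m a * x + om m a * (Om m b * x) := by
      simp only [Om, om_add]; ring
    rw [Set.mem_ofPred_eq, e]
    exact add_mem ha (om_mul_mem hL a hb)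
  neg_mem' {a} ha := by
    rw [Set.mem_ofPred_eq, Om_neg_mul_mem_iff hL]
    exact ha

lemma mem_stab (hL : ∀ γ ∈ L.lattice, om m 1 * γ ∈ L.lattice) {x : ℂ} {l : ZMod m} :
    l ∈ stab hL x ↔ Om m l * x ∈ L.lattice := Iff.rfl

/-- A generator `g` of the stabilizer of `x`, and its order `n`. -/
lemma exists_generator (hL : ∀ γ ∈ L.lattice, om m 1 * γ ∈ L.lattice) (x : ℂ) :
    ∃ (n : ℕ) (g : ZMod m), 0 < n ∧ n ∣ m ∧ Om m g * x ∈ L.lattice ∧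
      IsPrimitiveRoot (om m (-g)) n ∧ (∀ l : ZMod m, Om m l * x ∈ L.lattice → n • l = 0) ∧
      (x ∈ L.lattice → n = m) := by
  obtain ⟨g, hg⟩ := IsAddCyclic.exists_ofOrder_eq_natCard (α := stab hL x)
  refine ⟨Nat.card (stab hL x), g, Nat.card_pos, ?_, g.2, ?_, ?_, ?_⟩
  · have := AddSubgroup.card_addSubgroup_dvd_card (stab hL x)
    simpa using this
  · have h1 : addOrderOf (-(g : ZMod m)) = Nat.card (stab hL x) := by
      rw [addOrderOf_neg, AddSubgroup.addOrderOf_coe, hg]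
    rw [← h1]
    refine ⟨?_, fun k hk => ?_⟩
    · rw [← om_nsmul, addOrderOf_nsmul_eq_zero, om_zero]
    · rw [← om_nsmul, om_eq_one_iff] at hk
      exact addOrderOf_dvd_of_nsmul_eq_zero hk
  · intro l hl
    have := card_nsmul_eq_zero' (G := stab hL x) (x := ⟨l, hl⟩)
    exact congrArg Subtype.val this
  · intro hx
    have : stab hL x = ⊤ := by
      ext l
      simpa [mem_stab] using Om_mul_mem hL l hx
    rw [this]
    simp

end Stabilizer

/-! ### The Lax matrix near a point: gauge, symmetry, Fourier transform. -/

section LocalLax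

variable {L : PeriodPair} {m : ℕ} [NeZero m]

variable (L) in
/-- The off-diagonal part of the Lax matrix, as a function of `q`. -/
def laxOff (c : Family L m) (α : ℂ) (i j : ZMod m) (q : ℂ) : ℂ :=
  if i = j then 0 else -vKer L m c (i - j) (om m (-i) * q) α

variable (L) in
/-- The diagonal gauge making the Lax matrix equivariant near `x`. -/
def gauge (x α : ℂ) (i : ZMod m) : ℂ := Complex.exp (eta L x * om m i * α)

lemma gauge_ne_zero (x α : ℂ) (i : ZMod m) : gauge L x α i ≠ 0 := Complex.exp_ne_zero _

lemma gauge_mul_inv (x α : ℂ) (i j : ZMod m) :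
    gauge L x α i * (gauge L x α j)⁻¹ = Complex.exp (eta L x * (om m i - om m j) * α) := by
  rw [gauge, gauge, ← Complex.exp_neg, ← Complex.exp_add]
  congr 1
  ring

variable (L) in
/-- The gauge-transformed off-diagonal part of the Lax matrix, expanded at `x`. -/
def laxGauged (c : Family L m) (x α : ℂ) (i j : ZMod m) (t : ℂ) : ℂ :=
  gauge L x α i * laxOff L c α i j (x + t) * (gauge L x α j)⁻¹

lemma om_mul_Om_neg (i j : ZMod m) : om m i * Om m (-(i - j)) = om m i - om m j := by
  rw [Om, mul_sub, mul_one, ← om_add]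
  congr 2
  ring

/-- The gauge exactly cancels the exponential in the residue of the kernel, so the residue matrix no
longer depends on α. -/
lemma hasResidue_laxGauged (hL : ∀ γ ∈ L.lattice, om m 1 * γ ∈ L.lattice) {c : Family L m}
    (hc : IsCoupling L m c) (x : ℂ) {α : ℂ} (hα : IsNotFixed L m α) (i j : ZMod m) :
    HasResidue (laxGauged L c x α i j) 0 (-(om m i * c (i - j) (L.lattice.mkQ x))) := by
  by_cases hij : i = j
  · subst hij
    have : laxGauged L c x α i i = fun _ => 0 := by
      funext t; simp [laxGauged, laxOff]
    rw [this, sub_self, hc.index_zero, mul_zero, neg_zero]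
    exact AnalyticAt.hasResidue analyticAt_const
  have hl : i - j ≠ 0 := sub_ne_zero.mpr hij
  have h1 := hasResidue_vKer hL hc hl (om m (-i) * x) (hα _ (neg_ne_zero.mpr hl))
  have h2 := (HasResidue.comp_affine (a := om m (-i)) (b := om m (-i) * x) (z₀ := 0)
    (om_ne_zero _) (by rw [mul_zero, zero_add]; exact h1)).const_mul
      (-(gauge L x α i * (gauge L x α j)⁻¹))
  have e : Complex.exp (-eta L (Om m (i - j) * (om m (-i) * x)) * α)
      = (gauge L x α i * (gauge L x α j)⁻¹)⁻¹ := by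
    rw [gauge_mul_inv, ← Complex.exp_neg, eta_Om_mul hL, eta_om_mul hL, neg_neg, ← om_mul_Om_neg]
    congr 1
    ring
  rw [e, hc.invariant] at h2
  have hg := mul_ne_zero (gauge_ne_zero (L := L) x α i) (inv_ne_zero (gauge_ne_zero (L := L) x α j))
  have e2 : -(gauge L x α i * (gauge L x α j)⁻¹) * ((om m (-i))⁻¹ *
      (c (i - j) (L.lattice.mkQ x) * (gauge L x α i * (gauge L x α j)⁻¹)⁻¹))
      = -(om m i * c (i - j) (L.lattice.mkQ x)) := by
    rw [← om_neg, neg_neg]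
    generalize gauge L x α i * (gauge L x α j)⁻¹ = w at hg ⊢
    field_simp
  rw [e2] at h2
  refine h2.congr (.of_forall fun t => ?_)
  simp only [laxGauged, laxOff, if_neg hij, mul_add]
  rw [add_comm (om m (-i) * t)]
  ring

/-- Since s^g fixes x, shifting both indices by g amounts to t ↦ ω^(-g) t followed by a lattice
translation, whose multiplier is absorbed by the gauge. -/
lemma laxGauged_shift (hL : ∀ γ ∈ L.lattice, om m 1 * γ ∈ L.lattice) (c : Family L m) {x : ℂ}
    (α : ℂ) {g : ZMod m} (hg : Om m g * x ∈ L.lattice) (i j : ZMod m) (t : ℂ) :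
    laxGauged L c x α (i + g) (j + g) t = laxGauged L c x α i j (om m (-g) * t) := by
  by_cases hij : i = j
  · simp [laxGauged, laxOff, hij]
  have hij' : i + g ≠ j + g := by simpa using hij
  have e0 : i + g - (j + g) = i - j := by ring
  have hγ : -(om m (-i) * (Om m (-g) * x)) ∈ L.lattice :=
    neg_mem (om_mul_mem hL _ ((Om_neg_mul_mem_iff hL g x).mpr hg))
  have e1 : om m (-(i + g)) * (x + t)
      = om m (-i) * (x + om m (-g) * t) + -(om m (-i) * (Om m (-g) * x)) := by
    rw [neg_add, om_add, Om]; ring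
  simp only [laxGauged, laxOff, if_neg hij, if_neg hij', e0]
  have key : gauge L x α (i + g) * (gauge L x α (j + g))⁻¹
      * Complex.exp (-eta L (-(om m (-i) * (Om m (-g) * x))) * (Om m (-(i - j)) * α))
      = gauge L x α i * (gauge L x α j)⁻¹ := by
    rw [gauge_mul_inv, gauge_mul_inv, ← Complex.exp_add, eta_neg, eta_om_mul hL, eta_Om_mul hL,
      neg_neg, neg_neg, neg_neg, om_add, om_add]
    congr 1
    have h1 := om_mul_Om_neg i j
    have h2 : Om m g = 1 - om m g := rfl
    rw [h2]
    linear_combination (1 - om m g) * eta L x * α * h1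
  rw [e1, vKer_add_left c _ hγ]
  linear_combination (-vKer L m c (i - j) (om m (-i) * (x + om m (-g) * t)) α) * key

variable (L) in
/-- The gauge-transformed off-diagonal part in the Fourier basis. -/
def laxFourier (c : Family L m) (x α : ℂ) (s r : ZMod m) (t : ℂ) : ℂ :=
  ∑ i : ZMod m, ∑ j : ZMod m,
    (m : ℂ)⁻¹ * om m (-(s * i)) * om m (r * j) * laxGauged L c x α i j t

lemma sum_om_mul (a : ZMod m) : ∑ i : ZMod m, om m (a * i) = if a = 0 then (m : ℂ) else 0 := by
  have := AddChar.sum_mulShift (R := ZMod m) (R' := ℂ) a (ZMod.isPrimitive_stdAddChar m)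
  simp only [ZMod.card] at this
  simp only [om, mul_comm a]
  rw [this]
  split_ifs <;> simp

lemma fourier_orthogonality (s r : ZMod m) :
    ∑ i : ZMod m, (m : ℂ)⁻¹ * om m (-(s * i)) * om m (r * i) = if s = r then 1 else 0 := by
  have h : ∀ i : ZMod m, (m : ℂ)⁻¹ * om m (-(s * i)) * om m (r * i)
      = (m : ℂ)⁻¹ * om m ((r - s) * i) := fun i => by
    rw [mul_assoc, ← om_add]; congr 2; ring
  have hm : (m : ℂ) ≠ 0 := Nat.cast_ne_zero.mpr (NeZero.ne m)
  simp only [h, ← Finset.mul_sum, sum_om_mul, sub_eq_zero, eq_comm (a := r)]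
  split_ifs <;> simp [hm]

lemma fourier_orthogonality_om (s r : ZMod m) :
    ∑ i : ZMod m, (m : ℂ)⁻¹ * om m (-(s * i)) * om m i * om m (r * i)
      = if s = r + 1 then 1 else 0 := by
  rw [← fourier_orthogonality]
  refine Finset.sum_congr rfl fun i _ => ?_
  rw [mul_assoc, ← om_add]
  congr 2
  ring

/-- The residue matrix is diag(ω^i) times a circulant. The Fourier transform diagonalizes the
circulant, with eigenvalues -μ_r(x), and turns diag(ω^i) into the shift r ↦ r + 1. -/
lemma hasResidue_laxFourier (hL : ∀ γ ∈ L.lattice, om m 1 * γ ∈ L.lattice) {c : Family L m}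
    (hc : IsCoupling L m c) (x : ℂ) {α : ℂ} (hα : IsNotFixed L m α) (s r : ZMod m) :
    HasResidue (laxFourier L c x α s r) 0
      (if s = r + 1 then -mu L m c r.val (L.lattice.mkQ x) else 0) := by
  have h1 := HasResidue.sum Finset.univ fun i (_ : i ∈ Finset.univ) =>
    HasResidue.sum Finset.univ fun j (_ : j ∈ Finset.univ) =>
      (hasResidue_laxGauged hL hc x hα i j).const_mul
        ((m : ℂ)⁻¹ * om m (-(s * i)) * om m (r * j))
  have h2 : ∀ i : ZMod m, ∑ j : ZMod m, (m : ℂ)⁻¹ * om m (-(s * i)) * om m (r * j) *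
      -(om m i * c (i - j) (L.lattice.mkQ x))
      = -((m : ℂ)⁻¹ * om m (-(s * i)) * om m i * om m (r * i)
        * mu L m c r.val (L.lattice.mkQ x)) := by
    intro i
    rw [← Equiv.sum_comp (Equiv.subLeft i), mu, Finset.mul_sum, ← Finset.sum_neg_distrib]
    refine Finset.sum_congr rfl fun l _ => ?_
    rw [ZMod.natCast_zmod_val, Equiv.subLeft_apply, sub_sub_cancel, mul_sub, sub_eq_add_neg, om_add,
      neg_mul]
    ring
  simp only [h2, Finset.sum_neg_distrib, ← Finset.sum_mul, fourier_orthogonality_om] at h1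
  rw [neg_mul_eq_neg_mul, neg_mul, ite_mul, one_mul, zero_mul] at h1
  convert h1 using 1
  · rfl
  · split_ifs <;> simp

lemma laxFourier_mul (hL : ∀ γ ∈ L.lattice, om m 1 * γ ∈ L.lattice) (c : Family L m) {x : ℂ}
    (α : ℂ) {g : ZMod m} (hg : Om m g * x ∈ L.lattice) (s r : ZMod m) (t : ℂ) :
    laxFourier L c x α s r (om m (-g) * t)
      = om m (-g * (r - s)) * laxFourier L c x α s r t := by
  have h : ∀ i j, laxGauged L c x α i j (om m (-g) * t) = laxGauged L c x α (i + g) (j + g) t :=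
    fun i j => (laxGauged_shift hL c α hg i j t).symm
  unfold laxFourier
  simp only [h]
  rw [← Equiv.sum_comp (Equiv.addRight g)
    (fun i => ∑ j, (m : ℂ)⁻¹ * om m (-(s * i)) * om m (r * j) * laxGauged L c x α i j t),
    Finset.mul_sum]
  refine Finset.sum_congr rfl fun i _ => ?_
  rw [← Equiv.sum_comp (Equiv.addRight g) (fun j => (m : ℂ)⁻¹ *
    om m (-(s * (Equiv.addRight g i))) * om m (r * j) * laxGauged L c x α (Equiv.addRight g i) j t),
    Finset.mul_sum]
  refine Finset.sum_congr rfl fun j _ => ?_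
  simp only [Equiv.coe_addRight]
  have e : om m (-(s * i)) * om m (r * j)
      = om m (-g * (r - s)) * (om m (-(s * (i + g))) * om m (r * (j + g))) := by
    simp only [← om_add]
    congr 1
    ring
  linear_combination (m : ℂ)⁻¹ * laxGauged L c x α (i + g) (j + g) t * e

/-- Only l in the stabilizer of x contribute, and these are annihilated by n. -/
lemma mu_mod {c : Family L m}
    (hc : IsCoupling L m c) {x : ℂ} {n : ℕ}
    (hn : ∀ l : ZMod m, Om m l * x ∈ L.lattice → n • l = 0) (j : ℕ) :
    mu L m c (j % n) (L.lattice.mkQ x) = mu L m c j (L.lattice.mkQ x) := by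
  unfold mu
  refine Finset.sum_congr rfl fun l _ => ?_
  by_cases hl : Om m l * x ∈ L.lattice
  · congr 2
    have h1 : ((n * (j / n) : ℕ) : ZMod m) * l = 0 := by
      have := hn l hl
      rw [nsmul_eq_mul] at this
      push_cast
      linear_combination ((j / n : ℕ) : ZMod m) * this
    conv_rhs => rw [← Nat.div_add_mod j n]
    rw [Nat.cast_add]
    linear_combination h1
  · rw [hc.not_fixed l x hl]
    simp

/-- The shape of the Fourier coefficients near `x`. -/
lemma laxFourier_eq (hL : ∀ γ ∈ L.lattice, om m 1 * γ ∈ L.lattice) {c : Family L m}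
    (hc : IsCoupling L m c) {x : ℂ} {α : ℂ} (hα : IsNotFixed L m α) {n : ℕ} {g : ZMod m}
    (hn : 0 < n) (hg : Om m g * x ∈ L.lattice) (hgn : IsPrimitiveRoot (om m (-g)) n)
    (s r : ZMod m) : ∃ h : ℂ → ℂ, AnalyticAt ℂ h 0 ∧ ∀ᶠ t in 𝓝[≠] (0 : ℂ),
      t ^ (s.val % n) * (t⁻¹) ^ (r.val % n) * laxFourier L c x α s r t
        = t ^ (s.val % n) * (t⁻¹) ^ (r.val % n + 1)
            * (if s = r + 1 then -mu L m c r.val (L.lattice.mkQ x) else 0)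
          + h t * (if r.val % n < s.val % n then t ^ n else 1) := by
  set R := (if s = r + 1 then -mu L m c r.val (L.lattice.mkQ x) else 0) with hR
  obtain ⟨f, hf, hf0, hfe⟩ := hasResidue_laxFourier hL hc x hα s r
  rw [← hR] at hf0
  set u := om m (-g) with hu
  -- The representative in {1, …, n} of (r mod n) - (s mod n) + 1. Equivariance forces t ·
  -- `laxFourier` minus its residue to vanish to this order: an order congruent to e mod n that is
  -- nonzero is at least e.
  set e := r.val % n + 1 + (if r.val % n < s.val % n then n else 0) - s.val % n with he
  have hrn := Nat.mod_lt r.val hn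
  have hsn := Nat.mod_lt s.val hn
  have hes : e + s.val % n = r.val % n + 1 + (if r.val % n < s.val % n then n else 0) := by
    split_ifs at he ⊢ <;> omega
  have he1 : 1 ≤ e ∧ e ≤ n := by split_ifs at he ⊢ <;> omega
  have hu0 : u ≠ 0 := om_ne_zero _
  have hue : u * om m (-g * (r - s)) = u ^ e := by
    have h1 : ∀ a : ZMod m, om m (-g * a) = u ^ (a.val % n) := by
      intro a
      conv_lhs => rw [← ZMod.natCast_zmod_val a, mul_comm, ← nsmul_eq_mul, om_nsmul]
      rw [← hu, hgn.eq_orderOf, pow_mod_orderOf]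
    have h2 : om m (-g * (r - s)) * u ^ (s.val % n) = u ^ (r.val % n) := by
      rw [← h1, ← h1, ← om_add]; congr 1; ring
    have h3 : u ^ (if r.val % n < s.val % n then n else 0) = 1 := by
      split_ifs
      · exact hgn.pow_eq_one
      · simp
    refine mul_right_cancel₀ (pow_ne_zero (s.val % n) hu0) ?_
    rw [← pow_add, hes, pow_add, h3, mul_assoc, h2]
    ring
  have hm : Tendsto (fun t => u * t) (𝓝[≠] (0 : ℂ)) (𝓝[≠] (0 : ℂ)) := by
    simpa using tendsto_affine_punctured (b := 0) (z₀ := 0) hu0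
  simp only [sub_zero] at hfe
  have hequiv : ∀ᶠ t in 𝓝[≠] (0 : ℂ), f (u * t) - R = u ^ e * (f t - R) := by
    filter_upwards [hfe, hm.eventually hfe, self_mem_nhdsWithin] with t h1 h2 h3
    have h3' : t ≠ 0 := h3
    rw [laxFourier_mul hL c α hg, h1] at h2
    have h4 : f (u * t) = u ^ e * f t := by
      rw [← hue, ← mul_inv_cancel_left₀ (mul_ne_zero hu0 h3') (f (u * t)), ← h2]
      field_simp
    rw [h4, mul_sub]
    congr 1
    by_cases hsr : s = r + 1
    · rw [← hue, hsr]
      have : -g * (r - (r + 1)) = g := by ring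
      rw [this, hu, mul_comm u, om_mul_neg, one_mul]
    · rw [hR, if_neg hsr, mul_zero]
  obtain ⟨h, hh, hhe⟩ := exists_eq_pow_mul_of_equivariant (f := fun t => f t - R)
    (hf.sub analyticAt_const) hgn hn (s := e) (e := e) hequiv (by
      intro k hk hk0
      have hk0' := hk0 (by simp [hf0])
      by_contra hlt
      push Not at hlt
      rcases he1.2.lt_or_eq with h | h
      · have := Nat.ModEq.eq_of_lt_of_lt hk (by omega) h
        omega
      · have h1 : k % n = e % n := hk
        rw [h, Nat.mod_self, Nat.mod_eq_of_lt (by omega)] at h1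
        exact hk0' h1)
  refine ⟨h, hh, ?_⟩
  filter_upwards [hfe, hhe, self_mem_nhdsWithin] with t h1 h2 h3
  have h3' : t ≠ 0 := h3
  have h4 : t ^ e * t ^ (s.val % n) = t ^ (r.val % n) * t
      * (if r.val % n < s.val % n then t ^ n else 1) := by
    rw [← pow_add, hes]
    split_ifs
    · ring
    · ring
  have h5 : f t = R + t ^ e * h t := by rw [← h2]; ring
  rw [h1, h5]
  have h6 : (t⁻¹) ^ (r.val % n) * t ^ (r.val % n) = 1 := by
    rw [← mul_pow, inv_mul_cancel₀ h3', one_pow]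
  have h7 : t⁻¹ * t = 1 := inv_mul_cancel₀ h3'
  rw [pow_succ]
  generalize (if r.val % n < s.val % n then t ^ n else 1) = w at h4 ⊢
  linear_combination (t⁻¹ ^ (r.val % n) * t⁻¹ * h t) * h4 + t * t⁻¹ * w * h t * h6 + w * h t * h7

end LocalLax

/-! ### The determinant is locally spherical. -/

section LocalLaxDet

open Polynomial

variable {L : PeriodPair} {m : ℕ} [NeZero m]

variable (L) in
/-- The Lax matrix minus a scalar, as a matrix of polynomials in `p` whose coefficients are functions
of `q`. -/
def laxPoly (c : Family L m) (α k : ℂ) : Matrix (ZMod m) (ZMod m) (ℂ → ℂ)[X] :=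
  Matrix.of fun i j => (if i = j then C (fun _ => om m i) * X - C (fun _ => k) else 0)
    + C (laxOff L c α i j)

/-- The determinant of the Lax matrix lies in the local spherical subalgebra at every point. -/
lemma det_laxPoly_mem (hL : ∀ γ ∈ L.lattice, om m 1 * γ ∈ L.lattice) {c : Family L m}
    (hc : IsCoupling L m c) (x : ℂ) {α : ℂ} (hα : IsNotFixed L m α) (k : ℂ) {n : ℕ} {g : ZMod m}
    (hn : 0 < n) (hnm : n ∣ m) (hg : Om m g * x ∈ L.lattice)
    (hgn : IsPrimitiveRoot (om m (-g)) n)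
    (hst : ∀ l : ZMod m, Om m l * x ∈ L.lattice → n • l = 0) :
    (laxPoly L c α k).det.map (germAt x) ∈ spherical analyticGerms coordGerm n
      (constGerms fun j => mu L m c j (L.lattice.mkQ x)) := by
  set μ : ℕ → ℂ := fun j => mu L m c j (L.lattice.mkQ x) with hμ
  set A := spherical analyticGerms coordGerm n (constGerms μ) with hA
  -- U and V combine the gauge, the Fourier transform and the rescaling by powers of t. They are
  -- mutually inverse, so the determinant is unchanged while the entries take the shape required by
  -- `det_mem_of_spherical`, with xᵢ = tp - μᵢ and T = tⁿ.
  set U : Matrix (ZMod m) (ZMod m) PGerm[X] := Matrix.of fun s i =>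
    C (toGerm fun t => t ^ (s.val % n) * ((m : ℂ)⁻¹ * om m (-(s * i)) * gauge L x α i)) with hU
  set V : Matrix (ZMod m) (ZMod m) PGerm[X] := Matrix.of fun j r =>
    C (toGerm fun t => (gauge L x α j)⁻¹ * om m (r * j) * (t⁻¹) ^ (r.val % n)) with hV
  set M : Matrix (ZMod m) (ZMod m) PGerm[X] := (laxPoly L c α k).map (mapRingHom (germAt x)) with hM
  have hUV : U * V = 1 := by
    ext1 s r
    have h1 : (U * V) s r = C (toGerm fun t => t ^ (s.val % n) * (t⁻¹) ^ (r.val % n)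
        * if s = r then 1 else 0) := by
      simp only [Matrix.mul_apply, hU, hV, Matrix.of_apply, ← map_mul, ← map_sum]
      congr 2
      funext t
      rw [Finset.sum_apply, ← fourier_orthogonality, Finset.mul_sum]
      refine Finset.sum_congr rfl fun i _ => ?_
      simp only [Pi.mul_apply]
      have := gauge_ne_zero (L := L) x α i
      field_simp
    rw [h1, Matrix.one_apply]
    split_ifs with h
    · rw [← C_1, ← map_one toGerm, h]
      congr 1
      rw [toGerm_eq_iff]
      filter_upwards [self_mem_nhdsWithin] with t ht
      have ht' : t ≠ 0 := ht
      simp [ht']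
    · simp only [mul_zero]
      rw [← C_0, ← map_zero toGerm]
      rfl
  have hdet : (laxPoly L c α k).det.map (germAt x) = (U * M * V).det := by
    have h1 : (laxPoly L c α k).det.map (germAt x) = M.det :=
      RingHom.map_det (mapRingHom (germAt x)) _
    have h2 : U.det * V.det = 1 := by rw [← Matrix.det_mul, hUV, Matrix.det_one]
    rw [h1, Matrix.det_mul, Matrix.det_mul]
    linear_combination (-M.det) * h2
  rw [hdet]
  have hT : C ((coordGerm : PGerm) ^ n) ∈ A :=
    C_mem_spherical _ _ _ (pow_mem coordGerm_mem n)
  refine det_mem_of_spherical A.toSubring (n := n)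
    (fun i => sphP coordGerm - C (constGerms μ i : PGerm)) (C ((coordGerm : PGerm) ^ n))
    (C ((coordGerm⁻¹ : PGermˣ) : PGerm) ^ n) ?_ hT ?_ ?_ (fun r : ZMod m => r.val % n)
    (fun r => Nat.mod_lt _ hn) _ ?_
  · exact fun i => sub_mem (sphP_mem _ _ _) (C_mem_spherical _ _ _ (constGerms μ i).2)
  · rw [← C_pow, ← C_mul, ← mul_pow, Units.mul_inv, one_pow, C_1]
  · exact sphH_mem _ _ _
  intro s r
  obtain ⟨h, hh, hhe⟩ := laxFourier_eq hL hc hα hn hg hgn s r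
  -- The regular part comes from the remainder h and the spectral parameter. The shift part comes
  -- from s = r + 1, where the Fourier transform of diag(ω^i) p joins the pole -μ_r/t to form (tp -
  -- μ_r)/t.
  refine ⟨C (toGerm h) - (if s = r then C (toGerm fun _ => k) else 0), ?_,
    if s = r + 1 then 1 else 0, ?_, ?_⟩
  · refine sub_mem (C_mem_spherical _ _ _ (toGerm_mem hh)) ?_
    split_ifs
    · exact C_mem_spherical _ _ _ (toGerm_mem analyticAt_const)
    · exact zero_mem _
  · split_ifs
    · exact one_mem _
    · exact zero_mem _
  have hentry : (U * M * V) s r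
      = C (toGerm fun t => t ^ (s.val % n) * (t⁻¹) ^ (r.val % n) * if s = r + 1 then 1 else 0) * X
        - C (toGerm fun t => t ^ (s.val % n) * (t⁻¹) ^ (r.val % n) * if s = r then k else 0)
        + C (toGerm fun t => t ^ (s.val % n) * (t⁻¹) ^ (r.val % n) * laxFourier L c x α s r t) := by
    have hMij : ∀ i j, M i j = (if i = j then C (toGerm fun _ => om m i) * X - C (toGerm fun _ => k)
        else 0) + C (toGerm fun t => laxOff L c α i j (x + t)) := by
      intro i j
      simp only [hM, Matrix.map_apply, laxPoly, Matrix.of_apply, coe_mapRingHom, Polynomial.map_add,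
        map_C]
      congr 1
      split_ifs <;> simp [germAt_apply]
    have hsum : (U * M * V) s r = ∑ i, ∑ j, U s i * M i j * V j r := by
      rw [Matrix.mul_apply, Finset.sum_comm]
      refine Finset.sum_congr rfl fun j _ => ?_
      rw [Matrix.mul_apply, Finset.sum_mul]
    have hsplit : (U * M * V) s r = (∑ i, U s i * C (toGerm fun _ => om m i) * V i r) * X
        - ∑ i, U s i * C (toGerm fun _ => k) * V i r
        + ∑ i, ∑ j, U s i * C (toGerm fun t => laxOff L c α i j (x + t)) * V j r := by
      rw [hsum, Finset.sum_mul, ← Finset.sum_sub_distrib, ← Finset.sum_add_distrib]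
      refine Finset.sum_congr rfl fun i _ => ?_
      have h1 : ∀ j, U s i * M i j * V j r
          = (if i = j then U s i * (C (toGerm fun _ => om m i) * X - C (toGerm fun _ => k)) * V j r
            else 0) + U s i * C (toGerm fun t => laxOff L c α i j (x + t)) * V j r := by
        intro j
        rw [hMij]
        split_ifs <;> ring
      rw [Finset.sum_congr rfl fun j _ => h1 j, Finset.sum_add_distrib, Finset.sum_ite_eq,
        if_pos (Finset.mem_univ i)]
      ring
    rw [hsplit]
    congr 1
    · congr 1
      · congr 1
        simp only [hU, hV, Matrix.of_apply, ← map_mul, ← map_sum]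
        congr 2
        funext t
        rw [Finset.sum_apply, ← fourier_orthogonality_om, Finset.mul_sum]
        refine Finset.sum_congr rfl fun i _ => ?_
        simp only [Pi.mul_apply]
        have := gauge_ne_zero (L := L) x α i
        field_simp
      · simp only [hU, hV, Matrix.of_apply, ← map_mul, ← map_sum]
        congr 2
        funext t
        have : (if s = r then k else 0) = (if s = r then 1 else 0) * k := by split_ifs <;> simp
        rw [Finset.sum_apply, this, ← fourier_orthogonality, Finset.sum_mul, Finset.mul_sum]
        refine Finset.sum_congr rfl fun i _ => ?_
        simp only [Pi.mul_apply]
        have := gauge_ne_zero (L := L) x α i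
        field_simp
    · simp only [hU, hV, Matrix.of_apply, ← map_mul, ← map_sum]
      congr 2
      funext t
      rw [Finset.sum_apply, laxFourier, Finset.mul_sum]
      refine Finset.sum_congr rfl fun i _ => ?_
      rw [Finset.sum_apply, Finset.mul_sum]
      refine Finset.sum_congr rfl fun j _ => ?_
      simp only [Pi.mul_apply, laxGauged]
      ring
  rw [hentry]
  have hrn := Nat.mod_lt r.val hn
  have h3 : toGerm (fun t => t ^ (s.val % n) * (t⁻¹) ^ (r.val % n) * laxFourier L c x α s r t)
      = toGerm (fun t => t ^ (s.val % n) * (t⁻¹) ^ (r.val % n + 1)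
            * (if s = r + 1 then -mu L m c r.val (L.lattice.mkQ x) else 0))
          + toGerm h * (if r.val % n < s.val % n then (coordGerm : PGerm) ^ n else 1) := by
    rw [toGerm_eq_iff.mpr hhe]
    have : (if r.val % n < s.val % n then (coordGerm : PGerm) ^ n else 1)
        = toGerm fun t => if r.val % n < s.val % n then t ^ n else 1 := by
      split_ifs
      · rfl
      · rfl
    rw [this]
    rfl
  have h4 : (if s = r then C (toGerm fun _ => k) else (0 : PGerm[X]))
      * (if r.val % n < s.val % n then C ((coordGerm : PGerm) ^ n) else 1)
      = C (toGerm fun t => t ^ (s.val % n) * (t⁻¹) ^ (r.val % n) * if s = r then k else 0) := by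
    split_ifs with h1 h2 h2
    · rw [h1] at h2; exact absurd h2 (lt_irrefl _)
    · rw [mul_one]
      congr 1
      rw [toGerm_eq_iff, h1]
      filter_upwards [self_mem_nhdsWithin] with t ht
      have ht' : t ≠ 0 := ht
      simp [ht']
    · rw [zero_mul, ← C_0, ← map_zero toGerm]
      simp only [mul_zero]
      rfl
    · rw [zero_mul, ← C_0, ← map_zero toGerm]
      simp only [mul_zero]
      rfl
  rw [h3, sub_mul, h4]
  by_cases hsr : s = r + 1
  · have hs : s.val % n = (r.val % n + 1) % n := by
      have : s.val % m % n = (r.val + 1) % m % n := by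
        rw [hsr, ZMod.val_add, Nat.mod_mod]
        congr 1
        exact (Nat.ModEq.add_left r.val (by
          rw [← Nat.cast_one, ZMod.val_natCast]; exact Nat.mod_modEq 1 m))
      rw [Nat.mod_mod_of_dvd _ hnm, Nat.mod_mod_of_dvd _ hnm] at this
      rw [this, Nat.mod_add_mod]
    have h5 : toGerm (fun t => t ^ (s.val % n) * (t⁻¹) ^ (r.val % n + 1))
        = if r.val % n + 1 = n then ((coordGerm⁻¹ : PGermˣ) : PGerm) ^ n else 1 := by
      split_ifs with h6
      · rw [hs, h6, Nat.mod_self]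
        simp only [pow_zero, one_mul]
        rfl
      · rw [hs, Nat.mod_eq_of_lt (by omega), ← map_one toGerm, toGerm_eq_iff]
        filter_upwards [self_mem_nhdsWithin] with t ht
        have ht' : t ≠ 0 := ht
        rw [← mul_pow, mul_inv_cancel₀ ht', one_pow]
        rfl
    have h6 : toGerm (fun t => t ^ (s.val % n) * (t⁻¹) ^ (r.val % n))
        = toGerm (fun t => t ^ (s.val % n) * (t⁻¹) ^ (r.val % n + 1)) * (coordGerm : PGerm) := by
      have : (coordGerm : PGerm) = toGerm fun t => t := rfl
      rw [this, ← map_mul, toGerm_eq_iff]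
      filter_upwards [self_mem_nhdsWithin] with t ht
      have ht' : t ≠ 0 := ht
      simp only [Pi.mul_apply, pow_succ]
      field_simp
    have h7 : toGerm (fun t => t ^ (s.val % n) * (t⁻¹) ^ (r.val % n + 1)
        * -mu L m c r.val (L.lattice.mkQ x))
        = -(toGerm (fun t => t ^ (s.val % n) * (t⁻¹) ^ (r.val % n + 1))
          * (constGerms μ (r.val % n) : PGerm)) := by
      have : (constGerms μ (r.val % n) : PGerm)
          = toGerm fun _ => mu L m c r.val (L.lattice.mkQ x) := by
        simp only [constGerms, hμ, mu_mod hc hst]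
      rw [this, ← map_mul, ← map_neg]
      congr 1
      funext t
      simp
    simp only [if_pos hsr, mul_one]
    rw [if_pos hs, h7, h6, h5, one_mul]
    simp only [sphP, C_add, C_mul, C_neg, apply_ite (C : PGerm → PGerm[X]), C_1, ← C_pow]
    ring
  · simp only [if_neg hsr, mul_zero, zero_mul, ite_self, add_zero]
    have h8 : toGerm (fun _ => (0 : ℂ)) = 0 := map_zero toGerm
    rw [h8]
    simp only [C_0, C_mul, zero_mul, zero_add, zero_sub,
      apply_ite (C : PGerm → PGerm[X]), C_1]
    ring

end LocalLaxDet

/-! ### Sufficient conditions for products and hamiltonians to be spherical. -/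

section HamSpherical

open Polynomial

lemma exists_prod_add_mul {R ι : Type*} [CommRing R] (A : Subring R) (s : Finset ι) {x z : ι → R}
    {T : R} (hx : ∀ i, x i ∈ A) (hz : ∀ i, z i ∈ A) (hT : T ∈ A) :
    ∃ w ∈ A, ∏ i ∈ s, (x i + T * z i) = ∏ i ∈ s, x i + T * w := by
  classical
  induction s using Finset.induction_on with
  | empty => exact ⟨0, zero_mem _, by simp⟩
  | insert i s hi ih =>
    obtain ⟨w, hw, h⟩ := ih
    refine ⟨x i * w + z i * (∏ i ∈ s, x i + T * w), ?_, ?_⟩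
    · exact add_mem (mul_mem (hx i) hw)
        (mul_mem (hz i) (add_mem (prod_mem fun i _ => hx i) (mul_mem hT hw)))
    · rw [Finset.prod_insert hi, Finset.prod_insert hi, h]
      ring

variable {K : Type*} [CommRing K] {O : Subring K} (t : Kˣ) (n : ℕ) (μ : ℕ → O)

lemma C_mul_X_sub_C {f ν h : K} (hf : t * f = ν + t ^ n * h) :
    C (t : K) * (X - C f) = (sphP t - C ν) + C (t : K) ^ n * -C h := by
  rw [mul_sub, ← C_mul, hf, sphP, C_add, C_mul, C_pow]
  ring

/-- Cut the r factors into blocks of n. As μ is n-periodic, tⁿ times a block is ∏ (tp - μᵢ) modulo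
tⁿ times the algebra, so each block is the local hamiltonian plus a spherical element. Each of the r
mod n remaining factors needs just one t. -/
lemma prod_X_sub_C_mem_spherical (ht : (t : K) ∈ O) {f h : ℕ → K} (hh : ∀ j, h j ∈ O)
    (hμ : ∀ j, μ (j % n) = μ j) (hf : ∀ j, t * f j = μ j + t ^ n * h j) (r : ℕ) :
    C (t : K) ^ (r % n) * ∏ j ∈ Finset.range r, (X - C (f j)) ∈ spherical O t n μ := by
  have hT : C (t : K) ∈ spherical O t n μ := C_mem_spherical t n μ ht
  have hx : ∀ j, sphP t - C (μ j : K) ∈ spherical O t n μ := fun j =>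
    sub_mem (sphP_mem t n μ) (C_mem_spherical t n μ (μ j).2)
  have hz : ∀ j, -C (h j) ∈ spherical O t n μ := fun j => neg_mem (C_mem_spherical t n μ (hh j))
  have hblock : ∀ q, ∏ j ∈ Finset.range n, (X - C (f (n * q + j))) ∈ spherical O t n μ := by
    intro q
    obtain ⟨w, hw, he⟩ := exists_prod_add_mul (spherical O t n μ).toSubring (Finset.range n)
      (x := fun j => sphP t - C (μ (n * q + j) : K)) (z := fun j => -C (h (n * q + j)))
      (T := C (t : K) ^ n) (fun j => hx _) (fun j => hz _) (pow_mem hT n)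
    have hunit : C ((t⁻¹ : Kˣ) : K) ^ n * C (t : K) ^ n = 1 := by
      rw [← mul_pow, ← C_mul, Units.inv_mul, C_1, one_pow]
    have h1 : ∏ j ∈ Finset.range n, (X - C (f (n * q + j))) = sphH O t n μ + w := by
      have h2 : C (t : K) ^ n * ∏ j ∈ Finset.range n, (X - C (f (n * q + j)))
          = ∏ j ∈ Finset.range n, (sphP t - C (μ j : K)) + C (t : K) ^ n * w := by
        conv_lhs => rw [← Finset.card_range n, ← Finset.prod_const, Finset.card_range,
          ← Finset.prod_mul_distrib]
        rw [Finset.prod_congr rfl fun j _ => C_mul_X_sub_C t n (hf (n * q + j)), he]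
        congr 1
        refine Finset.prod_congr rfl fun j hj => ?_
        rw [← hμ (n * q + j), Nat.mul_add_mod, Nat.mod_eq_of_lt (Finset.mem_range.mp hj)]
      rw [sphH]
      linear_combination C ((t⁻¹ : Kˣ) : K) ^ n * h2
        + (w - ∏ j ∈ Finset.range n, (X - C (f (n * q + j)))) * hunit
    rw [h1]
    exact add_mem (sphH_mem t n μ) hw
  have hfull : ∀ q, ∏ j ∈ Finset.range (n * q), (X - C (f j)) ∈ spherical O t n μ := by
    intro q
    induction q with
    | zero => simp
    | succ q ih => rw [Nat.mul_succ, Finset.prod_range_add]; exact mul_mem ih (hblock q)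
  have hrest : C (t : K) ^ (r % n) * ∏ j ∈ Finset.range (r % n), (X - C (f (n * (r / n) + j)))
      ∈ spherical O t n μ := by
    have hpow : C (t : K) ^ (r % n) = ∏ _j ∈ Finset.range (r % n), C (t : K) := by simp
    rw [hpow, ← Finset.prod_mul_distrib]
    refine prod_mem fun j _ => ?_
    rw [C_mul_X_sub_C t n (hf _)]
    exact add_mem (hx _) (mul_mem (pow_mem hT n) (hz _))
  have h := mul_mem (hfull (r / n)) hrest
  rwa [mul_left_comm, ← Finset.prod_range_add, Nat.div_add_mod] at h

/-- After multiplication by tⁿ, and modulo tⁿ times the algebra, only the polar parts ν and e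
survive. The relation `hrel` assembles them into ∏ (tp - μⱼ), so the expression is the local
hamiltonian plus a spherical element. -/
lemma ham_mem_spherical_of_relation (ht : (t : K) ∈ O) {f h ν D e d : ℕ → K}
    (hh : ∀ j, h j ∈ O) (hν : ∀ j, ν j ∈ O) (hf : ∀ j, t * f j = ν j + t ^ n * h j)
    (he : ∀ i, e i ∈ O) (hd : ∀ i, d i ∈ O)
    (hD : ∀ i ∈ Finset.Icc 2 n, t ^ i * D i = e i + t ^ n * d i)
    (hrel : ∏ j ∈ Finset.range n, (sphP t - C (μ j : K))
      = ∏ j ∈ Finset.range n, (sphP t - C (ν j))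
        + ∑ i ∈ Finset.Icc 2 n, C (e i) * ∏ j ∈ Finset.range (n - i), (sphP t - C (ν j))) :
    ∏ j ∈ Finset.range n, (X - C (f j))
      + ∑ i ∈ Finset.Icc 2 n, C (D i) * ∏ j ∈ Finset.range (n - i), (X - C (f j))
      ∈ spherical O t n μ := by
  have hT : C (t : K) ∈ spherical O t n μ := C_mem_spherical t n μ ht
  have hx : ∀ j, sphP t - C (ν j) ∈ spherical O t n μ := fun j =>
    sub_mem (sphP_mem t n μ) (C_mem_spherical t n μ (hν j))
  have hz : ∀ j, -C (h j) ∈ spherical O t n μ := fun j => neg_mem (C_mem_spherical t n μ (hh j))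
  have hunit : C ((t⁻¹ : Kˣ) : K) ^ n * C (t : K) ^ n = 1 := by
    rw [← mul_pow, ← C_mul, Units.inv_mul, C_1, one_pow]
  choose w hw hwe using fun r => exists_prod_add_mul (spherical O t n μ).toSubring (Finset.range r)
      (T := C (t : K) ^ n) hx hz (pow_mem hT n)
  have hy : ∀ r, C (t : K) ^ r * ∏ j ∈ Finset.range r, (X - C (f j))
      = ∏ j ∈ Finset.range r, (sphP t - C (ν j)) + C (t : K) ^ n * w r := by
    intro r
    rw [← hwe, ← Finset.prod_congr rfl fun j _ => C_mul_X_sub_C t n (hf j),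
      Finset.prod_mul_distrib, Finset.prod_const, Finset.card_range]
  have hterm : ∀ i ∈ Finset.Icc 2 n,
      C (t : K) ^ n * (C (D i) * ∏ j ∈ Finset.range (n - i), (X - C (f j)))
      = C (e i) * ∏ j ∈ Finset.range (n - i), (sphP t - C (ν j)) + C (t : K) ^ n *
        (C (e i) * w (n - i) + C (d i) *
          (∏ j ∈ Finset.range (n - i), (sphP t - C (ν j)) + C (t : K) ^ n * w (n - i))) := by
    intro i hi
    have h1 : C (t : K) ^ n = C (t : K) ^ i * C (t : K) ^ (n - i) := by
      rw [← pow_add, Nat.add_sub_cancel' (Finset.mem_Icc.mp hi).2]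
    have h2 : C (t : K) ^ i * C (D i) = C (e i) + C (t : K) ^ n * C (d i) := by
      rw [← C_pow, ← C_mul, hD i hi, C_add, C_mul, C_pow]
    calc C (t : K) ^ n * (C (D i) * ∏ j ∈ Finset.range (n - i), (X - C (f j)))
        = (C (t : K) ^ i * C (D i))
          * (C (t : K) ^ (n - i) * ∏ j ∈ Finset.range (n - i), (X - C (f j))) := by
          rw [h1]; ring
      _ = _ := by rw [h2, hy]; ring
  set W := w n + ∑ i ∈ Finset.Icc 2 n, (C (e i) * w (n - i) + C (d i) *
          (∏ j ∈ Finset.range (n - i), (sphP t - C (ν j)) + C (t : K) ^ n * w (n - i))) with hW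
  have hWmem : W ∈ spherical O t n μ := by
    refine add_mem (hw n) (sum_mem fun i _ => add_mem
      (mul_mem (C_mem_spherical t n μ (he i)) (hw _))
      (mul_mem (C_mem_spherical t n μ (hd i)) (add_mem (prod_mem fun j _ => hx j)
        (mul_mem (pow_mem hT n) (hw _)))))
  have hmain : C (t : K) ^ n * (∏ j ∈ Finset.range n, (X - C (f j))
      + ∑ i ∈ Finset.Icc 2 n, C (D i) * ∏ j ∈ Finset.range (n - i), (X - C (f j)))
      = ∏ j ∈ Finset.range n, (sphP t - C (μ j : K)) + C (t : K) ^ n * W := by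
    rw [mul_add, hy, Finset.mul_sum, Finset.sum_congr rfl hterm, Finset.sum_add_distrib, hrel, hW,
      mul_add, ← Finset.mul_sum]
    ring
  have hfin : ∏ j ∈ Finset.range n, (X - C (f j))
      + ∑ i ∈ Finset.Icc 2 n, C (D i) * ∏ j ∈ Finset.range (n - i), (X - C (f j))
      = sphH O t n μ + W := by
    rw [sphH]
    linear_combination C ((t⁻¹ : Kˣ) : K) ^ n * hmain
      + (W - (∏ j ∈ Finset.range n, (X - C (f j))
      + ∑ i ∈ Finset.Icc 2 n, C (D i) * ∏ j ∈ Finset.range (n - i), (X - C (f j)))) * hunit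
  rw [hfin]
  exact add_mem (sphH_mem t n μ) hWmem

end HamSpherical

/-! ### The functions f_j: symmetry, residues, local expansion. -/

section SpecialPoints

variable {L : PeriodPair} {m : ℕ} [NeZero m]

lemma finite_special (hL : ∀ γ ∈ L.lattice, om m 1 * γ ∈ L.lattice) :
    {y : Curve L | y ≠ 0 ∧ ∃ l : ZMod m, l ≠ 0 ∧ y ∈ fixedPoints L m l}.Finite := by
  refine (Set.finite_iUnion fun l : {l : ZMod m // l ≠ 0} => finite_fixedPoints hL l.2).subset ?_
  rintro y ⟨-, l, hl, hy⟩
  exact Set.mem_iUnion.mpr ⟨⟨l, hl⟩, hy⟩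

/-- The nonzero points of the curve with nontrivial stabilizer. -/
def special (hL : ∀ γ ∈ L.lattice, om m 1 * γ ∈ L.lattice) : Finset (Curve L) :=
  (finite_special hL).toFinset

lemma mem_special (hL : ∀ γ ∈ L.lattice, om m 1 * γ ∈ L.lattice) {y : Curve L} :
    y ∈ special hL ↔ y ≠ 0 ∧ ∃ l : ZMod m, l ≠ 0 ∧ y ∈ fixedPoints L m l := by
  simp [special]

lemma exists_of_mu_ne_zero {c : Family L m} (hc : IsCoupling L m c) {j : ℕ} {y : Curve L}
    (h : mu L m c j y ≠ 0) : ∃ l : ZMod m, l ≠ 0 ∧ y ∈ fixedPoints L m l := by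
  obtain ⟨l, -, hl⟩ := Finset.exists_ne_zero_of_sum_ne_zero h
  have hl' := right_ne_zero_of_mul hl
  refine ⟨l, ?_, hc.mem_of_ne_zero hl'⟩
  rintro rfl
  exact hl' (hc.index_zero y)

lemma finsum_mu_mul_eq_sum (hL : ∀ γ ∈ L.lattice, om m 1 * γ ∈ L.lattice) {c : Family L m}
    (hc : IsCoupling L m c) (j : ℕ) (g : Curve L → ℂ) :
    ∑ᶠ x ∈ ({0}ᶜ : Set (Curve L)), mu L m c j x * g x = ∑ y ∈ special hL, mu L m c j y * g y := by
  refine finsum_mem_eq_sum_of_inter_support_eq _ (Set.ext fun y => ?_)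
  simp only [Set.mem_inter_iff, Set.mem_compl_iff, Set.mem_singleton_iff, Function.mem_support,
    Finset.mem_coe, mem_special]
  refine ⟨fun h => ⟨⟨h.1, exists_of_mu_ne_zero hc (left_ne_zero_of_mul h.2)⟩, h.2⟩,
    fun h => ⟨h.1.1, h.2⟩⟩

lemma muSum_eq_sum (hL : ∀ γ ∈ L.lattice, om m 1 * γ ∈ L.lattice) {c : Family L m}
    (hc : IsCoupling L m c) (j : ℕ) : muSum L m c j = ∑ y ∈ special hL, mu L m c j y := by
  have := finsum_mu_mul_eq_sum hL hc j fun _ => 1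
  simp only [mul_one] at this
  exact this

lemma fSum_eq_sum (hL : ∀ γ ∈ L.lattice, om m 1 * γ ∈ L.lattice) {c : Family L m}
    (hc : IsCoupling L m c) (j : ℕ) (q : ℂ) : fSum L m c j q = ∑ y ∈ special hL,
      mu L m c j y * (wZeta L (q - rep L y) - wZeta L q + wZeta L (rep L y)) :=
  finsum_mu_mul_eq_sum hL hc j _

lemma mu_curveMul (hL : ∀ γ ∈ L.lattice, om m 1 * γ ∈ L.lattice) {c : Family L m}
    (hc : IsCoupling L m c) (j : ℕ) (r : ZMod m) (y : Curve L) :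
    mu L m c j (curveMul hL r y) = mu L m c j y := by
  simp only [mu, hc.curveMul hL]

lemma rep_notMem {y : Curve L} (hy : y ≠ 0) : rep L y ∉ L.lattice := by
  intro h
  refine hy ?_
  rw [← mkQ_rep y, ← map_zero L.lattice.mkQ, mkQ_eq_iff, sub_zero]
  exact h

lemma mkQ_eq_zero_iff {z : ℂ} : L.lattice.mkQ z = 0 ↔ z ∈ L.lattice := by
  rw [← map_zero L.lattice.mkQ, mkQ_eq_iff, sub_zero]

lemma curveMul_mem_special (hL : ∀ γ ∈ L.lattice, om m 1 * γ ∈ L.lattice) (r : ZMod m)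
    (y : Curve L) : curveMul hL r y ∈ special hL ↔ y ∈ special hL := by
  rw [mem_special, mem_special, curveMul_apply]
  refine and_congr ?_ (exists_congr fun l => and_congr_right fun _ => ?_)
  · rw [not_iff_not, mkQ_eq_zero_iff, om_mul_mem_iff hL, ← mkQ_eq_zero_iff, mkQ_rep]
  · rw [mem_fixedPoints, mem_fixedPoints, Om_mul_rep_mkQ hL, mul_left_comm, om_mul_mem_iff hL]

lemma IsNotFixed.notMem (hL : ∀ γ ∈ L.lattice, om m 1 * γ ∈ L.lattice) (hm : 1 < m) {q : ℂ}
    (hq : IsNotFixed L m q) : q ∉ L.lattice := by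
  have : Fact (1 < m) := ⟨hm⟩
  exact fun h => hq 1 one_ne_zero (Om_mul_mem hL 1 h)

lemma IsNotFixed.sub_rep_notMem (hL : ∀ γ ∈ L.lattice, om m 1 * γ ∈ L.lattice) {q : ℂ}
    (hq : IsNotFixed L m q) {y : Curve L} (hy : y ∈ special hL) : q - rep L y ∉ L.lattice := by
  obtain ⟨-, l, hl, hyl⟩ := (mem_special hL).mp hy
  intro h
  have h1 := Om_mul_mem hL l h
  rw [mul_sub, mem_lattice_sub_iff L hyl] at h1
  exact hq l hl h1

lemma eventually_isNotFixed (x : ℂ) : ∀ᶠ z in 𝓝[≠] x, IsNotFixed L m z := by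
  unfold IsNotFixed
  rw [eventually_all]
  intro l
  by_cases hl : l = 0
  · simp [hl]
  · filter_upwards [eventually_mul_notMem (L := L) (Om_ne_zero hl) x] with z hz _ using hz

/-- The quasi-periods of ζ(q - x) and ζ(q) cancel, which is the role of the term -ζ(q). -/
lemma fSum_add (hL : ∀ γ ∈ L.lattice, om m 1 * γ ∈ L.lattice) (hm : 1 < m) {c : Family L m}
    (hc : IsCoupling L m c) (j : ℕ) {q γ : ℂ} (hq : IsNotFixed L m q) (hγ : γ ∈ L.lattice) :
    fSum L m c j (q + γ) = fSum L m c j q := by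
  rw [fSum_eq_sum hL hc, fSum_eq_sum hL hc]
  refine Finset.sum_congr rfl fun y hy => ?_
  rw [add_sub_right_comm, wZeta_add L hγ (hq.sub_rep_notMem hL hy),
    wZeta_add L hγ (hq.notMem hL hm)]
  ring

/-- Rotation permutes the special points and ζ is homogeneous. Changing representatives adds
opposite quasi-periods to ζ(q - x) and ζ(x), which is the role of the term ζ(x). -/
lemma fSum_om_mul (hL : ∀ γ ∈ L.lattice, om m 1 * γ ∈ L.lattice) {c : Family L m}
    (hc : IsCoupling L m c) (j : ℕ) (r : ZMod m) {q : ℂ} (hq : IsNotFixed L m q) :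
    fSum L m c j (om m r * q) = om m (-r) * fSum L m c j q := by
  rw [fSum_eq_sum hL hc, fSum_eq_sum hL hc, Finset.mul_sum]
  symm
  refine Finset.sum_equiv (curveMul hL r) (fun y => (curveMul_mem_special hL r y).symm)
    fun y hy => ?_
  obtain ⟨γ, hγ, h⟩ := exists_rep_mkQ (L := L) (om m r * rep L y)
  have hu := om_ne_zero r
  have hul := om_mul_mem_iff hL r
  have h1 := hq.sub_rep_notMem hL hy
  have h2 := rep_notMem ((mem_special hL).mp hy).1
  have e : om m r * q - (om m r * rep L y + γ) = om m r * (q - rep L y) + -γ := by ring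
  rw [mu_curveMul hL hc, curveMul_apply, h, e, wZeta_add L (neg_mem hγ) (mt (hul _).mp h1),
    wZeta_add L hγ (mt (hul _).mp h2), wZeta_mul L hu hul, wZeta_mul L hu hul, wZeta_mul L hu hul,
    eta_neg, om_neg]
  ring

lemma hasResidue_wZeta {z : ℂ} (hz : z ∈ L.lattice) : HasResidue (wZeta L) z 1 := by
  have h0 : HasResidue (wZeta L) 0 1 := by
    have h1 : HasResidue (fun z : ℂ => 1 / z) 0 1 :=
      ⟨fun _ => 1, analyticAt_const, rfl, .of_forall fun z => by simp⟩
    have h2 := h1.add (AnalyticAt.hasResidue (analyticAt_zetaSum L (zero_mem_punctured L)))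
    rw [add_zero] at h2
    exact h2.congr (.of_forall fun z => (wZeta_eq L z).symm)
  have h1 := HasResidue.comp_affine (f := wZeta L) (a := 1) (b := -z) (z₀ := z) (r := 1)
    one_ne_zero (by rwa [one_mul, add_neg_cancel])
  have h2 := h1.add (AnalyticAt.hasResidue (analyticAt_const (v := eta L z)))
  rw [inv_one, one_mul, add_zero] at h2
  refine h2.congr ?_
  have h3 := eventually_mul_notMem (L := L) one_ne_zero z
  filter_upwards [h3] with w hw
  rw [one_mul] at hw ⊢
  rw [← wZeta_add L hz (by rw [add_mem_lattice_iff L (neg_mem hz)]; exact hw)]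
  simp

lemma analyticAt_wZeta {z : ℂ} (hz : z ∉ L.lattice) : AnalyticAt ℂ (wZeta L) z := by
  have h0 : z ≠ 0 := by rintro rfl; exact hz (zero_mem _)
  have h1 : AnalyticAt ℂ (fun z : ℂ => 1 / z + zetaSum L z) z :=
    (analyticAt_const.div analyticAt_id h0).add
      (analyticAt_zetaSum L (mem_punctured_of_notMem L hz))
  exact h1

lemma hasResidue_wZeta_ite [DecidablePred (· ∈ L.lattice)] (z : ℂ) :
    HasResidue (wZeta L) z (if z ∈ L.lattice then 1 else 0) := by
  split_ifs with hz
  · exact hasResidue_wZeta hz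
  · exact AnalyticAt.hasResidue (analyticAt_wZeta hz)

open Classical in
variable (L) in
/-- The residue of `f_j` at `x`. -/
def fRes (c : Family L m) (x : ℂ) (j : ℕ) : ℂ :=
  if x ∈ L.lattice then -muSum L m c j else mu L m c j (L.lattice.mkQ x)

lemma hasResidue_fSum (hL : ∀ γ ∈ L.lattice, om m 1 * γ ∈ L.lattice) {c : Family L m}
    (hc : IsCoupling L m c) (j : ℕ) (x : ℂ) :
    HasResidue (fSum L m c j) x (fRes L c x j) := by
  classical
  have h1 : ∀ y ∈ special hL, HasResidue (fun q =>
      mu L m c j y * ((wZeta L (q - rep L y) + -1 * wZeta L q) + wZeta L (rep L y))) x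
      (mu L m c j y * ((if x - rep L y ∈ L.lattice then 1 else 0)
        + -1 * (if x ∈ L.lattice then 1 else 0) + 0)) := by
    intro y _
    refine HasResidue.const_mul (HasResidue.add (HasResidue.add ?_
      ((hasResidue_wZeta_ite x).const_mul _)) (AnalyticAt.hasResidue analyticAt_const)) _
    have h2 := HasResidue.comp_affine (f := wZeta L) (a := 1) (b := -rep L y) (z₀ := x)
      (one_ne_zero) (hasResidue_wZeta_ite _)
    simpa only [inv_one, one_mul, ← sub_eq_add_neg] using h2
  have h2 := HasResidue.sum _ h1
  have h3 : ∑ y ∈ special hL, (mu L m c j y * ((if x - rep L y ∈ L.lattice then 1 else 0)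
        + -1 * (if x ∈ L.lattice then 1 else 0) + 0)) = fRes L c x j := by
    have h4 : ∀ y, x - rep L y ∈ L.lattice ↔ L.lattice.mkQ x = y := fun y => by
      rw [← mkQ_eq_iff, mkQ_rep]
    simp only [h4, add_zero, mul_add, Finset.sum_add_distrib, mul_ite, mul_one, mul_zero,
      Finset.sum_ite_eq, fRes]
    by_cases hx : x ∈ L.lattice
    · rw [if_neg, muSum_eq_sum hL hc]
      · simp [hx]
      · rw [mkQ_eq_zero_iff.mpr hx]
        exact fun h => ((mem_special hL).mp h).1 rfl
    · simp only [hx, if_false, Finset.sum_const_zero, add_zero]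
      split_ifs with h
      · rfl
      · by_contra hne
        exact h ((mem_special hL).mpr ⟨mt mkQ_eq_zero_iff.mp hx,
          exists_of_mu_ne_zero hc (Ne.symm hne)⟩)
  rw [h3] at h2
  refine h2.congr (.of_forall fun q => ?_)
  rw [fSum_eq_sum hL hc]
  refine Finset.sum_congr rfl fun y _ => ?_
  ring

lemma analyticAt_fSum (hL : ∀ γ ∈ L.lattice, om m 1 * γ ∈ L.lattice) (hm : 1 < m) {c : Family L m}
    (hc : IsCoupling L m c) (j : ℕ) {q : ℂ} (hq : IsNotFixed L m q) :
    AnalyticAt ℂ (fSum L m c j) q := by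
  have : fSum L m c j = fun q => ∑ y ∈ special hL,
      mu L m c j y * (wZeta L (q - rep L y) - wZeta L q + wZeta L (rep L y)) :=
    funext (fSum_eq_sum hL hc j)
  rw [this]
  refine Finset.analyticAt_fun_sum _ fun y hy => analyticAt_const.mul
    (AnalyticAt.add (AnalyticAt.sub ?_ (analyticAt_wZeta (hq.notMem hL hm))) analyticAt_const)
  exact (analyticAt_wZeta (hq.sub_rep_notMem hL hy)).fun_comp (f := fun q => q - rep L y)
    (by fun_prop)

/-- The expansion of `f_j` near `x`. -/
lemma fSum_expansion (hL : ∀ γ ∈ L.lattice, om m 1 * γ ∈ L.lattice) (hm : 1 < m) {c : Family L m}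
    (hc : IsCoupling L m c) (j : ℕ) {x : ℂ} {n : ℕ} {g : ZMod m} (hn : 0 < n)
    (hg : Om m g * x ∈ L.lattice) (hgn : IsPrimitiveRoot (om m (-g)) n) :
    ∃ h : ℂ → ℂ, AnalyticAt ℂ h 0 ∧
      ∀ᶠ t in 𝓝[≠] (0 : ℂ), t * fSum L m c j (x + t) = fRes L c x j + t ^ n * h t := by
  obtain ⟨f, hf, hf0, hfe⟩ := hasResidue_fSum hL hc j x
  have hu0 : om m (-g) ≠ 0 := om_ne_zero _
  have hx : Tendsto (fun t => x + t) (𝓝[≠] (0 : ℂ)) (𝓝[≠] x) := by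
    simpa [add_comm] using tendsto_add_punctured 0 x
  have hm' : Tendsto (fun t => om m (-g) * t) (𝓝[≠] (0 : ℂ)) (𝓝[≠] (0 : ℂ)) := by
    simpa using tendsto_affine_punctured (b := 0) (z₀ := 0) hu0
  have h1 : ∀ᶠ t in 𝓝[≠] (0 : ℂ), t * fSum L m c j (x + t) = f (x + t) := by
    filter_upwards [hx.eventually hfe, self_mem_nhdsWithin] with t ht ht0
    rw [ht, add_sub_cancel_left, mul_inv_cancel_left₀ ht0]
  have hγ := (Om_neg_mul_mem_iff hL g x).mpr hg
  -- The function t f_j(x + t) is invariant under t ↦ ω^(-g) t, so after its value at 0 the next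
  -- possible order is n.
  obtain ⟨h, hh, hhe⟩ := exists_eq_pow_mul_of_equivariant
    (f := fun t => f (x + t) - fRes L c x j) (n := n) (s := 0) (e := n) (u := om m (-g))
    ((AnalyticAt.fun_comp (f := fun t => x + t) (by simpa using hf) (by fun_prop)).sub
      analyticAt_const) hgn hn (by
      filter_upwards [h1, hm'.eventually h1, hx.eventually (eventually_isNotFixed (L := L) (m := m) x)]
        with t h2 h3 h4
      have e : x + om m (-g) * t = om m (-g) * (x + t) + Om m (-g) * x := by rw [Om]; ring
      have h5 : IsNotFixed L m (om m (-g) * (x + t)) := fun l hl => by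
        rw [mul_left_comm, om_mul_mem_iff hL]; exact h4 l hl
      rw [← h3, ← h2, e, fSum_add hL hm hc j h5 hγ, fSum_om_mul hL hc j _ h4, neg_neg]
      have := om_mul_neg g
      linear_combination t * fSum L m c j (x + t) * this) (by
      intro k hk hk0
      have hk0' := hk0 (by simp [hf0])
      exact Nat.le_of_dvd (Nat.pos_of_ne_zero hk0') ((Nat.modEq_zero_iff_dvd).mp hk))
  refine ⟨h, hh, ?_⟩
  filter_upwards [h1, hhe] with t h2 h3
  rw [h2, ← h3]
  ring

end SpecialPoints

/-! ### Local expansions of the derivatives of ℘. -/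

section WeierstrassDerivatives

variable (L : PeriodPair)

lemma analyticAt_iteratedDeriv_weierstrassP (k : ℕ) {z : ℂ} (hz : z ∉ L.lattice) :
    AnalyticAt ℂ (iteratedDeriv k L.weierstrassP) z := by
  rw [iteratedDeriv_eq_iterate]
  exact L.analyticOnNhd_weierstrassP.iterated_deriv k z hz

lemma iteratedDeriv_weierstrassP_add (k : ℕ) {γ : ℂ} (hγ : γ ∈ L.lattice) (z : ℂ) :
    iteratedDeriv k L.weierstrassP (z + γ) = iteratedDeriv k L.weierstrassP z := by
  have h1 : (fun z => L.weierstrassP (z + γ)) = L.weierstrassP :=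
    funext fun z => L.weierstrassP_add_coe z ⟨γ, hγ⟩
  have h2 := congrFun (iteratedDeriv_comp_add_const k L.weierstrassP γ) z
  rw [h1] at h2
  exact h2.symm

variable {L} in
lemma iteratedDeriv_weierstrassP_mul {u : ℂ} (hu : u ≠ 0)
    (h : ∀ z, u * z ∈ L.lattice ↔ z ∈ L.lattice) (k : ℕ) (z : ℂ) :
    iteratedDeriv k L.weierstrassP (u * z) = u⁻¹ ^ (k + 2) * iteratedDeriv k L.weierstrassP z := by
  induction k generalizing z with
  | zero => simpa using weierstrassP_mul L hu h z
  | succ k ih =>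
    have h1 := deriv_comp_mul_left u (iteratedDeriv k L.weierstrassP) z
    rw [funext ih, deriv_const_mul_field, smul_eq_mul] at h1
    rw [iteratedDeriv_succ, pow_succ' _ (k + 2), mul_assoc, h1, inv_mul_cancel_left₀ hu]

/-- The principal part for k = i - 2 supplies the constants (-1)^i (i-1)! in the relation
determining a_i. -/
lemma iteratedDeriv_weierstrassP_eq (k : ℕ) {z : ℂ} (hz : z ∉ L.lattice) :
    iteratedDeriv k L.weierstrassP z = (-1) ^ k * ((k + 1).factorial : ℂ) * (z ^ (k + 2))⁻¹
      + iteratedDeriv k (L.weierstrassPExcept 0) z := by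
  have han : ∀ k, ∀ z ∉ L.lattice, AnalyticAt ℂ (iteratedDeriv k (L.weierstrassPExcept 0)) z := by
    intro k z hz
    rw [iteratedDeriv_eq_iterate]
    exact (L.analyticOnNhd_weierstrassPExcept 0).iterated_deriv k z fun h => hz h.1
  induction k generalizing z with
  | zero => simpa using weierstrassP_eq L z
  | succ k ih =>
    have h0 : z ≠ 0 := by rintro rfl; exact hz (zero_mem _)
    have h1 : iteratedDeriv k L.weierstrassP =ᶠ[𝓝 z] fun z =>
        (-1) ^ k * ((k + 1).factorial : ℂ) * (z ^ (k + 2))⁻¹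
          + iteratedDeriv k (L.weierstrassPExcept 0) z := by
      filter_upwards [(isOpen_compl_lattice L).mem_nhds hz] with w hw using ih hw
    have h2 : HasDerivAt (fun z : ℂ => (-1) ^ k * ((k + 1).factorial : ℂ) * (z ^ (k + 2))⁻¹
          + iteratedDeriv k (L.weierstrassPExcept 0) z)
        ((-1) ^ k * ((k + 1).factorial : ℂ) * (-((k + 2 : ℕ) * z ^ (k + 1)) / (z ^ (k + 2)) ^ 2)
          + deriv (iteratedDeriv k (L.weierstrassPExcept 0)) z) z := by
      refine HasDerivAt.add (HasDerivAt.const_mul _ ?_)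
        (han k z hz).differentiableAt.hasDerivAt
      exact (hasDerivAt_pow (k + 2) z).inv (pow_ne_zero _ h0)
    rw [iteratedDeriv_succ, iteratedDeriv_succ, h1.deriv_eq, h2.deriv,
      Nat.factorial_succ (k + 1)]
    congr 1
    push_cast
    field_simp
    ring

variable {m : ℕ} [NeZero m] {L}

/-- The expansion of the derivatives of `℘` at `0`. -/
lemma iteratedDeriv_weierstrassP_expansion_zero (hL : ∀ γ ∈ L.lattice, om m 1 * γ ∈ L.lattice)
    {i : ℕ} (hi : i ∈ Finset.Icc 2 m) :
    ∃ d : ℂ → ℂ, AnalyticAt ℂ d 0 ∧ ∀ᶠ t in 𝓝[≠] (0 : ℂ),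
      t ^ i * iteratedDeriv (i - 2) L.weierstrassP t
        = (-1) ^ i * ((i - 1).factorial : ℂ) + t ^ m * d t := by
  obtain ⟨h2i, him⟩ := Finset.mem_Icc.mp hi
  obtain ⟨k, rfl⟩ := Nat.exists_eq_add_of_le' h2i
  rw [show k + 2 - 2 = k by omega, show k + 2 - 1 = k + 1 by omega]
  have hprim := isPrimitiveRoot_om m
  set u := om m 1 with hu
  have hu0 : u ≠ 0 := om_ne_zero _
  have hul := om_mul_mem_iff hL (1 : ZMod m)
  rw [← hu] at hul
  have hlat : ∀ᶠ z in 𝓝[≠] (0 : ℂ), z ∉ L.lattice := by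
    simpa using eventually_mul_notMem (L := L) one_ne_zero 0
  have han : AnalyticAt ℂ (iteratedDeriv k (L.weierstrassPExcept 0)) 0 := by
    rw [iteratedDeriv_eq_iterate]
    exact (L.analyticOnNhd_weierstrassPExcept 0).iterated_deriv k 0 (by simp)
  have hinv : u⁻¹ ^ (k + 2) = u ^ (m - (k + 2)) := by
    have h1 : u ^ (m - (k + 2)) * u ^ (k + 2) = 1 := by
      rw [← pow_add, Nat.sub_add_cancel him, hprim.pow_eq_one]
    rw [inv_pow]
    exact (eq_inv_of_mul_eq_one_left h1).symm
  -- The regular part inherits the equivariance u^(-(k+2)) = u^(m-(k+2)), so it is divisible by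
  -- t^(m-(k+2)); multiplied by t^(k+2), it becomes a multiple of t^m.
  obtain ⟨d, hd, hde⟩ := exists_eq_pow_mul_of_equivariant (s := m - (k + 2)) (e := m - (k + 2)) han
    hprim (NeZero.pos m) (by
      filter_upwards [hlat, self_mem_nhdsWithin] with z hz hz0
      have h1 := iteratedDeriv_weierstrassP_eq L k hz
      have h2 := iteratedDeriv_weierstrassP_eq L k (mt (hul z).mp hz)
      rw [iteratedDeriv_weierstrassP_mul hu0 hul, h1] at h2
      rw [← hinv]
      have h3 : (u * z) ^ (k + 2) = u ^ (k + 2) * z ^ (k + 2) := mul_pow _ _ _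
      rw [h3, mul_inv, ← inv_pow u] at h2
      linear_combination -h2) (by
      intro r hr _
      have h1 : r % m = (m - (k + 2)) % m := hr
      rw [Nat.mod_eq_of_lt (a := m - (k + 2)) (by omega)] at h1
      rw [← h1]
      exact Nat.mod_le _ _)
  refine ⟨d, hd, ?_⟩
  filter_upwards [hlat, hde, self_mem_nhdsWithin] with t h1 h2 h3
  have h3' : t ≠ 0 := h3
  rw [iteratedDeriv_weierstrassP_eq L k h1, h2]
  have h4 : t ^ m = t ^ (k + 2) * t ^ (m - (k + 2)) := by
    rw [← pow_add, Nat.add_sub_cancel' him]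
  have h5 : t ^ (k + 2) * (t ^ (k + 2))⁻¹ = 1 := mul_inv_cancel₀ (pow_ne_zero _ h3')
  rw [h4, pow_add (-1 : ℂ) k 2]
  linear_combination ((-1) ^ k * ((k + 1).factorial : ℂ)) * h5

/-- The expansion of the derivatives of `℘` away from the lattice. -/
lemma iteratedDeriv_weierstrassP_expansion (hL : ∀ γ ∈ L.lattice, om m 1 * γ ∈ L.lattice)
    {i : ℕ} (hi : i ∈ Finset.Icc 2 m) {x : ℂ} (hx : x ∉ L.lattice) {n : ℕ} {g : ZMod m} (hn : 0 < n)
    (hnm : n ∣ m) (hg : Om m g * x ∈ L.lattice) (hgn : IsPrimitiveRoot (om m (-g)) n) :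
    ∃ d : ℂ → ℂ, AnalyticAt ℂ d 0 ∧ ∀ᶠ t in 𝓝[≠] (0 : ℂ),
      iteratedDeriv (i - 2) L.weierstrassP (x + t) = t ^ ((m - i) % n) * d t := by
  obtain ⟨h2i, him⟩ := Finset.mem_Icc.mp hi
  obtain ⟨k, rfl⟩ := Nat.exists_eq_add_of_le' h2i
  rw [show k + 2 - 2 = k by omega]
  have hul := om_mul_mem_iff hL (-g)
  have hu0 : om m (-g) ≠ 0 := om_ne_zero _
  have hinv : (om m (-g))⁻¹ ^ (k + 2) = om m (-g) ^ (m - (k + 2)) := by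
    have h1 : om m (-g) ^ (m - (k + 2)) * om m (-g) ^ (k + 2) = 1 := by
      rw [← pow_add, Nat.sub_add_cancel him, (hgn.pow_eq_one_iff_dvd m).mpr hnm]
    rw [inv_pow]
    exact (eq_inv_of_mul_eq_one_left h1).symm
  have hγ := (Om_neg_mul_mem_iff hL g x).mpr hg
  refine exists_eq_pow_mul_of_equivariant (u := om m (-g)) (s := m - (k + 2)) (n := n)
    (f := fun t => iteratedDeriv k L.weierstrassP (x + t))
    (AnalyticAt.fun_comp (f := fun t => x + t)
      (by simpa using analyticAt_iteratedDeriv_weierstrassP L k hx) (by fun_prop)) hgn hn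
    (.of_forall fun t => ?_) fun r hr _ => ?_
  · have e : x + om m (-g) * t = om m (-g) * (x + t) + Om m (-g) * x := by rw [Om]; ring
    rw [e, iteratedDeriv_weierstrassP_add L k hγ, iteratedDeriv_weierstrassP_mul hu0 hul, hinv]
  · have h1 : r % n = (m - (k + 2)) % n := hr
    rw [← h1]
    exact Nat.mod_le _ _

end WeierstrassDerivatives

/-! ### The hamiltonian is locally spherical. -/

section HamPoly

open Polynomial

variable {L : PeriodPair} {m : ℕ} [NeZero m]

variable (L) in
/-- The hamiltonian, as a polynomial in `p` whose coefficients are functions of `q`. -/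
def hamPoly (c : Family L m) (a : ℕ → ℂ) : (ℂ → ℂ)[X] :=
  ∏ j ∈ Finset.range m, (X - C (fSum L m c j))
    + ∑ i ∈ Finset.Icc 2 m, C (fun q => a i * iteratedDeriv (i - 2) L.weierstrassP q)
      * ∏ j ∈ Finset.range (m - i), (X - C (fSum L m c j))

/-- The defining relation of the coefficients, as an identity of polynomials. -/
lemma IsHamCoeff.polynomial_relation {c : Family L m} {a : ℕ → ℂ} (ha : IsHamCoeff L m c a) :
    (∏ j ∈ Finset.range m, (X - C (mu L m c j 0)) : ℂ[X])
      = ∏ j ∈ Finset.range m, (X - C (-muSum L m c j))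
        + ∑ i ∈ Finset.Icc 2 m, C ((-1) ^ i * ((i - 1).factorial : ℂ) * a i)
            * ∏ j ∈ Finset.range (m - i), (X - C (-muSum L m c j)) := by
  refine Polynomial.funext fun p => ?_
  have h := ha.relation p 1 one_ne_zero
  simp only [div_one, one_pow] at h
  simpa [eval_prod, eval_finsetSum] using h

/-- The hamiltonian lies in the local spherical subalgebra at every point. -/
lemma hamPoly_mem (hL : ∀ γ ∈ L.lattice, om m 1 * γ ∈ L.lattice) (hm : 1 < m) {c : Family L m}
    (hc : IsCoupling L m c) {a : ℕ → ℂ} (ha : IsHamCoeff L m c a) (x : ℂ) {n : ℕ} {g : ZMod m}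
    (hn : 0 < n) (hnm : n ∣ m) (hg : Om m g * x ∈ L.lattice)
    (hgn : IsPrimitiveRoot (om m (-g)) n)
    (hst : ∀ l : ZMod m, Om m l * x ∈ L.lattice → n • l = 0) (hxn : x ∈ L.lattice → n = m) :
    (hamPoly L c a).map (germAt x) ∈ spherical analyticGerms coordGerm n
      (constGerms fun j => mu L m c j (L.lattice.mkQ x)) := by
  choose h hh hhe using fun j => fSum_expansion hL hm hc j hn hg hgn
  have hf : ∀ j, (coordGerm : PGerm) * germAt x (fSum L m c j)
      = toGerm (fun _ => fRes L c x j) + (coordGerm : PGerm) ^ n * toGerm (h j) := fun j =>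
    toGerm_eq_iff.mpr (hhe j)
  have hhO : ∀ j, toGerm (h j) ∈ analyticGerms := fun j => toGerm_mem (hh j)
  have hmap : (hamPoly L c a).map (germAt x)
      = ∏ j ∈ Finset.range m, (X - C (germAt x (fSum L m c j)))
        + ∑ i ∈ Finset.Icc 2 m,
          C (germAt x fun q => a i * iteratedDeriv (i - 2) L.weierstrassP q)
          * ∏ j ∈ Finset.range (m - i), (X - C (germAt x (fSum L m c j))) := by
    simp [hamPoly, Polynomial.map_prod, Polynomial.map_sum]
  rw [hmap]
  -- At lattice points n = m, and the relation defining the a_i is needed. Elsewhere each summand is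
  -- spherical by itself: the derivative of ℘ contributes t^((m-i) mod n), exactly the power that a
  -- product of m - i factors requires.
  by_cases hx : x ∈ L.lattice
  · obtain rfl := hxn hx
    have hd : ∀ i, ∃ d : ℂ → ℂ, AnalyticAt ℂ d 0 ∧ (i ∈ Finset.Icc 2 n → ∀ᶠ t in 𝓝[≠] (0 : ℂ),
        t ^ i * (a i * iteratedDeriv (i - 2) L.weierstrassP (x + t))
          = (-1) ^ i * ((i - 1).factorial : ℂ) * a i + t ^ n * d t) := by
      intro i
      by_cases hi : i ∈ Finset.Icc 2 n
      · obtain ⟨d, hd, hde⟩ := iteratedDeriv_weierstrassP_expansion_zero hL hi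
        refine ⟨fun t => a i * d t, analyticAt_const.mul hd, fun _ => ?_⟩
        filter_upwards [hde] with t ht
        rw [add_comm x, iteratedDeriv_weierstrassP_add L _ hx]
        linear_combination a i * ht
      · exact ⟨0, analyticAt_const, fun h => absurd h hi⟩
    choose d hd hde using hd
    refine ham_mem_spherical_of_relation (ν := fun j => toGerm fun _ => fRes L c x j)
      (e := fun i => toGerm fun _ => (-1) ^ i * ((i - 1).factorial : ℂ) * a i)
      (d := fun i => toGerm (d i)) _ _ _ coordGerm_mem hhO
      (fun j => toGerm_mem analyticAt_const) hf (fun i => toGerm_mem analyticAt_const)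
      (fun i => toGerm_mem (hd i)) (fun i hi => toGerm_eq_iff.mpr (hde i hi)) ?_
    set φ : ℂ →+* PGerm := toGerm.comp (Pi.constRingHom ℂ ℂ) with hφ
    have hφ' : ∀ a : ℂ, toGerm (fun _ => a) = φ a := fun _ => rfl
    have hrel := congrArg (fun F => eval₂ (C.comp φ) (sphP (coordGerm : PGermˣ)) F)
      ha.polynomial_relation
    simp only [eval₂_add, eval₂_finsetProd, eval₂_finsetSum, eval₂_mul, eval₂_sub, eval₂_X, eval₂_C,
      RingHom.comp_apply] at hrel
    have h0 : L.lattice.mkQ x = 0 := mkQ_eq_zero_iff.mpr hx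
    have hfr : ∀ j, fRes L c x j = -muSum L n c j := fun j => if_pos hx
    simp only [constGerms, h0, hfr, hφ']
    exact hrel
  · have hμ : ∀ j, fRes L c x j = mu L m c j (L.lattice.mkQ x) := fun j => if_neg hx
    have hf' : ∀ j, (coordGerm : PGerm) * germAt x (fSum L m c j)
      = (constGerms (fun j => mu L m c j (L.lattice.mkQ x)) j : PGerm)
        + (coordGerm : PGerm) ^ n * toGerm (h j) := fun j => by rw [hf, hμ]; rfl
    have hprod := prod_X_sub_C_mem_spherical coordGerm n
      (constGerms fun j => mu L m c j (L.lattice.mkQ x)) coordGerm_mem hhO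
      (fun j => by simp only [constGerms, mu_mod hc hst]) hf'
    refine add_mem ?_ (sum_mem fun i hi => ?_)
    · have := hprod m
      rwa [Nat.mod_eq_zero_of_dvd hnm, pow_zero, one_mul] at this
    · obtain ⟨d, hd, hde⟩ := iteratedDeriv_weierstrassP_expansion hL hi hx hn hnm hg hgn
      have e : (germAt x fun q => a i * iteratedDeriv (i - 2) L.weierstrassP q)
          = toGerm (fun t => a i * d t) * (coordGerm : PGerm) ^ ((m - i) % n) := by
        refine toGerm_eq_iff.mpr ?_
        filter_upwards [hde] with t ht
        change a i * iteratedDeriv (i - 2) L.weierstrassP (x + t)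
          = a i * d t * t ^ ((m - i) % n)
        rw [ht]
        ring
      rw [e, C_mul, C_pow, mul_assoc]
      exact mul_mem (C_mem_spherical _ _ _ (toGerm_mem (analyticAt_const.mul hd))) (hprod _)

end HamPoly

/-! ### From local sphericity to a global constant. -/

section Global

open Polynomial

variable {L : PeriodPair} {m : ℕ}

lemma eventually_germAt_iff {x : ℂ} {f : ℂ → ℂ} {C : ℂ} :
    germAt x f = toGerm (fun _ => C) ↔ ∀ᶠ w in 𝓝[≠] x, f w = C := by
  rw [germAt_apply, toGerm_eq_iff]
  constructor
  · intro h
    have h1 := tendsto_add_punctured x (-x)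
    rw [add_neg_cancel] at h1
    filter_upwards [h1.eventually h] with w hw
    simpa using hw
  · intro h
    have h1 := tendsto_add_punctured 0 x
    rw [zero_add] at h1
    filter_upwards [h1.eventually h] with t ht
    rw [add_comm]
    exact ht

lemma eq_zero_of_const_eq_mul_pow {C : ℂ} {g : PGerm} (hg : g ∈ analyticGerms) {d : ℕ} (hd : d ≠ 0)
    (h : toGerm (fun _ => C) = g * (coordGerm : PGerm) ^ d) : C = 0 := by
  obtain ⟨f, hf, rfl⟩ := hg
  have h1 : (fun _ => C) =ᶠ[𝓝[≠] (0 : ℂ)] fun t => f t * t ^ d := toGerm_eq_iff.mp h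
  have h2 := eq_of_eventuallyEq_punctured h1 continuousAt_const
    (hf.continuousAt.mul (by fun_prop))
  simpa [hd] using h2

/-- A polynomial in the momentum with elliptic coefficients which is everywhere locally spherical is
constant, if its degree is small enough. -/
lemma exists_const_of_spherical {F : (ℂ → ℂ)[X]}
    (hmem : ∀ x : ℂ, ∃ n : ℕ, 0 < n ∧ (x = 0 → n = m) ∧ ∃ μ : ℕ → ℂ,
      F.map (germAt x) ∈ spherical analyticGerms coordGerm n (constGerms μ))
    (hdeg : F.natDegree < m)
    (hper : ∀ d, ∀ γ ∈ L.lattice, ∀ z, ∀ᶠ w in 𝓝[≠] z, F.coeff d (w + γ) = F.coeff d w) :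
    ∃ C₀ : ℂ, ∀ x, F.map (germAt x) = C (toGerm fun _ => C₀) := by
  -- A top coefficient of the form g t^(d mod n) is regular at every point, hence constant by
  -- Liouville. At 0, where n = m, it carries t^d for d < m, so for d ≠ 0 the constant is zero.
  -- Degrees are measured on germs, since coefficients are controlled only on punctured
  -- neighbourhoods.
  have hcoeff : ∀ d, (∀ x, (F.map (germAt x)).natDegree ≤ d) →
      ∃ C₀ : ℂ, (∀ x, (F.map (germAt x)).coeff d = toGerm fun _ => C₀)
        ∧ (d ≠ 0 → d < m → C₀ = 0) := by
    intro d hd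
    have hreg : ∀ z, IsRegular (F.coeff d) z := by
      intro z
      obtain ⟨n, hn, -, μ, hμ⟩ := hmem z
      obtain ⟨g, hg, he⟩ := coeff_of_mem_spherical _ _ _ hn coordGerm_mem hμ (hd z)
      refine isRegular_of_germAt_mem ?_
      rw [← coeff_map, he]
      exact mul_mem hg (pow_mem coordGerm_mem _)
    obtain ⟨C₀, hC⟩ := eq_const_of_regular L hreg (hper d)
    refine ⟨C₀, fun x => ?_, fun hd0 hdm => ?_⟩
    · rw [coeff_map]
      exact eventually_germAt_iff.mpr (hC x)
    · obtain ⟨n, hn, hnm, μ, hμ⟩ := hmem 0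
      obtain ⟨g, hg, he⟩ := coeff_of_mem_spherical _ _ _ hn coordGerm_mem hμ (hd 0)
      rw [hnm rfl, Nat.mod_eq_of_lt hdm, coeff_map, eventually_germAt_iff.mpr (hC 0)] at he
      exact eq_zero_of_const_eq_mul_pow hg hd0 he
  have hdown : ∀ d, d < m → ∀ x, (F.map (germAt x)).natDegree ≤ m - 1 - d := by
    intro d hd
    induction d with
    | zero => exact fun x => (natDegree_map_le).trans (by omega)
    | succ d ih =>
      have h1 := ih (by omega)
      obtain ⟨C₀, hC, h0⟩ := hcoeff _ h1
      have h2 := h0 (by omega) (by omega)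
      intro x
      rw [← Nat.sub_sub]
      refine natDegree_le_pred (h1 x) ?_
      rw [hC, h2]
      exact map_zero toGerm
  have hzero : ∀ x, (F.map (germAt x)).natDegree ≤ 0 := fun x => by
    have := hdown (m - 1) (by omega) x
    rwa [Nat.sub_self] at this
  obtain ⟨C₀, hC, -⟩ := hcoeff 0 hzero
  refine ⟨C₀, fun x => ?_⟩
  rw [eq_C_of_natDegree_le_zero (hzero x), hC]

variable [NeZero m]

variable (L) in
/-- The difference between the spectral determinant and the hamiltonian, as a polynomial in `p`. -/
def specPoly (c : Family L m) (a : ℕ → ℂ) (α k : ℂ) : (ℂ → ℂ)[X] :=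
  (-1) ^ m * (laxPoly L c α k).det + hamPoly L c a

lemma map_det_laxPoly (c : Family L m) (α k q : ℂ) :
    (laxPoly L c α k).det.map (Pi.evalRingHom (fun _ => ℂ) q)
      = (Matrix.of fun i j : ZMod m => (if i = j then C (om m i) * X - C k else 0)
        + C (laxOff L c α i j q)).det := by
  have h1 : (laxPoly L c α k).det.map (Pi.evalRingHom (fun _ => ℂ) q)
      = ((laxPoly L c α k).map (mapRingHom (Pi.evalRingHom (fun _ => ℂ) q))).det :=
    RingHom.map_det (mapRingHom (Pi.evalRingHom (fun _ => ℂ) q)) _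
  rw [h1]
  congr 1
  ext1 i j
  simp only [laxPoly, Matrix.map_apply, Matrix.of_apply, coe_mapRingHom, Polynomial.map_add, map_C]
  congr 1
  split_ifs <;> simp

lemma map_hamPoly (c : Family L m) (a : ℕ → ℂ) (q : ℂ) :
    (hamPoly L c a).map (Pi.evalRingHom (fun _ => ℂ) q)
      = ∏ j ∈ Finset.range m, (X - C (fSum L m c j q))
        + ∑ i ∈ Finset.Icc 2 m, C (a i * iteratedDeriv (i - 2) L.weierstrassP q)
          * ∏ j ∈ Finset.range (m - i), (X - C (fSum L m c j q)) := by
  simp [hamPoly, Polynomial.map_prod, Polynomial.map_sum]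

lemma eval_specPoly (c : Family L m) (a : ℕ → ℂ) (p q k α : ℂ) :
    ((specPoly L c a α k).map (Pi.evalRingHom (fun _ => ℂ) q)).eval p
      = (-1) ^ m * (lax L m c p q α - k • (1 : Matrix (ZMod m) (ZMod m) ℂ)).det
        + ham L m c a p q := by
  rw [specPoly, Polynomial.map_add, Polynomial.map_mul, map_det_laxPoly, map_hamPoly, eval_add,
    eval_mul]
  congr 1
  · congr 1
    · simp
    · rw [← coe_evalRingHom, RingHom.map_det]
      congr 1
      ext1 i j
      simp only [RingHom.mapMatrix_apply, Matrix.map_apply, Matrix.of_apply, coe_evalRingHom, lax,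
        leftMulMatrix, dunkl, laxOff, Matrix.sub_apply, Matrix.smul_apply, Matrix.one_apply,
        sub_eq_zero, eval_add, eval_C, smul_eq_mul]
      split_ifs with h
      · simp
      · simp
  · simp [ham, eval_prod, eval_finsetSum]

lemma laxOff_add (hL : ∀ γ ∈ L.lattice, om m 1 * γ ∈ L.lattice) (c : Family L m) (α : ℂ) {γ : ℂ}
    (hγ : γ ∈ L.lattice) (i j : ZMod m) (q : ℂ) :
    laxOff L c α i j (q + γ)
      = (gauge L γ α i)⁻¹ * (gauge L γ α j * laxOff L c α i j q) := by
  by_cases hij : i = j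
  · simp [laxOff, hij]
  have h1 : (gauge L γ α i)⁻¹ * gauge L γ α j
      = Complex.exp (-eta L (om m (-i) * γ) * (Om m (-(i - j)) * α)) := by
    rw [mul_comm, gauge_mul_inv, eta_om_mul hL, neg_neg]
    congr 1
    linear_combination eta L γ * α * om_mul_Om_neg i j
  rw [← mul_assoc, h1, laxOff, laxOff, if_neg hij, if_neg hij, mul_add,
    vKer_add_left c _ (om_mul_mem hL _ hγ)]
  ring

/-- Translating q by a period conjugates the Lax matrix by a diagonal gauge, which the determinant
does not see; the hamiltonian is periodic termwise. -/
lemma map_specPoly_add (hL : ∀ γ ∈ L.lattice, om m 1 * γ ∈ L.lattice) (hm : 1 < m)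
    {c : Family L m} (hc : IsCoupling L m c) (a : ℕ → ℂ) (α k : ℂ) {q γ : ℂ}
    (hq : IsNotFixed L m q) (hγ : γ ∈ L.lattice) :
    (specPoly L c a α k).map (Pi.evalRingHom (fun _ => ℂ) (q + γ))
      = (specPoly L c a α k).map (Pi.evalRingHom (fun _ => ℂ) q) := by
  rw [specPoly, Polynomial.map_add, Polynomial.map_add, Polynomial.map_mul, Polynomial.map_mul,
    map_det_laxPoly, map_hamPoly, map_det_laxPoly, map_hamPoly]
  simp only [fSum_add hL hm hc _ hq hγ, iteratedDeriv_weierstrassP_add L _ hγ]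
  congr 1
  congr 1
  · simp
  set N : Matrix (ZMod m) (ZMod m) ℂ[X] := Matrix.of fun i j : ZMod m =>
    (if i = j then C (om m i) * X - C k else 0) + C (laxOff L c α i j q) with hN
  have h1 : (Matrix.of fun i j : ZMod m => (if i = j then C (om m i) * X - C k else 0)
        + C (laxOff L c α i j (q + γ)))
      = Matrix.of fun i j => C (gauge L γ α i)⁻¹ * (Matrix.of fun i j => C (gauge L γ α j) * N i j) i j := by
    ext1 i j
    simp only [hN, Matrix.of_apply, laxOff_add hL c α hγ, C_mul, mul_add]
    congr 1
    split_ifs with h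
    · rw [h, ← mul_assoc, ← C_mul, inv_mul_cancel₀ (gauge_ne_zero γ α j), C_1, one_mul]
    · simp
  rw [h1, Matrix.det_mul_column, Matrix.det_mul_row, ← mul_assoc, ← Finset.prod_mul_distrib]
  rw [Finset.prod_eq_one, one_mul]
  intro i _
  rw [← C_mul, inv_mul_cancel₀ (gauge_ne_zero γ α i), C_1]

lemma natDegree_hamPoly_sub_lt (hm : 1 < m) (c : Family L m) (a : ℕ → ℂ) :
    (hamPoly L c a).natDegree ≤ m ∧ (hamPoly L c a).coeff m = 1 := by
  have hmon : ∀ r, (∏ j ∈ Finset.range r, (X - C (fSum L m c j)) : (ℂ → ℂ)[X]).Monic := fun r =>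
    monic_prod_of_monic _ _ fun j _ => monic_X_sub_C _
  have hdeg : ∀ r, (∏ j ∈ Finset.range r, (X - C (fSum L m c j)) : (ℂ → ℂ)[X]).natDegree = r :=
    fun r => by rw [natDegree_prod_of_monic _ _ fun j _ => monic_X_sub_C _]; simp
  have h2 : (∑ i ∈ Finset.Icc 2 m, C (fun q => a i * iteratedDeriv (i - 2) L.weierstrassP q)
      * ∏ j ∈ Finset.range (m - i), (X - C (fSum L m c j)) : (ℂ → ℂ)[X]).natDegree ≤ m - 1 := by
    refine natDegree_sum_le_of_forall_le _ _ fun i hi => ?_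
    refine (natDegree_C_mul_le _ _).trans ?_
    have := Finset.mem_Icc.mp hi
    rw [hdeg]
    omega
  constructor
  · refine (natDegree_add_le _ _).trans (max_le (hdeg m).le (h2.trans (Nat.sub_le _ _)))
  · rw [hamPoly, coeff_add, coeff_eq_zero_of_natDegree_lt (lt_of_le_of_lt h2 (by omega)), add_zero]
    have := (hmon m).coeff_natDegree
    rwa [hdeg] at this

/-- The p^m-coefficient of the determinant is ∏ ω^i = (-1)^(m+1), so with the sign (-1)^m it cancels
the monic hamiltonian. -/
lemma natDegree_specPoly_lt (hm : 1 < m) (c : Family L m) (a : ℕ → ℂ) (α k : ℂ) :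
    (specPoly L c a α k).natDegree < m := by
  set A : Matrix (ZMod m) (ZMod m) (ℂ → ℂ) := Matrix.diagonal fun i _ => om m i with hA
  set B : Matrix (ZMod m) (ZMod m) (ℂ → ℂ) := Matrix.of fun i j =>
    (if i = j then -fun _ => k else 0) + laxOff L c α i j with hB
  have h1 : laxPoly L c α k = (X : (ℂ → ℂ)[X]) • A.map C + B.map C := by
    ext1 i j
    simp only [laxPoly, hA, hB, Matrix.of_apply, Matrix.add_apply, Matrix.smul_apply,
      Matrix.map_apply, Matrix.diagonal_apply, smul_eq_mul]
    split_ifs with h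
    · rw [C_add, C_neg]
      ring
    · simp
  have h2 := natDegree_det_X_add_C_le A B
  have h3 := coeff_det_X_add_C_card A B
  rw [← h1, ZMod.card] at h2 h3
  obtain ⟨h4, h5⟩ := natDegree_hamPoly_sub_lt hm c a
  have h6 : ((-1) ^ m : (ℂ → ℂ)[X]) = C ((-1) ^ m) := by simp
  have h7 : A.det = (-1) ^ (m + 1) := by
    rw [hA, Matrix.det_diagonal]
    funext q
    rw [Finset.prod_apply, prod_om]
    rfl
  have h8 : (specPoly L c a α k).natDegree ≤ m := by
    refine (natDegree_add_le _ _).trans (max_le ?_ h4)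
    rw [h6]
    exact (natDegree_C_mul_le _ _).trans h2
  have h9 : (specPoly L c a α k).coeff m = 0 := by
    rw [specPoly, coeff_add, h5, h6, coeff_C_mul, h3, h7, ← pow_add, show m + (m + 1) = 2 * m + 1 by ring,
      pow_succ, pow_mul]
    simp
  exact lt_of_le_of_lt (natDegree_le_pred h8 h9) (by omega)

lemma specPoly_mem (hL : ∀ γ ∈ L.lattice, om m 1 * γ ∈ L.lattice) (hm : 1 < m)
    {c : Family L m} (hc : IsCoupling L m c) {a : ℕ → ℂ} (ha : IsHamCoeff L m c a) {α : ℂ}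
    (hα : IsNotFixed L m α) (k x : ℂ) : ∃ n : ℕ, 0 < n ∧ (x = 0 → n = m) ∧ ∃ μ : ℕ → ℂ,
      (specPoly L c a α k).map (germAt x) ∈ spherical analyticGerms coordGerm n (constGerms μ) := by
  obtain ⟨n, g, hn, hnm, hg, hgn, hst, hxn⟩ := exists_generator hL x
  refine ⟨n, hn, fun h => hxn (h ▸ zero_mem _), fun j => mu L m c j (L.lattice.mkQ x), ?_⟩
  rw [specPoly, Polynomial.map_add, Polynomial.map_mul]
  refine add_mem (mul_mem ?_ (det_laxPoly_mem hL hc x hα k hn hnm hg hgn hst))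
    (hamPoly_mem hL hm hc ha x hn hnm hg hgn hst hxn)
  rw [Polynomial.map_pow, Polynomial.map_neg, Polynomial.map_one]
  exact pow_mem (neg_mem (one_mem _)) m

lemma analyticAt_vKer_left (hL : ∀ γ ∈ L.lattice, om m 1 * γ ∈ L.lattice) {c : Family L m}
    (hc : IsCoupling L m c) {l : ZMod m} (hl : l ≠ 0) {x : ℂ} (hx : Om m l * x ∉ L.lattice) (z : ℂ) :
    AnalyticAt ℂ (fun x => vKer L m c l x z) x := by
  simp only [vKer_eq_sum hL hc hl]
  refine Finset.analyticAt_fun_sum _ fun y hy => analyticAt_const.mul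
    (analyticAt_vTerm_left _ (fun h => hx ?_) _)
  have h1 := Om_mul_mem hL l h
  rwa [mul_sub, mem_lattice_sub_iff L (by simpa [mem_fixedPoints] using hy)] at h1

lemma continuousAt_ham (hL : ∀ γ ∈ L.lattice, om m 1 * γ ∈ L.lattice) (hm : 1 < m)
    {c : Family L m} (hc : IsCoupling L m c) (a : ℕ → ℂ) (p : ℂ) {q : ℂ} (hq : IsNotFixed L m q) :
    ContinuousAt (ham L m c a p) q := by
  have hf : ∀ r, ContinuousAt (fun q => ∏ j ∈ Finset.range r, (p - fSum L m c j q)) q := fun r =>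
    tendsto_finsetProd _ fun j _ =>
      (continuousAt_const.sub (analyticAt_fSum hL hm hc j hq).continuousAt).tendsto
  unfold ham
  refine (hf m).add (tendsto_finsetSum _ fun i _ => ?_)
  exact ((continuousAt_const.mul (analyticAt_iteratedDeriv_weierstrassP L (i - 2)
    (hq.notMem hL hm)).continuousAt).mul (hf (m - i))).tendsto

lemma continuousAt_det_lax (hL : ∀ γ ∈ L.lattice, om m 1 * γ ∈ L.lattice)
    {c : Family L m} (hc : IsCoupling L m c) (p k α : ℂ) {q : ℂ} (hq : IsNotFixed L m q) :
    ContinuousAt (fun q => (lax L m c p q α - k • (1 : Matrix (ZMod m) (ZMod m) ℂ)).det) q := by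
  refine ContinuousAt.comp (g := Matrix.det)
    (continuous_id.matrix_det.continuousAt) (ContinuousAt.sub ?_ continuousAt_const)
  refine continuousAt_pi.mpr fun i => continuousAt_pi.mpr fun j => ?_
  simp only [lax, leftMulMatrix, dunkl, Matrix.of_apply]
  by_cases hij : i - j = 0
  · simp only [hij, if_true]
    exact continuousAt_const
  · simp only [hij, if_false]
    refine ContinuousAt.neg ?_
    refine ((analyticAt_vKer_left hL hc hij (x := om m (-i) * q) ?_ α).fun_comp
      (f := fun q => om m (-i) * q) (by fun_prop)).continuousAt
    rw [mul_left_comm, om_mul_mem_iff hL]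
    exact hq _ hij

/-- The characteristic polynomial of the Lax matrix is the hamiltonian, up to a constant. -/
lemma exists_det_lax_eq (hL : ∀ γ ∈ L.lattice, om m 1 * γ ∈ L.lattice) (hm : 1 < m)
    {c : Family L m} (hc : IsCoupling L m c) {a : ℕ → ℂ} (ha : IsHamCoeff L m c a) {α : ℂ}
    (hα : IsNotFixed L m α) (k : ℂ) : ∃ C₀ : ℂ, ∀ p q, IsNotFixed L m q →
      (-1) ^ m * (lax L m c p q α - k • (1 : Matrix (ZMod m) (ZMod m) ℂ)).det
        = C₀ - ham L m c a p q := by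
  obtain ⟨C₀, hC⟩ := exists_const_of_spherical (L := L) (specPoly_mem hL hm hc ha hα k)
    (natDegree_specPoly_lt hm c a α k) fun d γ hγ z => by
      filter_upwards [eventually_isNotFixed (L := L) (m := m) z] with w hw
      have := congrArg (fun F => F.coeff d) (map_specPoly_add hL hm hc a α k hw hγ)
      simpa only [coeff_map, Pi.evalRingHom_apply] using this
  refine ⟨C₀, fun p q hq => ?_⟩
  have h1 : ∀ᶠ w in 𝓝[≠] q, ∀ d ∈ Finset.range m,
      (specPoly L c a α k).coeff d w = if d = 0 then C₀ else 0 := by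
    rw [Finset.eventually_all]
    intro d _
    have h2 := congrArg (fun F => F.coeff d) (hC q)
    simp only [coeff_map, coeff_C] at h2
    split_ifs at h2 ⊢ with hd
    · exact eventually_germAt_iff.mp h2
    · exact eventually_germAt_iff.mp (h2.trans (map_zero toGerm).symm)
  have h2 : (fun w => (-1) ^ m * (lax L m c p w α - k • (1 : Matrix (ZMod m) (ZMod m) ℂ)).det
      + ham L m c a p w) =ᶠ[𝓝[≠] q] fun _ => C₀ := by
    filter_upwards [h1] with w hw
    have h3 : (specPoly L c a α k).map (Pi.evalRingHom (fun _ => ℂ) w) = C C₀ := by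
      ext d
      rw [coeff_map, Pi.evalRingHom_apply, coeff_C]
      by_cases hd : d < m
      · exact hw d (Finset.mem_range.mpr hd)
      · rw [coeff_eq_zero_of_natDegree_lt
          ((natDegree_specPoly_lt hm c a α k).trans_le (not_lt.mp hd)), if_neg (by omega)]
        rfl
    rw [← eval_specPoly, h3, eval_C]
  -- The germ identity holds only around q; continuity at points that are not fixed gives it at q.
  have h3 := eq_of_eventuallyEq_punctured h2
    ((continuousAt_const.mul (continuousAt_det_lax hL hc p k α hq)).add
      (continuousAt_ham hL hm hc a p hq)) continuousAt_const
  exact eq_sub_of_add_eq h3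

end Global

/-! ### Existence and uniqueness of the constants a_i. -/

section Coefficients

open Polynomial

lemma exists_eq_sum_of_monic {B : ℕ → ℂ[X]} (hB : ∀ r, (B r).Monic) (hd : ∀ r, (B r).natDegree = r)
    (s : ℕ) {F : ℂ[X]} (hF : F.degree < s) :
    ∃ b : ℕ → ℂ, F = ∑ r ∈ Finset.range s, C (b r) * B r := by
  induction s generalizing F with
  | zero =>
    refine ⟨0, ?_⟩
    rw [Nat.cast_zero, Nat.WithBot.lt_zero_iff, degree_eq_bot] at hF
    simp [hF]
  | succ s ih =>
    obtain ⟨b, hb⟩ := ih (F := F - C (F.coeff s) * B s) (by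
      rw [degree_lt_iff_coeff_zero] at hF ⊢
      intro r hr
      rw [coeff_sub, coeff_C_mul]
      rcases hr.eq_or_lt with rfl | h
      · have := (hB s).coeff_natDegree
        rw [hd] at this
        rw [this, mul_one, sub_self]
      · rw [hF r h, coeff_eq_zero_of_natDegree_lt (p := B s) (by rw [hd]; exact h), mul_zero,
          sub_zero])
    refine ⟨Function.update b s (F.coeff s), ?_⟩
    rw [Finset.sum_range_succ, Function.update_self, ← sub_eq_iff_eq_add, hb]
    refine Finset.sum_congr rfl fun r hr => ?_
    rw [Function.update_of_ne (Finset.mem_range.mp hr).ne]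

lemma eq_zero_of_sum_monic_eq_zero {B : ℕ → ℂ[X]} (hB : ∀ r, (B r).Monic)
    (hd : ∀ r, (B r).natDegree = r) (s : ℕ) {b : ℕ → ℂ}
    (h : ∑ r ∈ Finset.range s, C (b r) * B r = 0) : ∀ r < s, b r = 0 := by
  induction s with
  | zero => simp
  | succ s ih =>
    have h1 := congrArg (fun F => F.coeff s) h
    have h2 : ∀ r ∈ Finset.range s, b r * (B r).coeff s = 0 := fun r hr => by
      rw [coeff_eq_zero_of_natDegree_lt (by rw [hd]; exact Finset.mem_range.mp hr),
        mul_zero]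
    have h3 := (hB s).coeff_natDegree
    rw [hd] at h3
    simp only [Finset.sum_range_succ, coeff_add, finsetSum_coeff, Finset.sum_eq_zero h2, coeff_C_mul,
      h3, mul_one, zero_add, coeff_zero] at h1
    rw [Finset.sum_range_succ, h1, C_0, zero_mul, add_zero] at h
    intro r hr
    rcases Nat.lt_succ_iff_lt_or_eq.mp hr with h4 | rfl
    · exact ih h r h4
    · exact h1

lemma sum_Icc_two_eq_sum_range {M : Type*} [AddCommMonoid M] (m : ℕ) (G : ℕ → M) :
    ∑ i ∈ Finset.Icc 2 m, G i = ∑ r ∈ Finset.range (m - 1), G (m - r) := by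
  refine Finset.sum_nbij' (fun i => m - i) (fun r => m - r) ?_ ?_ ?_ ?_ ?_
  · intro i hi; simp only [Finset.mem_Icc, Finset.mem_range] at hi ⊢; omega
  · intro i hi; simp only [Finset.mem_Icc, Finset.mem_range] at hi ⊢; omega
  · intro i hi; simp only [Finset.mem_Icc] at hi; omega
  · intro i hi; simp only [Finset.mem_range] at hi; omega
  · intro i hi
    simp only [Finset.mem_Icc] at hi
    congr 1
    omega

variable {L : PeriodPair} {m : ℕ} [NeZero m]

/-- Summing the characters over j kills every l ≠ 0, and c_0 = 0. This makes the
p^(m-1)-coefficients vanish, so the expansion of the hamiltonian starts at i = 2. -/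
lemma sum_mu {c : Family L m} (hc : IsCoupling L m c) (y : Curve L) :
    ∑ j ∈ Finset.range m, mu L m c j y = 0 := by
  have h1 : ∑ j ∈ Finset.range m, mu L m c j y
      = ∑ i : ZMod m, ∑ l : ZMod m, om m (-i * l) * c l y := by
    refine Finset.sum_nbij' (fun j => (j : ZMod m)) ZMod.val (by simp) ?_ ?_ (by simp)
      fun j _ => rfl
    · exact fun i _ => Finset.mem_range.mpr (ZMod.val_lt i)
    · exact fun j hj => ZMod.val_cast_of_lt (Finset.mem_range.mp hj)
  rw [h1, Finset.sum_comm]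
  refine Finset.sum_eq_zero fun l _ => ?_
  rw [← Finset.sum_mul]
  by_cases hl : l = 0
  · rw [hl, hc.index_zero, mul_zero]
  · have h2 : ∀ i : ZMod m, om m (-i * l) = om m (-l * i) := fun i => by congr 1; ring
    simp only [h2, sum_om_mul, neg_eq_zero, hl, if_false, zero_mul]

lemma isHamCoeff_of_polynomial_relation {c : Family L m} {a : ℕ → ℂ}
    (h0 : ∀ i, i ∉ Finset.Icc 2 m → a i = 0)
    (h : (∏ j ∈ Finset.range m, (X - C (mu L m c j 0)) : ℂ[X])
      = ∏ j ∈ Finset.range m, (X - C (-muSum L m c j))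
        + ∑ i ∈ Finset.Icc 2 m, C ((-1) ^ i * ((i - 1).factorial : ℂ) * a i)
            * ∏ j ∈ Finset.range (m - i), (X - C (-muSum L m c j))) : IsHamCoeff L m c a where
  eq_zero := h0
  relation p q hq := by
    have h1 := congrArg (eval (p * q)) h
    simp only [eval_prod, eval_add, eval_finsetSum, eval_mul, eval_sub, eval_X, eval_C,
      sub_neg_eq_add] at h1
    have h2 : ∀ (r : ℕ) (f : ℕ → ℂ), ∏ j ∈ Finset.range r, (p * q + f j)
        = q ^ r * ∏ j ∈ Finset.range r, (p + f j / q) := by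
      intro r f
      have : q ^ r = ∏ _j ∈ Finset.range r, q := by simp
      rw [this, ← Finset.prod_mul_distrib]
      refine Finset.prod_congr rfl fun j _ => ?_
      field_simp
    have h3 : ∀ f : ℕ → ℂ, ∏ j ∈ Finset.range m, (p * q - f j)
        = q ^ m * ∏ j ∈ Finset.range m, (p - f j / q) := by
      intro f
      simpa only [sub_eq_add_neg, neg_div] using h2 m fun j => -f j
    have hqm : q ^ m ≠ 0 := pow_ne_zero _ hq
    rw [h3, h2] at h1
    refine mul_left_cancel₀ hqm ?_
    rw [h1, mul_add, Finset.mul_sum]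
    congr 1
    refine Finset.sum_congr rfl fun i hi => ?_
    have h4 : q ^ m = q ^ i * q ^ (m - i) := by
      rw [← pow_add, Nat.add_sub_cancel' (Finset.mem_Icc.mp hi).2]
    have h5 : q ^ i ≠ 0 := pow_ne_zero _ hq
    rw [h2, h4]
    field_simp

/-- The coefficients of the hamiltonian exist and are unique. -/
lemma existsUnique_isHamCoeff (hL : ∀ γ ∈ L.lattice, om m 1 * γ ∈ L.lattice) (hm : 1 < m)
    {c : Family L m} (hc : IsCoupling L m c) : ∃! a : ℕ → ℂ, IsHamCoeff L m c a := by
  set B : ℕ → ℂ[X] := fun r => ∏ j ∈ Finset.range r, (X - C (-muSum L m c j)) with hBdef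
  have hmon : ∀ (r : ℕ) (f : ℕ → ℂ), (∏ j ∈ Finset.range r, (X - C (f j)) : ℂ[X]).Monic :=
    fun r f => monic_prod_of_monic _ _ fun j _ => monic_X_sub_C _
  have hdeg : ∀ (r : ℕ) (f : ℕ → ℂ), (∏ j ∈ Finset.range r, (X - C (f j)) : ℂ[X]).natDegree = r :=
    fun r f => by rw [natDegree_prod_of_monic _ _ fun j _ => monic_X_sub_C _]; simp
  have hcoef : ∀ f : ℕ → ℂ, (∏ j ∈ Finset.range m, (X - C (f j)) : ℂ[X]).coeff (m - 1)
      = -∑ j ∈ Finset.range m, f j := fun f => by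
    have := prod_X_sub_C_coeff_card_pred (Finset.range m) f (by simpa using NeZero.pos m)
    rwa [Finset.card_range] at this
  have hfac : ∀ i, (-1 : ℂ) ^ i * ((i - 1).factorial : ℂ) ≠ 0 := fun i =>
    mul_ne_zero (pow_ne_zero _ (by norm_num)) (Nat.cast_ne_zero.mpr (Nat.factorial_ne_zero _))
  have hsum : ∑ j ∈ Finset.range m, -muSum L m c j = 0 := by
    simp only [muSum_eq_sum hL hc, Finset.sum_neg_distrib]
    rw [Finset.sum_comm, Finset.sum_eq_zero fun y _ => sum_mu hc y, neg_zero]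
  -- Both products are monic of degree m with zero p^(m-1)-coefficient, so their difference has
  -- degree below m - 1 and expands uniquely in the monic B r with r = m - i.
  obtain ⟨b, hb⟩ := exists_eq_sum_of_monic (B := B) (fun r => hmon r _) (fun r => hdeg r _) (m - 1)
    (F := ∏ j ∈ Finset.range m, (X - C (mu L m c j 0)) - B m) (by
      rw [degree_lt_iff_coeff_zero]
      intro r hr
      rw [coeff_sub, sub_eq_zero]
      rcases lt_trichotomy r m with h | h | h
      · obtain rfl : r = m - 1 := by omega
        rw [hcoef, hBdef, hcoef, hsum, sum_mu hc]
      · have h1 := (hmon m fun j => mu L m c j 0).coeff_natDegree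
        have h2 := (hmon m fun j => -muSum L m c j).coeff_natDegree
        rw [hdeg] at h1 h2
        rw [h, h1, hBdef, h2]
      · rw [coeff_eq_zero_of_natDegree_lt (by rw [hdeg]; exact h),
          coeff_eq_zero_of_natDegree_lt (by rw [hBdef, hdeg]; exact h)])
  refine ⟨fun i => if i ∈ Finset.Icc 2 m then
    ((-1 : ℂ) ^ i * ((i - 1).factorial : ℂ))⁻¹ * b (m - i) else 0, ?_, ?_⟩
  · refine isHamCoeff_of_polynomial_relation (fun i hi => if_neg hi) ?_
    rw [sub_eq_iff_eq_add'] at hb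
    rw [hb]
    congr 1
    rw [sum_Icc_two_eq_sum_range]
    refine Finset.sum_congr rfl fun r hr => ?_
    have hr' := Finset.mem_range.mp hr
    have h1 : m - (m - r) = r := by omega
    rw [if_pos (Finset.mem_Icc.mpr ⟨by omega, by omega⟩), mul_inv_cancel_left₀ (hfac _), h1]
  · intro a ha
    have h1 := ha.polynomial_relation
    rw [← sub_eq_iff_eq_add', hb, sum_Icc_two_eq_sum_range, ← sub_eq_zero,
      ← Finset.sum_sub_distrib] at h1
    have h2 := eq_zero_of_sum_monic_eq_zero (B := B) (fun r => hmon r _) (fun r => hdeg r _) (m - 1)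
      (b := fun r => b r - (-1) ^ (m - r) * ((m - r - 1).factorial : ℂ) * a (m - r)) (by
        rw [← h1]
        refine Finset.sum_congr rfl fun r hr => ?_
        have hr' := Finset.mem_range.mp hr
        have h3 : m - (m - r) = r := by omega
        rw [C_sub, sub_mul, h3])
    funext i
    split_ifs with hi
    · have hi' := Finset.mem_Icc.mp hi
      have h3 := h2 (m - i) (by omega)
      have h4 : m - (m - i) = i := by omega
      rw [h4, sub_eq_zero] at h3
      rw [h3, inv_mul_cancel_left₀ (hfac i)]
    · exact ha.eq_zero i hi

end Coefficients

/-! ### The additive constant and its sign under duality. -/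

section SpectralConstant

variable {L : PeriodPair} {m : ℕ} [NeZero m]

variable (L m) in
lemma exists_isNotFixed : ∃ q, IsNotFixed L m q := (eventually_isNotFixed (L := L) (m := m) 0).exists

variable (L) in
/-- `K` is the additive constant in the spectral equation. -/
def IsSpectralConstant (c : Family L m) (K : ℂ) : Prop :=
  ∀ a b : ℕ → ℂ, IsHamCoeff L m c a → IsHamCoeff L m (dual L m c) b →
    ∀ p q k α : ℂ, IsNotFixed L m q → IsNotFixed L m α →
      (-1) ^ m * (lax L m c p q α - k • (1 : Matrix (ZMod m) (ZMod m) ℂ)).det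
        = ham L m (dual L m c) b k α - ham L m c a p q + K

/-- For fixed (k, α) the determinant is K₁(k, α) - h(p, q). At a base point p = 0, q = z,
determinant duality turns it into the determinant of the dual Lax matrix, and the same statement for
c^∨ shows that K₁ is h^∨(k, α) plus a constant. -/
lemma exists_isSpectralConstant (hL : ∀ γ ∈ L.lattice, om m 1 * γ ∈ L.lattice) (hm : 1 < m)
    {c : Family L m} (hc : IsCoupling L m c) : ∃ K, IsSpectralConstant L c K := by
  have hc' := isCoupling_dual hL hc
  obtain ⟨a, ha, hau⟩ := existsUnique_isHamCoeff hL hm hc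
  obtain ⟨b, hb, hbu⟩ := existsUnique_isHamCoeff hL hm hc'
  obtain ⟨z, hz⟩ := exists_isNotFixed L m
  obtain ⟨K, hK⟩ := exists_det_lax_eq hL hm hc' hb hz 0
  refine ⟨ham L m c a 0 z - K, ?_⟩
  intro a' b' ha' hb' p q k α hq hα
  obtain rfl := hau a' ha'
  obtain rfl := hbu b' hb'
  obtain ⟨K₁, h₁⟩ := exists_det_lax_eq hL hm hc ha hα k
  have e₁ := h₁ p q hq
  have e₂ := h₁ 0 z hz
  have e₃ := hK k α hα
  rw [det_lax_duality hL hc 0 z k α hz hα] at e₂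
  linear_combination e₁ - e₂ - e₃

/-- Passing to the dual couplings reverses the sign of the determinant and of the difference of
hamiltonians, hence of the constant; involutivity of duality identifies the bidual hamiltonian with
the original one. -/
lemma IsSpectralConstant.dual (hL : ∀ γ ∈ L.lattice, om m 1 * γ ∈ L.lattice) (hm : 1 < m)
    {c : Family L m} (hc : IsCoupling L m c) {K K' : ℂ} (hK : IsSpectralConstant L c K)
    (hK' : IsSpectralConstant L (dual L m c) K') : K' = -K := by
  obtain ⟨a, ha, -⟩ := existsUnique_isHamCoeff hL hm hc
  obtain ⟨b, hb, -⟩ := existsUnique_isHamCoeff hL hm (isCoupling_dual hL hc)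
  obtain ⟨z, hz⟩ := exists_isNotFixed L m
  have e₁ := hK a b ha hb 0 z 0 z hz hz
  have e₂ := hK' b a hb (by rwa [dual_dual hL hc]) 0 z 0 z hz hz
  rw [dual_dual hL hc] at e₂
  rw [det_lax_duality hL hc 0 z 0 z hz hz] at e₁
  linear_combination -e₁ - e₂

end SpectralConstant

end

end EllipticDunkl

theorem mainTheorem3 (L : PeriodPair) (m : ℕ) [NeZero m] (hm : m = 2 ∨ m = 3 ∨ m = 4 ∨ m = 6)
    (hL : ∀ γ ∈ L.lattice, om m 1 * γ ∈ L.lattice) :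
    (∀ c : Family L m, IsCoupling L m c →
      IsCoupling L m (dual L m c) ∧
      (∀ l : ZMod m, l ≠ 0 → ∀ x z : ℂ, Om m l * x ∉ L.lattice → Om m l * z ∉ L.lattice →
        vKer L m c l x z = -vKer L m (dual L m c) (-l) z x) ∧
      (∀ p q k α : ℂ, IsNotFixed L m q → IsNotFixed L m α →
        (lax L m c p q α - k • (1 : Matrix (ZMod m) (ZMod m) ℂ)).det
          = -(lax L m (dual L m c) k α q - p • (1 : Matrix (ZMod m) (ZMod m) ℂ)).det) ∧
      (∃! a : ℕ → ℂ, IsHamCoeff L m c a)) ∧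
    (∃ κ : Family L m → ℂ, ∀ c : Family L m, IsCoupling L m c →
      ∀ a b : ℕ → ℂ, IsHamCoeff L m c a → IsHamCoeff L m (dual L m c) b →
        ∀ p q k α : ℂ, IsNotFixed L m q → IsNotFixed L m α →
          (-1) ^ m * (lax L m c p q α - k • (1 : Matrix (ZMod m) (ZMod m) ℂ)).det
            = (ham L m (dual L m c) b k α + κ (dual L m c)) - (ham L m c a p q + κ c)) := by
  have hm1 : 1 < m := by omega
  refine ⟨fun c hc => ⟨isCoupling_dual hL hc, fun l hl x z hx hz => vKer_duality hL hc hl hx hz,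
    det_lax_duality hL hc, existsUnique_isHamCoeff hL hm1 hc⟩, ?_⟩
  choose! K hK using fun (c : Family L m) (hc : IsCoupling L m c) =>
    exists_isSpectralConstant hL hm1 hc
  -- The requirement is κ(c^∨) - κ(c) = K(c), and K(c^∨) = -K(c) makes -K/2 a solution for all
  -- couplings at once.
  refine ⟨fun c => -K c / 2, fun c hc a b ha hb p q k α hq hα => ?_⟩
  have h := (hK c hc).dual hL hm1 hc (hK _ (isCoupling_dual hL hc))
  rw [hK c hc a b ha hb p q k α hq hα]
  linear_combination h / 2
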